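/- Let $\mu:\mathbb R^2\to\mathbb R$ be measurable, $1$-periodic in each variable, bounded between two positive constants, and of cubic symmetry: $\mu(-x_2,x_1)=\mu(x_1,x_2)$ for all $(x_1,x_2)$. Write $\langle f\rangle=\int_{[0,1]^2}f\,d\mathbf x$ and $(u,v)=\langle u\overline v\rangle$. **Effective coefficient.** For a unit vector $\boldsymbol\kappa\in\mathbb R^2$ put $\mathcal C_0u=-\nabla\cdot\mu\nabla u$ and $\mathcal C_1u=-i\boldsymbol\kappa\cdot\mu\nabla u-i\nabla\cdot(\mu\boldsymbol\kappa u)$ (weakly, on the periodic Sobolev space $H^1$), let $u_1\equiv1$ and $$\mu_{\rm eff}=\langle\mu\rangle-(\mathcal C_1\mathcal C_0^{-1}\mathcal C_1u_1,u_1),$$ where $\mathcal C_0^{-1}\mathcal C_1u_1$ is any $h\in H^1$ with $\mathcal C_0h=\mathcal C_1u_1$. **PWE bounds.** With the Fourier coefficients $\widehat\mu(\mathbf g)=\int_{[0,1]^2}\mu(\mathbf x)e^{-2\pi i\mathbf g\cdot\mathbf x}d\mathbf x$ and $N\ge0$ let $\mathcal C_{NN,0}=(\widehat\mu(\mathbf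 g-\mathbf g')\,\mathbf g\cdot\mathbf g')_{|g_i|,|g_i'|\le N}$, $\mathbf f_{NN}=(\widehat\mu(\mathbf g)g_1)_{|g_i|\le N}$ and $$\mu_{NN}(\mu)=\langle\mu\rangle-\mathbf f_{NN}\cdot\mathcal C_{NN,0}^{-1}\mathbf f_{NN},\qquad \tilde\mu_{NN}=1/\mu_{NN}(\mu^{-1}).$$ **MM bounds.** With $\widehat\mu_n(x_1)=\int_0^1\mu(x_1,x_2)e^{-2\pi inx_2}dx_2$ let $\widehat{\boldsymbol\mu}_N(x_1)=(\widehat\mu_{n-m}(x_1))_{n,m=-N}^N$, $\boldsymbol\partial_N=2\pi\,\mathrm{diag}(n)_{n=-N}^N$, $$\mathbf Q_N=\begin{pmatrix}\mathbf 0&\widehat{\boldsymbol\mu}_N^{-1}\\ \boldsymbol\partial_N\widehat{\boldsymbol\mu}_N\boldsymbol\partial_N&\mathbf 0\end{pmatrix},$$ and let the $(4N+2)\times(4N+2)$ matrix $\mathbf M_N$ be the multiplicative integral of $\mathbf I+\mathbf Q_N\,dx_1$ over $[0,1]$, i.e. the sum of the Peano series $\mathbf I+\int_0^1\mathbf Q_N(y_1)dy_1+\int_0^1\int_0^{y_1}\mathbf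 Q_N(y_1)\mathbf Q_N(y_2)\,dy_2dy_1+\dots$. With $\mathbf e=(\delta_{0n})_{n=-N}^N$, $\mathbf w_1=(\mathbf e,\mathbf 0)^\top$ and $\mathbf w_2=(\mathbf 0,\mathbf e)^\top$ let $$\mu_N(\mu)=\mathbf w_2\cdot(\mathbf M_N-\mathbf I)^{-1}\mathbf w_1,\qquad \tilde\mu_N=1/\mu_N(\mu^{-1}).$$ Here $\mathcal C_{NN,0}^{-1}\mathbf f_{NN}$ and $(\mathbf M_N-\mathbf I)^{-1}\mathbf w_1$ stand for any preimages. **Theorem.** All these quantities are well defined: $\widehat{\boldsymbol\mu}_N(x_1)$ is invertible for every $x_1$, the Peano series converges, the preimages and $h$ exist, the resulting values are real and do not depend on the choice of the preimages and of $h$, and $\mu_N$, $\mu_{NN}$ and the corresponding values for $\mu^{-1}$ are positive. If $\mu$ is continuous almost everywhere, $\mathbf M_N$ is also the limit as $k\to\infty$ of the products $\prod_{j=0}^{k}(\mathbf I+\frac1k\mathbf Q_N(\frac jk))$ (factors with larger $j$ to the left), and likewise for $\mu^{-1}$. For every unit vector $\boldsymbol\kappa$: (i) the sequence $\mu_N$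 is non-increasing and converges to $\mu_{\rm eff}$, and the sequence $\tilde\mu_N$ is non-decreasing and converges to $\mu_{\rm eff}$, as $N\to\infty$; (ii) $\tilde\mu_{NN}\le\tilde\mu_N\le\mu_{\rm eff}\le\mu_N\le\mu_{NN}$ for every $N\ge0$; hence $|\mu_N-\mu_{\rm eff}|\le|\mu_{NN}-\mu_{\rm eff}|$ and $|\tilde\mu_N-\mu_{\rm eff}|\le|\tilde\mu_{NN}-\mu_{\rm eff}|$ for every $N\ge0$. -/

import Mathlib

open Set Filter Topology MeasureTheory
open scoped Matrix ContDiff ComplexConjugate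

noncomputable section

namespace Phononic

/-! ### The unit cell, means and Fourier coefficients -/

/-- The closed square unit cell `[0,1]²`. -/
def cell : Set (ℝ × ℝ) := Icc (0 : ℝ) 1 ×ˢ Icc (0 : ℝ) 1

/-- The function `f` on the plane is `1`-periodic in each of its two arguments. -/
def IsPeriodic {α : Type*} (f : ℝ × ℝ → α) : Prop :=
  ∀ x : ℝ × ℝ, f (x.1 + 1, x.2) = f x ∧ f (x.1, x.2 + 1) = f x

/-- Cubic symmetry: invariance under the rotation `(x₁, x₂) ↦ (-x₂, x₁)` by `π/2`. -/
def IsCubic (μ : ℝ × ℝ → ℝ) : Prop := ∀ x : ℝ × ℝ, μ (-x.2, x.1) = μ x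

/-- The mean `⟨f⟩` of `f` over the unit cell. -/
def mean (f : ℝ × ℝ → ℂ) : ℂ := ∫ x in cell, f x

/-- The double Fourier coefficient `μ̂(g)`, `g ∈ ℤ²`. -/
def fourier2 (μ : ℝ × ℝ → ℝ) (g : ℤ × ℤ) : ℂ :=
  ∫ x in cell, (μ x : ℂ) *
    Complex.exp (-(2 * Real.pi * Complex.I * ((g.1 : ℂ) * (x.1 : ℂ) + (g.2 : ℂ) * (x.2 : ℂ))))

/-- The Fourier coefficient `μ̂ₙ(x₁)` of `μ` with respect to the second variable. -/
def fourier1 (μ : ℝ × ℝ → ℝ) (n : ℤ) (x₁ : ℝ) : ℂ :=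
  ∫ x₂ in Icc (0 : ℝ) 1, (μ (x₁, x₂) : ℂ) *
    Complex.exp (-(2 * Real.pi * Complex.I * ((n : ℂ) * (x₂ : ℂ))))

/-! ### The periodic Sobolev space and the effective coefficient -/

/-- Smooth `1`-periodic complex test functions. -/
def IsTest (φ : ℝ × ℝ → ℂ) : Prop := ContDiff ℝ ∞ φ ∧ IsPeriodic φ

/-- `d` is the weak derivative of `u` in the direction `e`, on the torus. -/
def HasWeakDeriv (u d : ℝ × ℝ → ℂ) (e : ℝ × ℝ) : Prop :=
  ∀ φ : ℝ × ℝ → ℂ, IsTest φ →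
    ∫ x in cell, u x * fderiv ℝ φ x e = -∫ x in cell, d x * φ x

/-- An element of the periodic Sobolev space `H¹` of the unit cell: a function in `L²`
together with its weak partial derivatives, which are also in `L²`. -/
structure H1Per where
  val : ℝ × ℝ → ℂ
  d1 : ℝ × ℝ → ℂ
  d2 : ℝ × ℝ → ℂ
  memLp_val : MemLp val 2 (volume.restrict cell)
  memLp_d1 : MemLp d1 2 (volume.restrict cell)
  memLp_d2 : MemLp d2 2 (volume.restrict cell)
  weak_d1 : HasWeakDeriv val d1 (1, 0)
  weak_d2 : HasWeakDeriv val d2 (0, 1)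

theorem integral_deriv_test_fst {φ : ℝ × ℝ → ℂ} (hφ : IsTest φ) :
    ∫ x in cell, fderiv ℝ φ x (1, 0) = 0 := by
  have hc : Continuous fun x => fderiv ℝ φ x (1, 0) :=
    (hφ.1.continuous_fderiv (by simp)).clm_apply continuous_const
  have hint : IntegrableOn (fun x => fderiv ℝ φ x (1, 0)) cell (volume.prod volume) :=
    hc.continuousOn.integrableOn_compact (isCompact_Icc.prod isCompact_Icc)
  have h0 : ∀ y : ℝ, ∫ x in Icc (0 : ℝ) 1, fderiv ℝ φ (x, y) (1, 0) = 0 := by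
    intro y
    rw [integral_Icc_eq_integral_Ioc, ← intervalIntegral.integral_of_le zero_le_one]
    have hd : ∀ x ∈ uIcc (0 : ℝ) 1,
        HasDerivAt (fun x => φ (x, y)) (fderiv ℝ φ (x, y) (1, 0)) x := by
      intro x _
      have h1 : HasFDerivAt φ (fderiv ℝ φ (x, y)) (x, y) :=
        (hφ.1.differentiable (by simp) (x, y)).hasFDerivAt
      exact h1.comp_hasDerivAt x ((hasDerivAt_id x).prodMk (hasDerivAt_const x y))
    rw [intervalIntegral.integral_eq_sub_of_hasDerivAt hd
      ((hc.comp (by fun_prop : Continuous fun x : ℝ => (x, y))).intervalIntegrable 0 1)]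
    have := (hφ.2 (0, y)).1
    simp only [zero_add] at this
    rw [this, sub_self]
  rw [cell, Measure.volume_eq_prod, setIntegral_prod _ hint,
    MeasureTheory.integral_integral_swap]
  · simp [h0]
  · rw [Measure.prod_restrict]
    exact hint

theorem integral_deriv_test_snd {φ : ℝ × ℝ → ℂ} (hφ : IsTest φ) :
    ∫ x in cell, fderiv ℝ φ x (0, 1) = 0 := by
  have hc : Continuous fun x => fderiv ℝ φ x (0, 1) :=
    (hφ.1.continuous_fderiv (by simp)).clm_apply continuous_const
  have hint : IntegrableOn (fun x => fderiv ℝ φ x (0, 1)) cell (volume.prod volume) :=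
    hc.continuousOn.integrableOn_compact (isCompact_Icc.prod isCompact_Icc)
  have h0 : ∀ x : ℝ, ∫ y in Icc (0 : ℝ) 1, fderiv ℝ φ (x, y) (0, 1) = 0 := by
    intro x
    rw [integral_Icc_eq_integral_Ioc, ← intervalIntegral.integral_of_le zero_le_one]
    have hd : ∀ y ∈ uIcc (0 : ℝ) 1,
        HasDerivAt (fun y => φ (x, y)) (fderiv ℝ φ (x, y) (0, 1)) y := by
      intro y _
      have h1 : HasFDerivAt φ (fderiv ℝ φ (x, y)) (x, y) :=
        (hφ.1.differentiable (by simp) (x, y)).hasFDerivAt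
      exact h1.comp_hasDerivAt y ((hasDerivAt_const y x).prodMk (hasDerivAt_id y))
    rw [intervalIntegral.integral_eq_sub_of_hasDerivAt hd
      ((hc.comp (by fun_prop : Continuous fun y : ℝ => (x, y))).intervalIntegrable 0 1)]
    have := (hφ.2 (x, 0)).2
    simp only [zero_add] at this
    rw [this, sub_self]
  rw [cell, Measure.volume_eq_prod, setIntegral_prod _ hint]
  simp [h0]

/-- The constant function `u₁ ≡ 1`. -/
def H1Per.one : H1Per where
  val := fun _ => 1
  d1 := fun _ => 0
  d2 := fun _ => 0
  memLp_val := by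
    have : IsFiniteMeasure (volume.restrict cell) :=
      ⟨by
        rw [Measure.restrict_apply_univ]
        exact (isCompact_Icc.prod isCompact_Icc).measure_lt_top⟩
    exact memLp_const 1
  memLp_d1 := MemLp.zero'
  memLp_d2 := MemLp.zero'
  weak_d1 := fun φ hφ => by simp [integral_deriv_test_fst hφ]
  weak_d2 := fun φ hφ => by simp [integral_deriv_test_snd hφ]

/-- The sesquilinear form `(𝒞₀ u, v)` of the operator `𝒞₀ u = -∇·(μ ∇u)`. -/
def formC0 (μ : ℝ × ℝ → ℝ) (u v : H1Per) : ℂ :=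
  ∫ x in cell, (μ x : ℂ) * (u.d1 x * conj (v.d1 x) + u.d2 x * conj (v.d2 x))

/-- The sesquilinear form `(𝒞₁ u, v)` of the operator
`𝒞₁ u = -i κ·(μ ∇u) - i ∇·(μ κ u)`, the divergence being taken weakly. -/
def formC1 (μ : ℝ × ℝ → ℝ) (κ : ℝ × ℝ) (u v : H1Per) : ℂ :=
  -Complex.I * (∫ x in cell, (μ x : ℂ) * (κ.1 * u.d1 x + κ.2 * u.d2 x) * conj (v.val x))
  + Complex.I * ∫ x in cell, (μ x : ℂ) * u.val x * (κ.1 * conj (v.d1 x) + κ.2 * conj (v.d2 x))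

/-- `h` is a weak solution of `𝒞₀ h = 𝒞₁ u₁`, that is, `h = 𝒞₀⁻¹ 𝒞₁ u₁`. -/
def IsCorrector (μ : ℝ × ℝ → ℝ) (κ : ℝ × ℝ) (h : H1Per) : Prop :=
  ∀ v : H1Per, formC0 μ h v = formC1 μ κ H1Per.one v

open Classical in
/-- The effective coefficient `⟨μ⟩ - (𝒞₁ 𝒞₀⁻¹ 𝒞₁ u₁, u₁)` in the direction `κ`. -/
def muEff (μ : ℝ × ℝ → ℝ) (κ : ℝ × ℝ) : ℝ :=
  if h : ∃ h : H1Per, IsCorrector μ κ h then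
    (mean (fun x => (μ x : ℂ)) - formC1 μ κ h.choose H1Per.one).re
  else 0

/-! ### The PWE bounds -/

/-- The indices `-N, …, N`. -/
abbrev Harm (N : ℕ) : Type := ↥(Finset.Icc (-(N : ℤ)) (N : ℤ))

/-- The matrix `𝒞_{NN,0} = (μ̂(g - g') g·g')`. -/
def pweMatrix (μ : ℝ × ℝ → ℝ) (N : ℕ) : Matrix (Harm N × Harm N) (Harm N × Harm N) ℂ :=
  Matrix.of fun g g' =>
    fourier2 μ ((g.1 : ℤ) - (g'.1 : ℤ), (g.2 : ℤ) - (g'.2 : ℤ)) *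
      (((g.1 : ℤ) * (g'.1 : ℤ) + (g.2 : ℤ) * (g'.2 : ℤ) : ℤ) : ℂ)

/-- The vector `f_{NN} = (μ̂(g) g₁)`. -/
def pweVec (μ : ℝ × ℝ → ℝ) (N : ℕ) : Harm N × Harm N → ℂ :=
  fun g => fourier2 μ ((g.1 : ℤ), (g.2 : ℤ)) * ((g.1 : ℤ) : ℂ)

open Classical in
/-- `μ_{NN}(μ) = ⟨μ⟩ - f_{NN} · 𝒞_{NN,0}⁻¹ f_{NN}`, where `𝒞_{NN,0}⁻¹ f_{NN}` is any preimage
of `f_{NN}` under `𝒞_{NN,0}`. -/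
def pweBound (μ : ℝ × ℝ → ℝ) (N : ℕ) : ℝ :=
  if h : ∃ v, pweMatrix μ N *ᵥ v = pweVec μ N then
    (mean (fun x => (μ x : ℂ)) - star (pweVec μ N) ⬝ᵥ h.choose).re
  else 0

/-! ### Multiplicative integrals -/

/-- The terms of the Peano series: `P₀ = I`, `P_{n+1}(x) = ∫₀ˣ Q(y) P_n(y) dy` (entrywise). -/
def peanoTerm {ι : Type*} [Fintype ι] [DecidableEq ι] (Q : ℝ → Matrix ι ι ℂ) :
    ℕ → ℝ → Matrix ι ι ℂ
  | 0, _ => 1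
  | n + 1, x => Matrix.of fun i j => ∫ y in (0 : ℝ)..x, (Q y * peanoTerm Q n y) i j

/-- The multiplicative integral of `I + Q dx` over `[0,1]`, for a bounded measurable `Q`, as
the sum of the Peano series. -/
def multIntegral {ι : Type*} [Fintype ι] [DecidableEq ι] (Q : ℝ → Matrix ι ι ℂ) :
    Matrix ι ι ℂ :=
  ∑' n, peanoTerm Q n 1

/-- The product `(I + Q((j-1)/k)/k) ⋯ (I + Q(1/k)/k) (I + Q(0)/k)` of the first `j` factors. -/
def partialProduct {ι : Type*} [Fintype ι] [DecidableEq ι] (Q : ℝ → Matrix ι ι ℂ) (k : ℕ) :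
    ℕ → Matrix ι ι ℂ
  | 0 => 1
  | j + 1 => (1 + (1 / (k : ℂ)) • Q ((j : ℝ) / (k : ℝ))) * partialProduct Q k j

/-- The Riemann product over `[0,1]` with the factors `I + Q(j/k)/k`, `j = 0, …, k`, the
factors with a larger `j` standing further to the left. -/
def riemannProduct {ι : Type*} [Fintype ι] [DecidableEq ι] (Q : ℝ → Matrix ι ι ℂ) (k : ℕ) :
    Matrix ι ι ℂ :=
  partialProduct Q k (k + 1)

/-! ### The MM bounds -/

/-- The Toeplitz matrix `(μ̂_{n-m}(x₁))`, `-N ≤ n, m ≤ N`. -/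
def muHat (μ : ℝ × ℝ → ℝ) (N : ℕ) (x₁ : ℝ) : Matrix (Harm N) (Harm N) ℂ :=
  Matrix.of fun n m => fourier1 μ ((n : ℤ) - (m : ℤ)) x₁

/-- The matrix `2π diag(n)`, `-N ≤ n ≤ N`. -/
def diffMatrix (N : ℕ) : Matrix (Harm N) (Harm N) ℂ :=
  Matrix.diagonal fun n => 2 * (Real.pi : ℂ) * ((n : ℤ) : ℂ)

/-- The system matrix `Q_N(x₁)`, of size `4N + 2`. -/
def systemMatrix (μ : ℝ × ℝ → ℝ) (N : ℕ) (x₁ : ℝ) :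
    Matrix (Harm N ⊕ Harm N) (Harm N ⊕ Harm N) ℂ :=
  Matrix.fromBlocks 0 (muHat μ N x₁)⁻¹ (diffMatrix N * muHat μ N x₁ * diffMatrix N) 0

/-- The monodromy matrix `M_N`. -/
def monodromy (μ : ℝ × ℝ → ℝ) (N : ℕ) : Matrix (Harm N ⊕ Harm N) (Harm N ⊕ Harm N) ℂ :=
  multIntegral (systemMatrix μ N)

/-- The vector `(δ_{0n})`, `-N ≤ n ≤ N`. -/
def e0 (N : ℕ) : Harm N → ℂ := fun n => if (n : ℤ) = 0 then 1 else 0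

/-- The vector `w₁ = (e₀, 0)`. -/
def w1 (N : ℕ) : Harm N ⊕ Harm N → ℂ := Sum.elim (e0 N) 0

/-- The vector `w₂ = (0, e₀)`. -/
def w2 (N : ℕ) : Harm N ⊕ Harm N → ℂ := Sum.elim 0 (e0 N)

open Classical in
/-- `μ_N(μ) = w₂ · (M_N - I)⁻¹ w₁`, where `(M_N - I)⁻¹ w₁` is any preimage of `w₁` under
`M_N - I`. -/
def mmBound (μ : ℝ × ℝ → ℝ) (N : ℕ) : ℝ :=
  if h : ∃ v, (monodromy μ N - 1) *ᵥ v = w1 N then (w2 N ⬝ᵥ h.choose).re else 0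

/-! ### The lower bounds -/

/-- The reciprocal function `μ⁻¹ = 1/μ`. -/
def recip (μ : ℝ × ℝ → ℝ) : ℝ × ℝ → ℝ := fun x => 1 / μ x

/-- `μ̃_N(μ) = 1/μ_N(μ⁻¹)`. -/
def mmDual (μ : ℝ × ℝ → ℝ) (N : ℕ) : ℝ := 1 / mmBound (recip μ) N

/-- `μ̃_{NN}(μ) = 1/μ_{NN}(μ⁻¹)`. -/
def pweDual (μ : ℝ × ℝ → ℝ) (N : ℕ) : ℝ := 1 / pweBound (recip μ) N

/-! ### The values above do not depend on the choices made -/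

/-- `μ_eff` is well defined: `𝒞₀⁻¹ 𝒞₁ u₁` exists, and every choice of it gives the same real
value. -/
def MuEffWellDefined (μ : ℝ × ℝ → ℝ) (κ : ℝ × ℝ) : Prop :=
  (∃ h : H1Per, IsCorrector μ κ h) ∧
  ∀ h : H1Per, IsCorrector μ κ h →
    mean (fun x => (μ x : ℂ)) - formC1 μ κ h H1Per.one = (muEff μ κ : ℂ)

/-- `μ_{NN}` is well defined: `f_{NN}` has a preimage, every preimage gives the same real value,
and this value is positive. -/
def PweWellDefined (μ : ℝ × ℝ → ℝ) (N : ℕ) : Prop :=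
  (∃ v, pweMatrix μ N *ᵥ v = pweVec μ N) ∧
  (∀ v, pweMatrix μ N *ᵥ v = pweVec μ N →
    mean (fun x => (μ x : ℂ)) - star (pweVec μ N) ⬝ᵥ v = (pweBound μ N : ℂ)) ∧
  0 < pweBound μ N

/-- `μ_N` is well defined: the matrices that are inverted in `Q_N` are invertible, the
multiplicative integral exists as the sum of its Peano series, and also as the limit of the Riemann
products if `μ` is continuous almost everywhere; `w₁` has a preimage under `M_N - I`, every
preimage gives the same real value, and this value is positive. -/
def MmWellDefined (μ : ℝ × ℝ → ℝ) (N : ℕ) : Prop :=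
  (∀ x₁ : ℝ, IsUnit (muHat μ N x₁).det) ∧
  (Summable fun n => peanoTerm (systemMatrix μ N) n 1) ∧
  ((∀ᵐ x : ℝ × ℝ, ContinuousAt μ x) →
    Tendsto (fun k => riemannProduct (systemMatrix μ N) k) atTop (𝓝 (monodromy μ N))) ∧
  (∃ v, (monodromy μ N - 1) *ᵥ v = w1 N) ∧
  (∀ v, (monodromy μ N - 1) *ᵥ v = w1 N → w2 N ⬝ᵥ v = (mmBound μ N : ℂ)) ∧
  0 < mmBound μ N

end Phononic

end

/-! Every quantity in the theorem is a minimal energy. Let `A` be multiplication by `μ` on square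
integrable vector fields of the cell, and for a set `S` of frequencies let `gradSpace S` be the
closed space of periodic gradients with frequencies in `S`. The minimum of `⟪e₁ + w, A (e₁ + w)⟫`
over `w ∈ gradSpace S` is the effective coefficient for all of `ℤ²`, the MM bound for the strip
`|g₂| ≤ N`, and the PWE bound for the box `|g₁|, |g₂| ≤ N`. Box ⊆ strip ⊆ `ℤ²` orders the three
minima. The strips increase to `ℤ²` and trigonometric polynomials are dense, so the MM bounds
decrease to the effective coefficient (`IsElliptic.minVal_anti`, `IsElliptic.tendsto_minVal`).
Existence of preimages and independence of their choice come from Lax-Milgram and from the fact that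
the mean flux of the minimizer is the minimal energy (`IsElliptic.exists_isMinimizer`,
`IsMinimizer.inner_eq`).

The PWE equations are the Euler-Lagrange equations in Fourier coordinates (`pwe_preimage_iff`). For
the strip, let `a` be the harmonics in `x₂` of the total potential and `b` those of the first flux
component. The Euler-Lagrange equation becomes the linear system with matrix `Q_N` for `(a, b)`, and
`(M_N - I) v = w₁` says that the solution starting at `v` has `b` periodic while `a` gains `e₀` over
a period, which is a unit mean gradient (`exists_isBandSolution`, `IsBandSolution.isMinimizer`). The
pairing `w₂ · v` reads off the mean flux. The matrix `M_N - I` is singular, but its kernel lies in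
the line of `w₁` and one of its rows vanishes, so rank-nullity puts `w₁` in its range
(`exists_mm_preimage`).

The lower bounds rest on two-dimensional duality. Cubic symmetry makes the effective tensor a scalar
`α` (`inner_unitY_flux`, `minVal_constField`). The optimal flux is divergence free, so after a
rotation by `π/2` it is curl free, and divided by `α` it is the optimal field for `μ⁻¹`. Hence the
effective coefficient of `μ⁻¹` is `α⁻¹` (`effCoeff_recip`), and reciprocals of upper bounds for
`μ⁻¹` are lower bounds for `μ`.

The Peano series is dominated by an exponential series. Its sum solves an integral equation, and a
discrete Gronwall argument compares it with the Riemann products (`norm_prodSteps_sub_le`). -/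

noncomputable section

namespace Phononic

/-! ### Quadratic minimisation over a closed subspace -/

section Variational

variable {H : Type*} [NormedAddCommGroup H] [InnerProductSpace ℂ H]

/-- `A` is symmetric and bounded below by the constant `m`. -/
structure IsElliptic (A : H →L[ℂ] H) (m : ℝ) : Prop where
  pos : 0 < m
  symm : ∀ x y, inner ℂ (A x) y = inner ℂ x (A y)
  coercive : ∀ x, m * ‖x‖ ^ 2 ≤ (inner ℂ x (A x)).re

/-- `u ∈ K` solves the Euler-Lagrange equation of the energy `⟪f + u, A (f + u)⟫` over `K`. -/
def IsMinimizer (A : H →L[ℂ] H) (K : Submodule ℂ H) (f u : H) : Prop :=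
  u ∈ K ∧ ∀ w ∈ K, inner ℂ w (A (f + u)) = 0

/-- The minimal energy over the affine space `f + K`. -/
def minVal (A : H →L[ℂ] H) (K : Submodule ℂ H) (f : H) : ℝ :=
  ⨅ w : K, (inner ℂ (f + w) (A (f + w))).re

variable {A : H →L[ℂ] H} {m : ℝ} {K L : Submodule ℂ H} {f u w : H}

theorem IsElliptic.inner_self_im (hA : IsElliptic A m) (x : H) : (inner ℂ x (A x)).im = 0 := by
  have h : (starRingEnd ℂ) (inner ℂ x (A x)) = inner ℂ x (A x) := by
    rw [inner_conj_symm, hA.symm]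
  exact Complex.conj_eq_iff_im.mp h

theorem IsElliptic.inner_self_nonneg (hA : IsElliptic A m) (x : H) :
    0 ≤ (inner ℂ x (A x)).re :=
  (mul_nonneg hA.pos.le (sq_nonneg _)).trans (hA.coercive x)

/-- Lax-Milgram: the Euler-Lagrange equation asks the compression `B` of `A` to `K` to send `u` to
minus the projection of `A f`. The compression inherits coercivity and is therefore invertible. -/
theorem IsElliptic.exists_isMinimizer [CompleteSpace H] (hA : IsElliptic A m)
    (hK : IsClosed (K : Set H)) (f : H) : ∃ u, IsMinimizer A K f u := by
  have : CompleteSpace K := hK.completeSpace_coe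
  let B : K →L[ℂ] K := K.orthogonalProjectionOnto ∘L A ∘L K.subtypeL
  have hB : ∀ x y : K, inner ℂ x (B y) = inner ℂ (x : H) (A y) := fun x y => by
    simp [B]
  have hu : IsUnit B := by
    refine ContinuousLinearMap.isUnit_of_forall_le_norm_inner_map B (c := ⟨m, hA.pos.le⟩)
      hA.pos fun x => ?_
    rw [← inner_conj_symm, RCLike.norm_conj, hB]
    have h := hA.coercive x
    calc ‖x‖ ^ 2 * m = m * ‖(x : H)‖ ^ 2 := by rw [mul_comm]; rfl
      _ ≤ _ := h.trans (Complex.re_le_norm _)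
  obtain ⟨v, hv⟩ := hu
  let u : K := (↑v⁻¹ : K →L[ℂ] K) (-K.orthogonalProjectionOnto (A f))
  have hBu : B u = -K.orthogonalProjectionOnto (A f) := by
    have : (B * ↑v⁻¹) (-K.orthogonalProjectionOnto (A f)) = -K.orthogonalProjectionOnto (A f) := by
      rw [← hv, Units.mul_inv]; rfl
    exact this
  refine ⟨u, u.2, fun w hw => ?_⟩
  have h1 := hB ⟨w, hw⟩ u
  rw [hBu] at h1
  rw [map_add, inner_add_right, ← h1]
  simp

/-- The cross terms vanish by the Euler-Lagrange equation and the symmetry of `A`. The excess of any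
competitor is thus exactly the energy of its distance from `u`; minimality and convergence both
follow from this. -/
theorem IsMinimizer.energy_add (hA : IsElliptic A m) (hu : IsMinimizer A K f u) (hw : w ∈ K) :
    (inner ℂ (f + w) (A (f + w))).re =
      (inner ℂ f (A (f + u))).re + (inner ℂ (w - u) (A (w - u))).re := by
  have e : f + w = (f + u) + (w - u) := by abel
  have h1 : inner ℂ (w - u) (A (f + u)) = 0 := hu.2 _ (K.sub_mem hw hu.1)
  have h2 : inner ℂ (f + u) (A (w - u)) = 0 := by
    rw [← hA.symm, ← inner_conj_symm, h1, map_zero]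
  have h3 : inner ℂ u (A (f + u)) = 0 := hu.2 _ hu.1
  rw [e, map_add A (f + u) (w - u), inner_add_left, inner_add_right, inner_add_right, h1, h2,
    inner_add_left, h3, add_zero, add_zero, zero_add, Complex.add_re]

theorem IsMinimizer.energy_eq (hu : IsMinimizer A K f u) :
    inner ℂ (f + u) (A (f + u)) = inner ℂ f (A (f + u)) := by
  rw [inner_add_left, hu.2 _ hu.1, add_zero]

theorem IsElliptic.minVal_le (hA : IsElliptic A m) (hw : w ∈ K) :
    minVal A K f ≤ (inner ℂ (f + w) (A (f + w))).re :=
  ciInf_le ⟨0, by rintro _ ⟨v, rfl⟩; exact hA.inner_self_nonneg _⟩ (⟨w, hw⟩ : K)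

/-- The left side is linear in `u`, which is the form in which the corrector formula and the PWE and
MM formulas produce their values. It equals the energy of `f + u`, which is real because `A` is
symmetric. -/
theorem IsMinimizer.inner_eq (hA : IsElliptic A m) (hu : IsMinimizer A K f u) :
    inner ℂ f (A (f + u)) = (minVal A K f : ℂ) := by
  have h1 : (inner ℂ f (A (f + u))).re = minVal A K f := by
    refine le_antisymm (le_ciInf fun w => ?_) ?_
    · rw [hu.energy_add hA w.2]
      exact le_add_of_nonneg_right (hA.inner_self_nonneg _)
    · rw [← hu.energy_eq]
      exact hA.minVal_le hu.1
  apply Complex.ext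
  · simpa using h1
  · rw [← hu.energy_eq, hA.inner_self_im, Complex.ofReal_im]

theorem IsElliptic.eq_zero_of_re_inner (hA : IsElliptic A m) {x : H}
    (hx : (inner ℂ x (A x)).re = 0) : x = 0 := by
  have h := hA.coercive x
  rw [hx] at h
  have h2 : ‖x‖ ^ 2 ≤ 0 := by
    by_contra hc
    exact absurd h (not_le.mpr (mul_pos hA.pos (not_le.mp hc)))
  simpa using h2

/-- Needed to carry symmetries of the data over to the minimizer, and to determine the kernel of
`M_N - I`. -/
theorem IsMinimizer.unique {v : H} (hA : IsElliptic A m) (hu : IsMinimizer A K f u)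
    (hv : IsMinimizer A K f v) : u = v := by
  have h : inner ℂ (u - v) (A (u - v)) = 0 := by
    have e : u - v = (f + u) - (f + v) := by abel
    conv_lhs => rw [e, map_sub, ← e, inner_sub_right]
    rw [hu.2 _ (K.sub_mem hu.1 hv.1), hv.2 _ (K.sub_mem hu.1 hv.1), sub_zero]
  exact sub_eq_zero.mp (hA.eq_zero_of_re_inner (by rw [h, Complex.zero_re]))

theorem IsElliptic.minVal_anti (hA : IsElliptic A m) (h : K ≤ L) :
    minVal A L f ≤ minVal A K f :=
  le_ciInf fun w => hA.minVal_le (h w.2)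

/-- By Pythagoras no competitor is shorter than `f`, so coercivity bounds all energies below by `m *
‖f‖ ^ 2`. -/
theorem IsElliptic.minVal_pos (hA : IsElliptic A m) (hf : f ≠ 0)
    (hfK : ∀ w ∈ K, inner ℂ f w = 0) : 0 < minVal A K f := by
  have h : 0 < m * ‖f‖ ^ 2 := mul_pos hA.pos (by positivity)
  refine h.trans_le (le_ciInf fun w => ?_)
  refine le_trans ?_ (hA.coercive _)
  refine mul_le_mul_of_nonneg_left ?_ hA.pos.le
  have e : ‖f + w‖ * ‖f + w‖ = ‖f‖ * ‖f‖ + ‖(w : H)‖ * ‖(w : H)‖ :=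
    norm_add_sq_eq_norm_sq_add_norm_sq_of_inner_eq_zero _ _ (hfK w w.2)
  nlinarith [norm_nonneg (w : H)]

/-- By `energy_add` a competitor `w` exceeds the minimum by the energy of `w - u`, which is small
once `w` is close to `u`. Density is therefore required only at the minimizer. -/
theorem IsElliptic.tendsto_minVal (hA : IsElliptic A m) {V : ℕ → Submodule ℂ H}
    (hV : Monotone V) (hVK : ∀ N, V N ≤ K) (hu : IsMinimizer A K f u)
    (hdense : ∀ ε > 0, ∃ N, ∃ w ∈ V N, ‖w - u‖ < ε) :
    Tendsto (fun N => minVal A (V N) f) atTop (𝓝 (minVal A K f)) := by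
  have hval : (inner ℂ f (A (f + u))).re = minVal A K f := by
    rw [hu.inner_eq hA, Complex.ofReal_re]
  rw [Metric.tendsto_atTop]
  intro ε hε
  have hc : Continuous fun x : H => (inner ℂ x (A x)).re := by fun_prop
  have h0 := Metric.continuousAt_iff.mp (hc.continuousAt (x := 0)) ε hε
  obtain ⟨δ, hδ, h0⟩ := h0
  obtain ⟨N, w, hw, hwu⟩ := hdense δ hδ
  refine ⟨N, fun n hn => ?_⟩
  have h1 : minVal A (V n) f ≤ _ := hA.minVal_le (hV hn hw)
  rw [hu.energy_add hA (hVK N hw), hval] at h1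
  have h2 := hA.minVal_anti (f := f) (hVK n)
  have h3 := h0 (x := w - u) (by simpa using hwu)
  simp only [inner_zero_left, Complex.zero_re, dist_zero_right, Real.norm_eq_abs] at h3
  rw [Real.dist_eq, abs_of_nonneg (by linarith)]
  have := le_abs_self (inner ℂ (w - u) (A (w - u))).re
  linarith

end Variational

/-! ### Fourier series on the unit cell -/

theorem volume_restrict_cell :
    (volume.restrict cell : Measure (ℝ × ℝ)) =
      (volume.restrict (Icc (0 : ℝ) 1)).prod (volume.restrict (Icc (0 : ℝ) 1)) := by
  rw [cell, Measure.prod_restrict, Measure.volume_eq_prod]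

instance : IsProbabilityMeasure (volume.restrict (Icc (0 : ℝ) 1)) := ⟨by simp⟩

instance : IsProbabilityMeasure (volume.restrict cell) := by
  rw [volume_restrict_cell]; infer_instance

/-- The character `x ↦ exp (2πinx)` of the circle. -/
def wave1 (n : ℤ) (x : ℝ) : ℂ := Complex.exp (2 * Real.pi * Complex.I * (n * x))

/-- The character `x ↦ exp (2πi g·x)` of the torus. -/
def wave (g : ℤ × ℤ) (x : ℝ × ℝ) : ℂ := wave1 g.1 x.1 * wave1 g.2 x.2

theorem wave1_continuous (n : ℤ) : Continuous (wave1 n) := by unfold wave1; fun_prop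

theorem wave_continuous (g : ℤ × ℤ) : Continuous (wave g) :=
  ((wave1_continuous _).comp continuous_fst).mul ((wave1_continuous _).comp continuous_snd)

theorem norm_wave1 (n : ℤ) (x : ℝ) : ‖wave1 n x‖ = 1 := by
  rw [wave1, show (2 * Real.pi * Complex.I * (n * x) : ℂ) =
    ((2 * Real.pi * (n * x) : ℝ) : ℂ) * Complex.I by push_cast; ring]
  exact Complex.norm_exp_ofReal_mul_I _

theorem norm_wave (g : ℤ × ℤ) (x : ℝ × ℝ) : ‖wave g x‖ = 1 := by
  rw [wave, norm_mul, norm_wave1, norm_wave1, one_mul]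

theorem wave1_add (n k : ℤ) (x : ℝ) : wave1 (n + k) x = wave1 n x * wave1 k x := by
  rw [wave1, wave1, wave1, ← Complex.exp_add]
  congr 1; push_cast; ring

theorem wave1_zero (x : ℝ) : wave1 0 x = 1 := by simp [wave1]

theorem wave_zero (x : ℝ × ℝ) : wave 0 x = 1 := by simp [wave, wave1_zero]

theorem wave1_conj (n : ℤ) (x : ℝ) : conj (wave1 n x) = wave1 (-n) x := by
  rw [wave1, wave1, ← Complex.exp_conj]
  congr 1
  simp only [map_mul, Complex.conj_I, Complex.conj_ofReal, map_ofNat, map_intCast]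
  push_cast; ring

theorem wave_conj (g : ℤ × ℤ) (x : ℝ × ℝ) : conj (wave g x) = wave (-g) x := by
  rw [wave, map_mul, wave1_conj, wave1_conj]; rfl

theorem wave_add (g k : ℤ × ℤ) (x : ℝ × ℝ) : wave (g + k) x = wave g x * wave k x := by
  simp only [wave, Prod.fst_add, Prod.snd_add, wave1_add]; ring

theorem wave1_add_one (n : ℤ) (x : ℝ) : wave1 n (x + 1) = wave1 n x := by
  rw [wave1, wave1, show (2 * Real.pi * Complex.I * (n * ((x + 1 : ℝ) : ℂ)) : ℂ) =
    2 * Real.pi * Complex.I * (n * x) + n * (2 * Real.pi * Complex.I) by push_cast; ring,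
    Complex.exp_add, Complex.exp_int_mul_two_pi_mul_I, mul_one]

theorem wave1_hasDerivAt (n : ℤ) (x : ℝ) :
    HasDerivAt (wave1 n) (2 * Real.pi * Complex.I * n * wave1 n x) x := by
  have h1 : HasDerivAt (fun z : ℂ => Complex.exp (2 * Real.pi * Complex.I * (n * z)))
      (Complex.exp (2 * Real.pi * Complex.I * (n * x)) * (2 * Real.pi * Complex.I * (n * 1)))
      (x : ℂ) :=
    (((hasDerivAt_id (x : ℂ)).const_mul (n : ℂ)).const_mul (2 * Real.pi * Complex.I)).cexp
  have h2 := h1.comp_ofReal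
  refine h2.congr_deriv ?_
  simp only [wave1]; ring

theorem integral_wave1 (n : ℤ) :
    ∫ x in Icc (0 : ℝ) 1, wave1 n x = if n = 0 then 1 else 0 := by
  split_ifs with h
  · subst h; simp [wave1_zero]
  · rw [integral_Icc_eq_integral_Ioc, ← intervalIntegral.integral_of_le zero_le_one]
    have hne : (2 * Real.pi * Complex.I * n : ℂ) ≠ 0 := by
      simp [Real.pi_ne_zero, h]
    have hd : ∀ x ∈ uIcc (0 : ℝ) 1,
        HasDerivAt (fun x => (2 * Real.pi * Complex.I * n : ℂ)⁻¹ * wave1 n x) (wave1 n x) x := by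
      intro x _
      have := (wave1_hasDerivAt n x).const_mul (2 * Real.pi * Complex.I * n : ℂ)⁻¹
      rwa [inv_mul_cancel_left₀ hne] at this
    rw [intervalIntegral.integral_eq_sub_of_hasDerivAt hd
      ((wave1_continuous n).intervalIntegrable 0 1)]
    have := wave1_add_one n 0
    rw [zero_add] at this
    rw [this, sub_self]

theorem integral_wave (g : ℤ × ℤ) :
    ∫ x in cell, wave g x = if g = 0 then 1 else 0 := by
  rw [volume_restrict_cell]
  refine (integral_prod_mul (wave1 g.1) (wave1 g.2)).trans ?_
  rw [integral_wave1, integral_wave1]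
  by_cases h1 : g.1 = 0 <;> by_cases h2 : g.2 = 0 <;> simp [h1, h2, Prod.ext_iff]

theorem hasSum_sq_integral_wave1 {f : ℝ → ℂ} (hf : MemLp f 2 (volume.restrict (Icc (0 : ℝ) 1))) :
    HasSum (fun n : ℤ => ‖∫ x in Icc (0 : ℝ) 1, wave1 (-n) x * f x‖ ^ 2)
      (∫ x in Icc (0 : ℝ) 1, ‖f x‖ ^ 2) := by
  have hf' : MemLp f 2 (volume.restrict (Ioc (0 : ℝ) 1)) := by
    rwa [restrict_Ioc_eq_restrict_Icc]
  have h := hasSum_sq_fourierCoeffOn zero_lt_one hf'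
  rw [intervalIntegral.integral_of_le zero_le_one, restrict_Ioc_eq_restrict_Icc] at h
  simp only [sub_zero, inv_one, one_smul] at h
  convert h using 4 with n
  rw [fourierCoeffOn_eq_integral, intervalIntegral.integral_of_le zero_le_one,
    restrict_Ioc_eq_restrict_Icc]
  simp only [sub_zero, div_one, one_smul, smul_eq_mul, fourier_coe_apply]
  refine integral_congr_ae (Eventually.of_forall fun x => ?_)
  simp only [wave1]
  congr 2
  push_cast; ring

theorem ae_eq_zero_of_integral_wave1 {f : ℝ → ℂ}
    (hf : MemLp f 2 (volume.restrict (Icc (0 : ℝ) 1)))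
    (h : ∀ n : ℤ, ∫ x in Icc (0 : ℝ) 1, wave1 (-n) x * f x = 0) :
    f =ᵐ[volume.restrict (Icc (0 : ℝ) 1)] 0 := by
  have h1 := hasSum_sq_integral_wave1 hf
  simp only [h, norm_zero, ne_eq, OfNat.ofNat_ne_zero, not_false_eq_true, zero_pow] at h1
  have h2 := h1.unique hasSum_zero
  rw [integral_eq_zero_iff_of_nonneg (fun x => sq_nonneg _)
    ((memLp_two_iff_integrable_sq_norm hf.1).mp hf)] at h2
  filter_upwards [h2] with x hx
  simpa using hx

theorem wave_mul_integrable {f : ℝ × ℝ → ℂ} (g : ℤ × ℤ)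
    (hf : Integrable f (volume.restrict cell)) :
    Integrable (fun x => wave g x * f x) (volume.restrict cell) :=
  hf.bdd_mul (c := 1) (wave_continuous g).aestronglyMeasurable
    (Eventually.of_forall fun x => (norm_wave g x).le)

/-- Completeness on the torus follows from the circle by Fubini. Each partial coefficient `c n` has
vanishing Fourier coefficients in `x`, so almost every section of `f` has only zero coefficients,
and Parseval on the sections gives zero norm. -/
theorem ae_eq_zero_of_integral_wave {f : ℝ × ℝ → ℂ} (hf : MemLp f 2 (volume.restrict cell))
    (h : ∀ g : ℤ × ℤ, ∫ x in cell, wave (-g) x * f x = 0) :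
    f =ᵐ[volume.restrict cell] 0 := by
  have hint : Integrable f (volume.restrict cell) := hf.integrable (by norm_num)
  have hsq := (memLp_two_iff_integrable_sq_norm hf.1).mp hf
  have hwint := fun g => wave_mul_integrable g hint
  have hmeas := hf.1
  rw [volume_restrict_cell] at h hint hsq hwint hmeas ⊢
  have hL2 : ∀ᵐ x ∂(volume.restrict (Icc (0 : ℝ) 1)),
      MemLp (fun y => f (x, y)) 2 (volume.restrict (Icc (0 : ℝ) 1)) := by
    filter_upwards [hsq.prod_right_ae, hmeas.prodMk_left] with x h1 h2
    exact (memLp_two_iff_integrable_sq_norm h2).mpr h1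
  set c : ℤ → ℝ → ℂ := fun n x => ∫ y in Icc (0 : ℝ) 1, wave1 (-n) y * f (x, y) with hc
  have hcL2 : ∀ n, MemLp (c n) 2 (volume.restrict (Icc (0 : ℝ) 1)) := by
    intro n
    have hm : AEStronglyMeasurable (c n) (volume.restrict (Icc (0 : ℝ) 1)) := by
      -- At the frequency `(0, -n)` the first factor of the wave is `1`, so the inner integral is `c
      -- n`.
      have h0 := (hwint (0, -n)).1.integral_prod_right'
      simpa only [wave, wave1_zero, one_mul] using h0
    refine (memLp_two_iff_integrable_sq_norm hm).mpr ?_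
    refine hsq.integral_prod_left.mono' (hm.norm.pow 2) ?_
    filter_upwards [hL2] with x hx
    rw [Real.norm_of_nonneg (sq_nonneg _)]
    -- Bessel's inequality on the section at `x`.
    exact le_hasSum (hasSum_sq_integral_wave1 hx) n fun _ _ => sq_nonneg _
  have hc0 : ∀ n, c n =ᵐ[volume.restrict (Icc (0 : ℝ) 1)] 0 := by
    intro n
    refine ae_eq_zero_of_integral_wave1 (hcL2 n) fun k => ?_
    have := h (k, n)
    rw [integral_prod _ (hwint _)] at this
    rw [← this]
    refine integral_congr_ae (Eventually.of_forall fun x => ?_)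
    simp only [hc, wave, ← integral_const_mul, Prod.fst_neg, Prod.snd_neg, mul_assoc]
  have hall : ∀ᵐ x ∂(volume.restrict (Icc (0 : ℝ) 1)), ∀ n, c n x = 0 := ae_all_iff.mpr hc0
  have hz : ∫ z, ‖f z‖ ^ 2 ∂((volume.restrict (Icc (0 : ℝ) 1)).prod
      (volume.restrict (Icc (0 : ℝ) 1))) = 0 := by
    rw [integral_prod _ hsq]
    refine integral_eq_zero_of_ae ?_
    filter_upwards [hL2, hall] with x hx hcx
    have h1 := hasSum_sq_integral_wave1 hx
    have h2 : ∀ n : ℤ, ∫ y in Icc (0 : ℝ) 1, wave1 (-n) y * f (x, y) = 0 := hcx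
    simp only [h2, norm_zero, ne_eq, OfNat.ofNat_ne_zero, not_false_eq_true, zero_pow] at h1
    exact h1.unique hasSum_zero
  rw [integral_eq_zero_iff_of_nonneg (fun x => sq_nonneg _) hsq] at hz
  filter_upwards [hz] with x hx
  simpa using hx

/-- The space `L²` of the unit cell. -/
abbrev L2Cell : Type := Lp ℂ 2 (volume.restrict cell)

theorem wave_memLp (g : ℤ × ℤ) : MemLp (wave g) 2 (volume.restrict cell) :=
  MemLp.of_bound (wave_continuous g).aestronglyMeasurable 1
    (Eventually.of_forall fun x => (norm_wave g x).le)

/-- The character of frequency `g` as an element of `L²`. -/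
def waveLp (g : ℤ × ℤ) : L2Cell := (wave_memLp g).toLp

theorem coeFn_waveLp (g : ℤ × ℤ) : waveLp g =ᵐ[volume.restrict cell] wave g :=
  (wave_memLp g).coeFn_toLp

theorem inner_waveLp (g : ℤ × ℤ) (f : L2Cell) :
    inner ℂ (waveLp g) f = ∫ x in cell, wave (-g) x * f x := by
  rw [L2.inner_def]
  refine integral_congr_ae ?_
  filter_upwards [coeFn_waveLp g] with x hx
  rw [RCLike.inner_apply, hx, wave_conj, mul_comm]

theorem inner_waveLp_toLp (g : ℤ × ℤ) {f : ℝ × ℝ → ℂ} (hf : MemLp f 2 (volume.restrict cell)) :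
    inner ℂ (waveLp g) hf.toLp = ∫ x in cell, wave (-g) x * f x := by
  rw [inner_waveLp]
  refine integral_congr_ae ?_
  filter_upwards [hf.coeFn_toLp] with x hx
  rw [hx]

theorem orthonormal_waveLp : Orthonormal ℂ waveLp := by
  classical
  rw [orthonormal_iff_ite]
  intro g k
  rw [waveLp, waveLp, ← waveLp, inner_waveLp_toLp]
  simp only [← wave_add, integral_wave, neg_add_eq_zero]

/-- The Fourier basis of `L²` of the unit cell. -/
def waveBasis : HilbertBasis (ℤ × ℤ) ℂ L2Cell :=
  HilbertBasis.mkOfOrthogonalEqBot orthonormal_waveLp (by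
    rw [Submodule.eq_bot_iff]
    intro f hf
    rw [Submodule.mem_orthogonal] at hf
    rw [Lp.eq_zero_iff_ae_eq_zero]
    refine ae_eq_zero_of_integral_wave (Lp.memLp f) fun g => ?_
    rw [← inner_waveLp]
    exact hf _ (Submodule.subset_span ⟨g, rfl⟩))

@[simp] theorem waveBasis_apply (g : ℤ × ℤ) : waveBasis g = waveLp g := by
  simp [waveBasis]

theorem ext_inner_waveLp {f h : L2Cell}
    (hfh : ∀ g, inner ℂ (waveLp g) f = inner ℂ (waveLp g) h) : f = h := by
  refine waveBasis.repr.injective (lp.ext (funext fun g => ?_))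
  simpa [HilbertBasis.repr_apply_apply] using hfh g

theorem hasSum_inner_waveLp (f h : L2Cell) :
    HasSum (fun g => conj (inner ℂ (waveLp g) f) * inner ℂ (waveLp g) h) (inner ℂ f h) := by
  simpa using waveBasis.hasSum_inner_mul_inner f h

theorem hasSum_waveLp (f : L2Cell) :
    HasSum (fun g => (inner ℂ (waveLp g) f : ℂ) • waveLp g) f := by
  simpa [HilbertBasis.repr_apply_apply] using waveBasis.hasSum_repr f

/-! ### Multiplication by the coefficient -/

/-- `μ` is a measurable periodic coefficient of cubic symmetry with values in `[m, M]`. -/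
structure IsCoeff (μ : ℝ × ℝ → ℝ) (m M : ℝ) : Prop where
  meas : Measurable μ
  pos : 0 < m
  lower : ∀ x, m ≤ μ x
  upper : ∀ x, μ x ≤ M
  periodic : IsPeriodic μ
  cubic : IsCubic μ

section Coeff

variable {μ : ℝ × ℝ → ℝ} {m M : ℝ}

theorem IsCoeff.pos' (h : IsCoeff μ m M) (x : ℝ × ℝ) : 0 < μ x := h.pos.trans_le (h.lower x)

theorem IsCoeff.pos_upper (h : IsCoeff μ m M) : 0 < M := (h.pos' 0).trans_le (h.upper 0)

theorem IsCoeff.recip (h : IsCoeff μ m M) : IsCoeff (recip μ) M⁻¹ m⁻¹ where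
  meas := measurable_const.div h.meas
  pos := inv_pos.mpr h.pos_upper
  lower x := by
    rw [Phononic.recip, one_div]
    exact inv_anti₀ (h.pos' x) (h.upper x)
  upper x := by
    rw [Phononic.recip, one_div]
    exact inv_anti₀ h.pos (h.lower x)
  periodic x := by simp only [Phononic.recip, h.periodic x, and_self]
  cubic x := by simp only [Phononic.recip, h.cubic x]

theorem IsCoeff.norm_le (h : IsCoeff μ m M) (x : ℝ × ℝ) : ‖(μ x : ℂ)‖ ≤ M := by
  rw [Complex.norm_real, Real.norm_of_nonneg (h.pos' x).le]
  exact h.upper x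

theorem IsCoeff.measurable_ofReal (h : IsCoeff μ m M) : Measurable fun x => (μ x : ℂ) :=
  Complex.measurable_ofReal.comp h.meas

theorem IsCoeff.memLp_mul (h : IsCoeff μ m M) {f : ℝ × ℝ → ℂ}
    (hf : MemLp f 2 (volume.restrict cell)) :
    MemLp (fun x => (μ x : ℂ) * f x) 2 (volume.restrict cell) := by
  refine hf.of_le_mul (c := M) (h.measurable_ofReal.aestronglyMeasurable.mul hf.1)
    (Eventually.of_forall fun x => ?_)
  rw [norm_mul]
  exact mul_le_mul_of_nonneg_right (h.norm_le x) (norm_nonneg _)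

/-- Multiplication by `μ` on `L²` of the unit cell. -/
def mulOp (h : IsCoeff μ m M) : L2Cell →L[ℂ] L2Cell :=
  LinearMap.mkContinuous
    { toFun := fun f => (h.memLp_mul (Lp.memLp f)).toLp
      map_add' := fun f k => by
        rw [← MemLp.toLp_add]
        refine MemLp.toLp_congr _ _ ?_
        filter_upwards [Lp.coeFn_add f k] with x hx
        simp only [hx, Pi.add_apply, mul_add]
      map_smul' := fun c f => by
        rw [RingHom.id_apply, ← MemLp.toLp_const_smul]
        refine MemLp.toLp_congr _ _ ?_
        filter_upwards [Lp.coeFn_smul c f] with x hx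
        simp only [hx, Pi.smul_apply, smul_eq_mul]
        ring } M
    (fun f => by
      refine Lp.norm_le_mul_norm_of_ae_le_mul ?_
      filter_upwards [(h.memLp_mul (Lp.memLp f)).coeFn_toLp] with x hx
      simp only [LinearMap.coe_mk, AddHom.coe_mk, hx, norm_mul]
      exact mul_le_mul_of_nonneg_right (h.norm_le x) (norm_nonneg _))

theorem coeFn_mulOp (h : IsCoeff μ m M) (f : L2Cell) :
    mulOp h f =ᵐ[volume.restrict cell] fun x => (μ x : ℂ) * f x :=
  (h.memLp_mul (Lp.memLp f)).coeFn_toLp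

theorem mulOp_toLp (h : IsCoeff μ m M) {f : ℝ × ℝ → ℂ} (hf : MemLp f 2 (volume.restrict cell)) :
    mulOp h hf.toLp = (h.memLp_mul hf).toLp := by
  refine MemLp.toLp_congr (h.memLp_mul (Lp.memLp _)) _ ?_
  filter_upwards [hf.coeFn_toLp] with x hx
  rw [hx]

theorem inner_mulOp_left (h : IsCoeff μ m M) (f k : L2Cell) :
    inner ℂ (mulOp h f) k = inner ℂ f (mulOp h k) := by
  rw [L2.inner_def, L2.inner_def]
  refine integral_congr_ae ?_
  filter_upwards [coeFn_mulOp h f, coeFn_mulOp h k] with x h1 h2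
  rw [RCLike.inner_apply, RCLike.inner_apply, h1, h2, map_mul, Complex.conj_ofReal]
  ring

theorem mulOp_coercive (h : IsCoeff μ m M) (f : L2Cell) :
    m * ‖f‖ ^ 2 ≤ (inner ℂ f (mulOp h f)).re := by
  have e1 : ‖f‖ ^ 2 = ∫ x in cell, ‖f x‖ ^ 2 := by
    have h0 : (inner ℂ f f).re = ‖f‖ ^ 2 := by
      rw [inner_self_eq_norm_sq_to_K]; norm_cast
    rw [← h0, L2.inner_def]
    have := integral_re (L2.integrable_inner (𝕜 := ℂ) f f)
    simp only [RCLike.re_to_complex] at this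
    rw [← this]
    refine integral_congr_ae (Eventually.of_forall fun x => ?_)
    simp only [inner_self_eq_norm_sq_to_K]
    norm_cast
  have e2 := integral_re (L2.integrable_inner (𝕜 := ℂ) f (mulOp h f))
  simp only [RCLike.re_to_complex] at e2
  rw [L2.inner_def, ← e2, e1, ← integral_const_mul]
  refine integral_mono_ae
    (((memLp_two_iff_integrable_sq_norm (Lp.memLp f).1).mp (Lp.memLp f)).const_mul m)
    (L2.integrable_inner (𝕜 := ℂ) f (mulOp h f)).re ?_
  filter_upwards [coeFn_mulOp h f] with x hx
  simp only [RCLike.inner_apply, hx, mul_assoc, Complex.mul_conj,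
    Complex.normSq_eq_norm_sq]
  rw [← Complex.ofReal_mul, Complex.ofReal_re]
  exact mul_le_mul_of_nonneg_right (h.lower x) (sq_nonneg _)

theorem fourier2_eq (g : ℤ × ℤ) : fourier2 μ g = ∫ x in cell, (μ x : ℂ) * wave (-g) x := by
  refine integral_congr_ae (Eventually.of_forall fun x => ?_)
  simp only [wave, wave1, ← Complex.exp_add, Prod.fst_neg, Prod.snd_neg]
  congr 2
  push_cast; ring

theorem inner_waveLp_mulOp_waveLp (h : IsCoeff μ m M) (g k : ℤ × ℤ) :
    inner ℂ (waveLp g) (mulOp h (waveLp k)) = fourier2 μ (g - k) := by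
  rw [waveLp, waveLp, ← waveLp, mulOp_toLp, inner_waveLp_toLp, fourier2_eq]
  refine integral_congr_ae (Eventually.of_forall fun x => ?_)
  simp only [show -(g - k) = -g + k by abel, wave_add]
  ring

theorem mulOp_recip_mulOp (h : IsCoeff μ m M) (f : L2Cell) :
    mulOp h.recip (mulOp h f) = f := by
  refine Lp.ext ?_
  filter_upwards [coeFn_mulOp h.recip (mulOp h f), coeFn_mulOp h f] with x h1 h2
  rw [h1, h2, recip, ← mul_assoc, ← Complex.ofReal_mul, one_div,
    inv_mul_cancel₀ (h.pos' x).ne', Complex.ofReal_one, one_mul]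

theorem fourier2_conj (g : ℤ × ℤ) : conj (fourier2 μ g) = fourier2 μ (-g) := by
  rw [fourier2_eq, fourier2_eq, ← integral_conj]
  simp only [map_mul, Complex.conj_ofReal, wave_conj]

theorem integral_Icc_neg {f : ℝ → ℂ} (hf : ∀ x, f (x + 1) = f x) :
    ∫ x in Icc (0 : ℝ) 1, f (-x) = ∫ x in Icc (0 : ℝ) 1, f x := by
  rw [integral_Icc_eq_integral_Ioc, ← intervalIntegral.integral_of_le zero_le_one,
    integral_Icc_eq_integral_Ioc, ← intervalIntegral.integral_of_le zero_le_one,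
    intervalIntegral.integral_comp_neg]
  have hp : Function.Periodic f 1 := hf
  simpa using hp.intervalIntegral_add_eq (-1) 0

/-- The Fourier coefficients inherit the cubic symmetry. -/
theorem IsCoeff.fourier2_rot (h : IsCoeff μ m M) (g : ℤ × ℤ) :
    fourier2 μ (-g.2, g.1) = fourier2 μ g := by
  set φ : ℤ × ℤ → ℝ × ℝ → ℂ := fun g x => (μ x : ℂ) * wave (-g) x with hφ
  have hint : ∀ g, Integrable (φ g) (volume.restrict cell) := fun g =>
    (h.memLp_mul (wave_memLp (-g))).integrable (by norm_num)
  have hrot : ∀ x y : ℝ, φ (-g.2, g.1) (x, y) = φ g (y, -x) := by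
    intro x y
    have h1 : μ (x, y) = μ (y, -x) := by
      have := h.cubic (y, -x)
      rw [neg_neg] at this
      exact this
    have h2 : ∀ n : ℤ, wave1 n (-x) = wave1 (-n) x := by
      intro n; simp only [wave1]; congr 1; push_cast; ring
    simp only [hφ, h1, wave, Prod.fst_neg, Prod.snd_neg, h2]
    ring
  have hper : ∀ y x : ℝ, φ g (y, x + 1) = φ g (y, x) := by
    intro y x
    simp only [hφ, wave, wave1_add_one, (h.periodic (y, x)).2]
  have i1 := hint (-g.2, g.1)
  have i2 := hint g
  rw [fourier2_eq, fourier2_eq]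
  change ∫ x in cell, φ (-g.2, g.1) x = ∫ x in cell, φ g x
  rw [volume_restrict_cell] at i1 i2 ⊢
  -- Iterating the two integrals in opposite orders exchanges the coordinates; what remains of the
  -- rotation is the reflection `x ↦ -x` in one variable.
  rw [integral_prod_symm _ i1, integral_prod _ i2]
  refine integral_congr_ae (Eventually.of_forall fun y => ?_)
  simp only [hrot]
  exact integral_Icc_neg (f := fun x => φ g (y, x)) (hper y)

end Coeff

/-! ### Vector fields and gradient fields -/

/-- Square integrable vector fields on the unit cell. -/
abbrev VField : Type := WithLp 2 (L2Cell × L2Cell)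

/-- The vector field with the components `f` and `k`. -/
abbrev mkField (f k : L2Cell) : VField := WithLp.toLp 2 (f, k)

theorem mkField_fst (f k : L2Cell) : (mkField f k).fst = f := rfl

theorem mkField_snd (f k : L2Cell) : (mkField f k).snd = k := rfl

theorem VField.inner_eq (F W : VField) :
    inner ℂ F W = inner ℂ F.fst W.fst + inner ℂ F.snd W.snd := WithLp.prod_inner_apply F W

theorem VField.ext' {F W : VField} (h1 : F.fst = W.fst) (h2 : F.snd = W.snd) : F = W :=
  (WithLp.ofLp_injective 2) (Prod.ext h1 h2)

/-- The operator acting as `T` on both components of a vector field. -/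
def fieldOp (T : L2Cell →L[ℂ] L2Cell) : VField →L[ℂ] VField :=
  (WithLp.prodContinuousLinearEquiv 2 ℂ L2Cell L2Cell).symm.toContinuousLinearMap ∘L
    (T.prodMap T) ∘L (WithLp.prodContinuousLinearEquiv 2 ℂ L2Cell L2Cell).toContinuousLinearMap

@[simp] theorem fieldOp_fst (T : L2Cell →L[ℂ] L2Cell) (F : VField) :
    (fieldOp T F).fst = T F.fst := rfl

@[simp] theorem fieldOp_snd (T : L2Cell →L[ℂ] L2Cell) (F : VField) :
    (fieldOp T F).snd = T F.snd := rfl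

theorem isElliptic_fieldOp {μ : ℝ × ℝ → ℝ} {m M : ℝ} (h : IsCoeff μ m M) :
    IsElliptic (fieldOp (mulOp h)) m where
  pos := h.pos
  symm F W := by
    simp only [VField.inner_eq, fieldOp_fst, fieldOp_snd, inner_mulOp_left]
  coercive F := by
    simp only [VField.inner_eq, fieldOp_fst, fieldOp_snd, WithLp.prod_norm_sq_eq_of_L2,
      Complex.add_re, mul_add]
    exact add_le_add (mulOp_coercive h _) (mulOp_coercive h _)

/-- The closed space of gradient fields `∇v` of functions `v` with frequencies in `S`, described by
Fourier coefficients. -/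
def gradSpace (S : Set (ℤ × ℤ)) : Submodule ℂ VField where
  -- The first condition is the vanishing of the curl. It is void at `g = 0`, so the vanishing of
  -- the mean is a separate condition.
  carrier := {F | (∀ g : ℤ × ℤ, (g.2 : ℂ) * inner ℂ (waveLp g) F.fst =
      (g.1 : ℂ) * inner ℂ (waveLp g) F.snd) ∧
    (inner ℂ (waveLp 0) F.fst = 0 ∧ inner ℂ (waveLp 0) F.snd = 0) ∧
    ∀ g ∉ S, inner ℂ (waveLp g) F.fst = 0 ∧ inner ℂ (waveLp g) F.snd = 0}
  add_mem' := by
    rintro F W ⟨a1, ⟨a2, a3⟩, a4⟩ ⟨b1, ⟨b2, b3⟩, b4⟩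
    refine ⟨fun g => ?_, ⟨?_, ?_⟩, fun g hg => ⟨?_, ?_⟩⟩
    · simp only [WithLp.add_fst, WithLp.add_snd, inner_add_right, mul_add, a1, b1]
    · simp only [WithLp.add_fst, inner_add_right, a2, b2, add_zero]
    · simp only [WithLp.add_snd, inner_add_right, a3, b3, add_zero]
    · simp only [WithLp.add_fst, inner_add_right, (a4 g hg).1, (b4 g hg).1, add_zero]
    · simp only [WithLp.add_snd, inner_add_right, (a4 g hg).2, (b4 g hg).2, add_zero]
  zero_mem' := by simp
  smul_mem' := by
    rintro c F ⟨a1, ⟨a2, a3⟩, a4⟩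
    refine ⟨fun g => ?_, ⟨?_, ?_⟩, fun g hg => ⟨?_, ?_⟩⟩
    · simp only [WithLp.smul_fst, WithLp.smul_snd, inner_smul_right, mul_left_comm _ c, a1]
    · simp only [WithLp.smul_fst, inner_smul_right, a2, mul_zero]
    · simp only [WithLp.smul_snd, inner_smul_right, a3, mul_zero]
    · simp only [WithLp.smul_fst, inner_smul_right, (a4 g hg).1, mul_zero]
    · simp only [WithLp.smul_snd, inner_smul_right, (a4 g hg).2, mul_zero]

theorem mem_gradSpace {S : Set (ℤ × ℤ)} {F : VField} :
    F ∈ gradSpace S ↔ (∀ g : ℤ × ℤ, (g.2 : ℂ) * inner ℂ (waveLp g) F.fst =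
      (g.1 : ℂ) * inner ℂ (waveLp g) F.snd) ∧
    (inner ℂ (waveLp 0) F.fst = 0 ∧ inner ℂ (waveLp 0) F.snd = 0) ∧
    ∀ g ∉ S, inner ℂ (waveLp g) F.fst = 0 ∧ inner ℂ (waveLp g) F.snd = 0 := Iff.rfl

theorem gradSpace_mono {S T : Set (ℤ × ℤ)} (h : S ⊆ T) : gradSpace S ≤ gradSpace T :=
  fun _ hF => ⟨hF.1, hF.2.1, fun g hg => hF.2.2 g fun hS => hg (h hS)⟩

theorem isClosed_gradSpace (S : Set (ℤ × ℤ)) : IsClosed (gradSpace S : Set VField) := by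
  have h1 : ∀ g, Continuous fun F : VField => (inner ℂ (waveLp g) F.fst : ℂ) := fun g =>
    continuous_const.inner (continuous_fst.comp (WithLp.prodContinuousLinearEquiv 2 ℂ _ _).continuous)
  have h2 : ∀ g, Continuous fun F : VField => (inner ℂ (waveLp g) F.snd : ℂ) := fun g =>
    continuous_const.inner (continuous_snd.comp (WithLp.prodContinuousLinearEquiv 2 ℂ _ _).continuous)
  have e : (gradSpace S : Set VField) =
      (⋂ g : ℤ × ℤ, {F : VField | (g.2 : ℂ) * inner ℂ (waveLp g) F.fst =
        (g.1 : ℂ) * inner ℂ (waveLp g) F.snd}) ∩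
      (({F : VField | inner ℂ (waveLp 0) F.fst = 0} ∩
        {F : VField | inner ℂ (waveLp 0) F.snd = 0}) ∩
      ⋂ g ∈ Sᶜ, ({F : VField | inner ℂ (waveLp g) F.fst = 0} ∩
        {F : VField | inner ℂ (waveLp g) F.snd = 0})) := by
    ext F
    simp [mem_gradSpace]
  rw [e]
  refine (isClosed_iInter fun g => ?_).inter (IsClosed.inter (IsClosed.inter ?_ ?_)
    (isClosed_biInter fun g _ => IsClosed.inter ?_ ?_))
  · exact isClosed_eq (continuous_const.mul (h1 g)) (continuous_const.mul (h2 g))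
  · exact isClosed_eq (h1 0) continuous_const
  · exact isClosed_eq (h2 0) continuous_const
  · exact isClosed_eq (h1 g) continuous_const
  · exact isClosed_eq (h2 g) continuous_const

theorem inner_waveLp_smul_waveLp [DecidableEq (ℤ × ℤ)] (g k : ℤ × ℤ) (c : ℂ) :
    inner ℂ (waveLp g) (c • waveLp k) = if g = k then c else 0 := by
  rw [inner_smul_right, orthonormal_iff_ite.mp orthonormal_waveLp]
  split_ifs <;> simp

theorem mkField_waveLp_mem {S : Set (ℤ × ℤ)} {g : ℤ × ℤ} (hg : g ∈ S) {a b : ℂ}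
    (hab : (g.2 : ℂ) * a = g.1 * b) (h0 : g = 0 → a = 0 ∧ b = 0) :
    mkField (a • waveLp g) (b • waveLp g) ∈ gradSpace S := by
  classical
  refine ⟨fun k => ?_, ⟨?_, ?_⟩, fun k hk => ?_⟩
  · simp only [mkField_fst, mkField_snd, inner_waveLp_smul_waveLp]
    split_ifs with h
    · rw [h]; exact hab
    · simp
  · simp only [mkField_fst, inner_waveLp_smul_waveLp]
    split_ifs with h
    · exact (h0 h.symm).1
    · rfl
  · simp only [mkField_snd, inner_waveLp_smul_waveLp]
    split_ifs with h
    · exact (h0 h.symm).2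
    · rfl
  · simp only [mkField_fst, mkField_snd, inner_waveLp_smul_waveLp]
    have hkg : k ≠ g := by rintro rfl; exact hk hg
    rw [if_neg hkg, if_neg hkg]
    exact ⟨rfl, rfl⟩

/-- A field is orthogonal to the gradients iff it is divergence free at the frequencies in `S`. -/
theorem orthogonal_gradSpace_iff {S : Set (ℤ × ℤ)} {D : VField} :
    (∀ w ∈ gradSpace S, inner ℂ w D = 0) ↔
      ∀ g ∈ S, (g.1 : ℂ) * inner ℂ (waveLp g) D.fst + (g.2 : ℂ) * inner ℂ (waveLp g) D.snd = 0 := by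
  constructor
  · intro h g hg
    -- The test field is, up to a constant factor, the gradient of the single wave of frequency `g`.
    have h1 := h (mkField ((g.1 : ℂ) • waveLp g) ((g.2 : ℂ) • waveLp g))
      (mkField_waveLp_mem hg (mul_comm _ _) (by rintro rfl; simp))
    simpa [VField.inner_eq, inner_smul_left] using h1
  · intro h w hw
    rw [VField.inner_eq]
    have hs := (hasSum_inner_waveLp w.fst D.fst).add (hasSum_inner_waveLp w.snd D.snd)
    refine hs.unique ?_
    convert hasSum_zero with k
    by_cases hk : k ∈ S
    swap
    · rw [(hw.2.2 k hk).1, (hw.2.2 k hk).2]; simp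
    have e1 := hw.1 k
    have e2 := h k hk
    have e1' := congrArg conj e1
    simp only [map_mul, map_intCast] at e1'
    -- At a nonzero frequency in `S` the coefficient of `w` is parallel to `k` and that of `D` is
    -- orthogonal to it in the bilinear sense, so the summand of Parseval's series vanishes. The
    -- algebra divides by a nonzero component of `k`.
    by_cases h1 : k.1 = 0
    · by_cases h2 : k.2 = 0
      · have hk0 : k = 0 := Prod.ext h1 h2
        rw [hk0, hw.2.1.1, hw.2.1.2]; simp
      · have h2' : (k.2 : ℂ) ≠ 0 := by exact_mod_cast h2
        refine (mul_eq_zero.mp (?_ : (k.2 : ℂ) * _ = 0)).resolve_left h2'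
        linear_combination conj (inner ℂ (waveLp k) w.snd) * e2 +
          inner ℂ (waveLp k) D.fst * e1'
    · have h1' : (k.1 : ℂ) ≠ 0 := by exact_mod_cast h1
      refine (mul_eq_zero.mp (?_ : (k.1 : ℂ) * _ = 0)).resolve_left h1'
      linear_combination conj (inner ℂ (waveLp k) w.fst) * e2 -
          inner ℂ (waveLp k) D.snd * e1'

theorem isMinimizer_gradSpace_iff {A : VField →L[ℂ] VField} {S : Set (ℤ × ℤ)} {f u : VField} :
    IsMinimizer A (gradSpace S) f u ↔ u ∈ gradSpace S ∧ ∀ g ∈ S,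
      (g.1 : ℂ) * inner ℂ (waveLp g) (A (f + u)).fst +
        (g.2 : ℂ) * inner ℂ (waveLp g) (A (f + u)).snd = 0 :=
  and_congr_right fun _ => orthogonal_gradSpace_iff

/-- Gradient fields are approximated by those of trigonometric polynomials. -/
theorem exists_gradSpace_near {V : ℕ → Set (ℤ × ℤ)} (hV : Monotone V)
    (hVu : ∀ g, ∃ N, g ∈ V N) {u : VField} (hu : u ∈ gradSpace univ) {ε : ℝ} (hε : 0 < ε) :
    ∃ N, ∃ w ∈ gradSpace (V N), ‖w - u‖ < ε := by
  -- Each term of the componentwise Fourier expansion of a gradient is itself a gradient, so the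
  -- partial sums are admissible approximations.
  have hs : HasSum (fun g => mkField ((inner ℂ (waveLp g) u.fst : ℂ) • waveLp g)
      ((inner ℂ (waveLp g) u.snd : ℂ) • waveLp g)) u :=
    ((hasSum_waveLp u.fst).prodMk (hasSum_waveLp u.snd)).mapL
      (WithLp.prodContinuousLinearEquiv 2 ℂ L2Cell L2Cell).symm.toContinuousLinearMap
  obtain ⟨s, hs⟩ := (Metric.tendsto_atTop.mp hs) ε hε
  choose n hn using hVu
  refine ⟨s.sup n, _, Submodule.sum_mem _ fun g hg => ?_, by
    simpa [dist_eq_norm] using hs s le_rfl⟩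
  refine mkField_waveLp_mem (hV (Finset.le_sup hg) (hn g)) (hu.1 g) ?_
  rintro rfl
  exact hu.2.1

/-- The constant unit field in the first direction. -/
def unitX : VField := mkField (waveLp 0) 0

/-- The constant unit field in the second direction. -/
def unitY : VField := mkField 0 (waveLp 0)

theorem inner_waveLp_zero_self : inner ℂ (waveLp 0) (waveLp 0) = (1 : ℂ) := by
  classical
  rw [orthonormal_iff_ite.mp orthonormal_waveLp, if_pos rfl]

theorem unitX_ne_zero : unitX ≠ 0 := by
  intro h
  have := congrArg (fun F : VField => (inner ℂ (waveLp 0) F.fst : ℂ)) h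
  rw [unitX, mkField_fst, inner_waveLp_zero_self, WithLp.zero_fst, inner_zero_right] at this
  exact one_ne_zero this

theorem inner_unitX (F : VField) : inner ℂ unitX F = inner ℂ (waveLp 0) F.fst := by
  simp [unitX]

theorem inner_unitY (F : VField) : inner ℂ unitY F = inner ℂ (waveLp 0) F.snd := by
  simp [unitY]

theorem minVal_unitX_pos {μ : ℝ × ℝ → ℝ} {m M : ℝ} (h : IsCoeff μ m M) (S : Set (ℤ × ℤ)) :
    0 < minVal (fieldOp (mulOp h)) (gradSpace S) unitX :=
  (isElliptic_fieldOp h).minVal_pos unitX_ne_zero fun w hw => by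
    rw [inner_unitX, hw.2.1.1]

/-! ### Isotropy and duality of the effective coefficient -/

/-- The rotation of frequencies by `π/2`. -/
def rotFreq : ℤ × ℤ ≃ ℤ × ℤ where
  toFun g := (-g.2, g.1)
  invFun g := (g.2, -g.1)
  left_inv g := by simp
  right_inv g := by simp

theorem rotFreq_sub (g k : ℤ × ℤ) : rotFreq g - rotFreq k = rotFreq (g - k) := by
  simp only [rotFreq, Equiv.coe_fn_mk, Prod.mk_sub_mk, Prod.fst_sub, Prod.snd_sub]
  congr 1; ring

/-- The Fourier basis, reindexed by a rotation of the frequencies. -/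
def rotBasis : HilbertBasis (ℤ × ℤ) ℂ L2Cell :=
  HilbertBasis.mk (orthonormal_waveLp.comp rotFreq rotFreq.injective) (by
    rw [rotFreq.surjective.range_comp]
    have := waveBasis.dense_span
    simp only [funext waveBasis_apply] at this
    exact this.ge)

/-- Rotation of a periodic function by `π/2`. -/
def rotOp : L2Cell ≃ₗᵢ[ℂ] L2Cell := waveBasis.repr.trans rotBasis.repr.symm

theorem rotOp_waveLp (g : ℤ × ℤ) : rotOp (waveLp g) = waveLp (rotFreq g) := by
  classical
  have h1 := waveBasis.repr_self g
  have h2 := rotBasis.repr_symm_single g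
  rw [waveBasis_apply] at h1
  rw [rotOp, LinearIsometryEquiv.trans_apply, h1, h2]
  simp [rotBasis]

theorem inner_waveLp_rotOp (g : ℤ × ℤ) (f : L2Cell) :
    inner ℂ (waveLp (rotFreq g)) (rotOp f) = inner ℂ (waveLp g) f := by
  rw [← rotOp_waveLp, LinearIsometryEquiv.inner_map_map]

section Effective

variable {μ : ℝ × ℝ → ℝ} {m M : ℝ}

/-- In the Fourier basis multiplication by `μ` has the matrix `μ̂(g - k)`, which is invariant under
rotation of both indices. This settles single waves. -/
theorem rotOp_mulOp (h : IsCoeff μ m M) (f : L2Cell) :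
    rotOp (mulOp h f) = mulOp h (rotOp f) := by
  have h0 : ∀ g, rotOp (mulOp h (waveLp g)) = mulOp h (rotOp (waveLp g)) := by
    intro g
    refine ext_inner_waveLp fun k => ?_
    obtain ⟨k, rfl⟩ := rotFreq.surjective k
    rw [inner_waveLp_rotOp, rotOp_waveLp, inner_waveLp_mulOp_waveLp, inner_waveLp_mulOp_waveLp,
      rotFreq_sub]
    exact (h.fourier2_rot (k - g)).symm
  -- For general `f`, self-adjointness moves the multiplication onto the wave being paired with,
  -- where the case just proved applies.
  refine ext_inner_waveLp fun k => ?_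
  obtain ⟨k, rfl⟩ := rotFreq.surjective k
  rw [inner_waveLp_rotOp, ← inner_mulOp_left, ← inner_mulOp_left, ← rotOp_waveLp, ← h0,
    LinearIsometryEquiv.inner_map_map]

/-- Rotation of a periodic vector field by `π/2`. -/
def rotField (F : VField) : VField := mkField (-rotOp F.snd) (rotOp F.fst)

theorem rotField_fst (F : VField) : (rotField F).fst = -rotOp F.snd := rfl

theorem rotField_snd (F : VField) : (rotField F).snd = rotOp F.fst := rfl

theorem rotField_add (F W : VField) : rotField (F + W) = rotField F + rotField W := by
  refine VField.ext' ?_ ?_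
  · simp only [rotField_fst, WithLp.add_fst, WithLp.add_snd, map_add, neg_add]
  · simp only [rotField_snd, WithLp.add_fst, WithLp.add_snd, map_add]

theorem inner_rotField (F W : VField) : inner ℂ (rotField F) (rotField W) = inner ℂ F W := by
  simp only [VField.inner_eq, rotField_fst, rotField_snd, inner_neg_neg,
    LinearIsometryEquiv.inner_map_map]
  exact add_comm _ _

theorem fieldOp_rotField (h : IsCoeff μ m M) (F : VField) :
    fieldOp (mulOp h) (rotField F) = rotField (fieldOp (mulOp h) F) := by
  refine VField.ext' ?_ ?_
  · simp only [rotField_fst, fieldOp_fst, fieldOp_snd, map_neg, rotOp_mulOp]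
  · simp only [rotField_snd, fieldOp_fst, fieldOp_snd, rotOp_mulOp]

theorem rotField_unitX : rotField unitX = unitY := by
  refine VField.ext' ?_ ?_
  · simp [rotField_fst, unitX, unitY]
  · rw [rotField_snd, unitX, unitY, mkField_fst, mkField_snd, rotOp_waveLp]
    rfl

theorem rotField_unitY : rotField unitY = -unitX := by
  refine VField.ext' ?_ ?_
  · rw [rotField_fst, unitX, unitY, WithLp.neg_fst, mkField_fst, mkField_snd, rotOp_waveLp]
    rfl
  · simp [rotField_snd, unitX, unitY]

/-- Turning both the frequencies and the components by `π/2` preserves the curl and divergence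
conditions, and by cubic symmetry it commutes with multiplication by `μ`. -/
theorem isMinimizer_rotField (h : IsCoeff μ m M) {f u : VField}
    (hu : IsMinimizer (fieldOp (mulOp h)) (gradSpace univ) f u) :
    IsMinimizer (fieldOp (mulOp h)) (gradSpace univ) (rotField f) (rotField u) := by
  rw [isMinimizer_gradSpace_iff] at hu ⊢
  obtain ⟨⟨h1, ⟨h2, h3⟩, -⟩, h4⟩ := hu
  refine ⟨⟨fun g => ?_, ⟨?_, ?_⟩, fun g hg => absurd (mem_univ g) hg⟩, fun g _ => ?_⟩
  · obtain ⟨g, rfl⟩ := rotFreq.surjective g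
    rw [rotField_fst, rotField_snd, inner_neg_right, inner_waveLp_rotOp, inner_waveLp_rotOp]
    simp only [rotFreq, Equiv.coe_fn_mk, Int.cast_neg]
    linear_combination h1 g
  · have := inner_waveLp_rotOp 0 u.snd
    rw [rotField_fst, inner_neg_right, neg_eq_zero, ← h3, ← this]; rfl
  · have := inner_waveLp_rotOp 0 u.fst
    rw [rotField_snd, ← h2, ← this]; rfl
  · obtain ⟨g, rfl⟩ := rotFreq.surjective g
    rw [← rotField_add, fieldOp_rotField, rotField_fst, rotField_snd, inner_neg_right,
      inner_waveLp_rotOp, inner_waveLp_rotOp]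
    simp only [rotFreq, Equiv.coe_fn_mk, Int.cast_neg]
    linear_combination h4 g (mem_univ g)

/-! ### Complex conjugation of periodic functions and fields -/

theorem inner_waveLp_star (g : ℤ × ℤ) (f : L2Cell) :
    inner ℂ (waveLp g) (star f) = conj (inner ℂ (waveLp (-g)) f) := by
  rw [inner_waveLp, inner_waveLp, ← integral_conj]
  refine integral_congr_ae ?_
  filter_upwards [Lp.coeFn_star f] with x hx
  rw [hx, map_mul, wave_conj, Pi.star_apply, neg_neg]
  rfl

theorem star_mulOp (h : IsCoeff μ m M) (f : L2Cell) :
    mulOp h (star f) = star (mulOp h f) := by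
  refine Lp.ext ?_
  filter_upwards [coeFn_mulOp h (star f), Lp.coeFn_star (mulOp h f), Lp.coeFn_star f,
    coeFn_mulOp h f] with x h1 h2 h3 h4
  rw [h1, h2, h3, Pi.star_apply, Pi.star_apply, h4]
  simp

theorem star_waveLp_zero : star (waveLp 0) = waveLp 0 := by
  refine Lp.ext ?_
  filter_upwards [Lp.coeFn_star (waveLp 0), coeFn_waveLp 0] with x h1 h2
  rw [h1, Pi.star_apply, h2, wave_zero, star_one]

theorem Lp_star_add (f k : L2Cell) : star (f + k) = star f + star k := by
  refine Lp.ext ?_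
  filter_upwards [Lp.coeFn_star (f + k), Lp.coeFn_star f, Lp.coeFn_star k, Lp.coeFn_add f k,
    Lp.coeFn_add (star f) (star k)] with x h1 h2 h3 h4 h5
  rw [h1, h5, Pi.star_apply, h4, Pi.add_apply, Pi.add_apply, h2, h3, star_add]
  rfl

theorem Lp_star_zero : star (0 : L2Cell) = 0 := by
  have := Lp_star_add 0 0
  rwa [add_zero, left_eq_add] at this

/-- The complex conjugate of a vector field. -/
def conjField (F : VField) : VField := mkField (star F.fst) (star F.snd)

/-- Multiplication by the real `μ` commutes with conjugation. Conjugation reverses frequencies,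
hence the requirement that `S` be symmetric. -/
theorem isMinimizer_conjField (h : IsCoeff μ m M) {f u : VField} {S : Set (ℤ × ℤ)}
    (hS : ∀ g ∈ S, -g ∈ S)
    (hu : IsMinimizer (fieldOp (mulOp h)) (gradSpace S) f u) :
    IsMinimizer (fieldOp (mulOp h)) (gradSpace S) (conjField f) (conjField u) := by
  rw [isMinimizer_gradSpace_iff] at hu ⊢
  obtain ⟨⟨h1, ⟨h2, h3⟩, h5⟩, h4⟩ := hu
  refine ⟨⟨fun g => ?_, ⟨?_, ?_⟩, fun g hg => ?_⟩, fun g hg => ?_⟩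
  · have := congrArg conj (h1 (-g))
    simp only [map_mul, map_intCast, Prod.fst_neg, Prod.snd_neg, Int.cast_neg, map_neg] at this
    rw [conjField, mkField_fst, mkField_snd, inner_waveLp_star, inner_waveLp_star]
    linear_combination -this
  · rw [conjField, mkField_fst, inner_waveLp_star, neg_zero, h2, map_zero]
  · rw [conjField, mkField_snd, inner_waveLp_star, neg_zero, h3, map_zero]
  · obtain ⟨h6, h7⟩ := h5 (-g) fun hn => hg (by simpa using hS _ hn)
    rw [conjField, mkField_fst, mkField_snd, inner_waveLp_star, inner_waveLp_star, h6, h7]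
    simp
  · have := congrArg conj (h4 (-g) (hS g hg))
    simp only [map_mul, map_intCast, Prod.fst_neg, Prod.snd_neg, Int.cast_neg, map_neg, map_add,
      map_zero, fieldOp_fst, fieldOp_snd, WithLp.add_fst, WithLp.add_snd] at this
    simp only [fieldOp_fst, fieldOp_snd, WithLp.add_fst, WithLp.add_snd, conjField, mkField_fst,
      mkField_snd, map_add, star_mulOp, inner_add_right, inner_waveLp_star] at this ⊢
    linear_combination -this

/-- The minimal energy of the field `unitX` over all gradients. -/
def effCoeff (h : IsCoeff μ m M) : ℝ := minVal (fieldOp (mulOp h)) (gradSpace univ) unitX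

theorem effCoeff_pos (h : IsCoeff μ m M) : 0 < effCoeff h := minVal_unitX_pos h univ

/-- The flux of the minimizer for `unitX` has no mean component in the second direction. -/
theorem inner_unitY_flux (h : IsCoeff μ m M) {u : VField}
    (hu : IsMinimizer (fieldOp (mulOp h)) (gradSpace univ) unitX u) :
    inner ℂ unitY (fieldOp (mulOp h) (unitX + u)) = 0 := by
  have hA := isElliptic_fieldOp h
  set A := fieldOp (mulOp h) with hAdef
  have hv := isMinimizer_rotField h hu
  have hvv := isMinimizer_rotField h hv
  rw [rotField_unitX] at hv hvv
  rw [rotField_unitY] at hvv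
  set v := rotField u with hvdef
  -- Two rotations by `π/2` send the datum `unitX` to its negative, so uniqueness forces the same
  -- for the minimizer.
  have hneg : -u = rotField v := by
    have h1 : IsMinimizer A (gradSpace univ) (-unitX) (-u) :=
      ⟨neg_mem hu.1, fun w hw => by
        rw [← neg_add, map_neg, inner_neg_right, hu.2 w hw, neg_zero]⟩
    exact h1.unique hA hvv
  -- The datum is real, so by uniqueness the minimizer is real.
  have hconj : conjField u = u := by
    have h1 := isMinimizer_conjField h (fun g _ => mem_univ (-g)) hu
    have h2 : conjField unitX = unitX := by
      refine VField.ext' ?_ ?_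
      · rw [conjField, unitX, mkField_fst, mkField_fst, star_waveLp_zero]
      · rw [conjField, unitX, mkField_snd, mkField_snd, Lp_star_zero]
    rw [h2] at h1
    exact h1.unique hA hu
  -- `a` and `b` are the off-diagonal entries of the effective tensor. Rotation gives `a = -b`,
  -- self-adjointness gives `a = conj b`, and `a` is real; together these force `a = -a`.
  set a := inner ℂ unitY (A (unitX + u)) with ha
  set b := inner ℂ unitX (A (unitY + v)) with hb
  have hab : a = -b := by
    have e : unitX + u = -rotField (unitY + v) := by
      rw [rotField_add, rotField_unitY, ← hneg]; abel
    rw [ha, e, map_neg, inner_neg_right, hAdef, fieldOp_rotField, ← rotField_unitX, inner_rotField,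
      hb, rotField_unitX]
  have hab' : a = conj b := by
    have e1 : a = inner ℂ (unitY + v) (A (unitX + u)) := by
      rw [inner_add_left, hu.2 v hv.1, add_zero]
    have e2 : b = inner ℂ (unitX + u) (A (unitY + v)) := by
      rw [inner_add_left, hv.2 u hu.1, add_zero]
    rw [e1, e2, inner_conj_symm, hA.symm]
  have hreal : conj a = a := by
    rw [ha, inner_unitY, ← neg_zero, ← inner_waveLp_star, hAdef, fieldOp_snd, ← star_mulOp,
      neg_zero]
    congr 2
    have := congrArg (fun F : VField => F.snd) hconj
    simp only [conjField, mkField_snd] at this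
    rw [WithLp.add_snd, Lp_star_add, this, unitX, mkField_snd, Lp_star_zero]
  have h1 : b = a := by
    rw [← hreal, hab', Complex.conj_conj]
  rw [h1] at hab
  have h2 : (2 : ℂ) * a = 0 := by linear_combination hab
  exact (mul_eq_zero.mp h2).resolve_left two_ne_zero

/-- The constant field with the components of `κ`. -/
def constField (κ : ℝ × ℝ) : VField := (κ.1 : ℂ) • unitX + (κ.2 : ℂ) • unitY

/-- The effective tensor is a multiple of the identity: rotation equates its diagonal entries and
the off-diagonal ones vanish. Minimizers depend linearly on the datum, so the energy for `κ` is this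
multiple times `|κ|² = 1`. -/
theorem minVal_constField (h : IsCoeff μ m M) {κ : ℝ × ℝ} (hκ : κ.1 ^ 2 + κ.2 ^ 2 = 1) :
    minVal (fieldOp (mulOp h)) (gradSpace univ) (constField κ) = effCoeff h := by
  have hA := isElliptic_fieldOp h
  obtain ⟨u, hu⟩ := hA.exists_isMinimizer (isClosed_gradSpace univ) unitX
  have hv := isMinimizer_rotField h hu
  rw [rotField_unitX] at hv
  have h11 := hu.inner_eq hA
  have h21 := inner_unitY_flux h hu
  have h22 : inner ℂ unitY (fieldOp (mulOp h) (unitY + rotField u)) = (effCoeff h : ℂ) := by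
    rw [← rotField_unitX, ← rotField_add, fieldOp_rotField, inner_rotField, h11, effCoeff]
  have h12 : inner ℂ unitX (fieldOp (mulOp h) (unitY + rotField u)) = 0 := by
    have e1 : inner ℂ unitY (fieldOp (mulOp h) (unitX + u)) =
        inner ℂ (unitY + rotField u) (fieldOp (mulOp h) (unitX + u)) := by
      rw [inner_add_left, hu.2 _ hv.1, add_zero]
    have e2 : inner ℂ unitX (fieldOp (mulOp h) (unitY + rotField u)) =
        inner ℂ (unitX + u) (fieldOp (mulOp h) (unitY + rotField u)) := by
      rw [inner_add_left, hv.2 u hu.1, add_zero]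
    rw [e2, ← inner_conj_symm, hA.symm, ← e1, h21, map_zero]
  have e : constField κ + ((κ.1 : ℂ) • u + (κ.2 : ℂ) • rotField u) =
      (κ.1 : ℂ) • (unitX + u) + (κ.2 : ℂ) • (unitY + rotField u) := by
    rw [constField]; module
  have hw : IsMinimizer (fieldOp (mulOp h)) (gradSpace univ) (constField κ)
      ((κ.1 : ℂ) • u + (κ.2 : ℂ) • rotField u) := by
    refine ⟨add_mem (Submodule.smul_mem _ _ hu.1) (Submodule.smul_mem _ _ hv.1), fun w hw => ?_⟩
    rw [e, map_add, map_smul, map_smul, inner_add_right, inner_smul_right, inner_smul_right,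
      hu.2 w hw, hv.2 w hw, mul_zero, mul_zero, add_zero]
  have hval := hw.inner_eq hA
  rw [e, constField, map_add, map_smul, map_smul, inner_add_left, inner_add_right, inner_add_right]
    at hval
  simp only [inner_smul_left, inner_smul_right, h11, h12, h21, h22, Complex.conj_ofReal, mul_zero,
    add_zero, zero_add] at hval
  rw [← effCoeff] at hval
  have hκ' : (κ.1 : ℂ) ^ 2 + (κ.2 : ℂ) ^ 2 = 1 := by exact_mod_cast hκ
  have : (effCoeff h : ℂ) = (minVal (fieldOp (mulOp h)) (gradSpace univ) (constField κ) : ℂ) := by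
    rw [constField, ← hval]
    linear_combination -(effCoeff h : ℂ) * hκ'
  exact_mod_cast this.symm

/-- Duality in two dimensions: the effective coefficient of `μ⁻¹` is the reciprocal. -/
theorem effCoeff_recip (h : IsCoeff μ m M) : effCoeff h.recip = (effCoeff h)⁻¹ := by
  have hA := isElliptic_fieldOp h
  have hA' := isElliptic_fieldOp h.recip
  obtain ⟨u, hu⟩ := hA.exists_isMinimizer (isClosed_gradSpace univ) unitX
  have h11 := hu.inner_eq hA
  have h21 := inner_unitY_flux h hu
  rw [← effCoeff] at h11
  set α := effCoeff h with hα
  have hα0 : (α : ℂ) ≠ 0 := by exact_mod_cast (effCoeff_pos h).ne'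
  rw [inner_unitX] at h11
  rw [inner_unitY] at h21
  obtain ⟨⟨h1, ⟨h2, h3⟩, -⟩, h4⟩ := isMinimizer_gradSpace_iff.mp hu
  set D := fieldOp (mulOp h) (unitX + u) with hD
  have hback : fieldOp (mulOp h.recip) D = unitX + u := by
    refine VField.ext' ?_ ?_
    · rw [hD, fieldOp_fst, fieldOp_fst, mulOp_recip_mulOp]
    · rw [hD, fieldOp_snd, fieldOp_snd, mulOp_recip_mulOp]
  have hback1 := congrArg (fun F : VField => F.fst) hback
  have hback2 := congrArg (fun F : VField => F.snd) hback
  simp only [fieldOp_fst, fieldOp_snd] at hback1 hback2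
  -- The flux turned by `π/2` and divided by `α`: it is curl free because `D` is divergence free,
  -- and its mean is `(0, 1)` because the mean of `D` is `(α, 0)`.
  set w : VField := mkField (-(α : ℂ)⁻¹ • D.snd) ((α : ℂ)⁻¹ • D.fst) with hw
  have hc : ∀ g, inner ℂ (waveLp g) (waveLp 0) = (if g = 0 then 1 else 0 : ℂ) := fun g => by
    classical
    rw [orthonormal_iff_ite.mp orthonormal_waveLp]
  -- Since `μ⁻¹ D = unitX + u`, the divergence condition for `μ⁻¹ w` is the curl condition for `u`:
  -- the two conditions change places.
  have hmin : IsMinimizer (fieldOp (mulOp h.recip)) (gradSpace univ) unitY (w - unitY) := by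
    rw [isMinimizer_gradSpace_iff, add_sub_cancel]
    refine ⟨⟨fun g => ?_, ⟨?_, ?_⟩, fun g hg => absurd (mem_univ g) hg⟩, fun g _ => ?_⟩
    · simp only [hw, unitY, WithLp.sub_fst, WithLp.sub_snd, mkField_fst, mkField_snd,
        inner_sub_right, inner_smul_right, inner_zero_right, hc]
      have h5 := h4 g (mem_univ g)
      by_cases hg : g = 0
      · subst hg; simp
      · rw [if_neg hg]
        linear_combination (-(α : ℂ)⁻¹) * h5
    · simp only [hw, unitY, WithLp.sub_fst, mkField_fst, sub_zero, inner_smul_right, h21, mul_zero]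
    · simp only [hw, unitY, WithLp.sub_snd, mkField_snd, inner_sub_right, inner_smul_right, h11,
        inner_waveLp_zero_self]
      rw [inv_mul_cancel₀ hα0, sub_self]
    · simp only [hw, fieldOp_fst, fieldOp_snd, mkField_fst, mkField_snd, map_smul, hback1, hback2,
        inner_smul_right, WithLp.add_fst, WithLp.add_snd, inner_add_right, unitX, hc,
        inner_zero_right]
      have h5 := h1 g
      by_cases hg : g = 0
      · subst hg; simp
      · rw [if_neg hg]
        linear_combination (α : ℂ)⁻¹ * h5
  -- The energy for `μ⁻¹` is the mean of the second component of `μ⁻¹ w`, which is `α⁻¹` times the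
  -- first component of `unitX + u`, of mean `1`.
  have hval := hmin.inner_eq hA'
  rw [add_sub_cancel, inner_unitY, fieldOp_snd, hw, mkField_snd, map_smul, hback1, inner_smul_right,
    WithLp.add_fst, inner_add_right, h2, unitX, mkField_fst, inner_waveLp_zero_self, add_zero,
    mul_one] at hval
  -- The rotation produced the datum `unitY`; isotropy of `μ⁻¹` leads back to `effCoeff`.
  have hY : constField (0, 1) = unitY := by simp [constField]
  rw [← hY, minVal_constField h.recip (by norm_num)] at hval
  exact_mod_cast hval.symm

end Effective

/-! ### The PWE bounds as minimal energies -/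

/-- The frequencies `g` with `|g₁|, |g₂| ≤ N`. -/
def freqBox (N : ℕ) : Set (ℤ × ℤ) :=
  {g | g.1 ∈ Finset.Icc (-(N : ℤ)) N ∧ g.2 ∈ Finset.Icc (-(N : ℤ)) N}

/-- The frequency attached to a pair of harmonics. -/
def harmFreq {N : ℕ} (g : Harm N × Harm N) : ℤ × ℤ := (g.1, g.2)

theorem harmFreq_injective (N : ℕ) : Function.Injective (harmFreq (N := N)) := fun g k h => by
  simp only [harmFreq, Prod.mk.injEq] at h
  exact Prod.ext (Subtype.ext h.1) (Subtype.ext h.2)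

theorem harmFreq_mem {N : ℕ} (g : Harm N × Harm N) : harmFreq g ∈ freqBox N :=
  ⟨g.1.2, g.2.2⟩

theorem exists_harmFreq {N : ℕ} {g : ℤ × ℤ} (hg : g ∈ freqBox N) :
    ∃ k : Harm N × Harm N, harmFreq k = g := ⟨(⟨g.1, hg.1⟩, ⟨g.2, hg.2⟩), rfl⟩

/-- The gradient field with the coefficients `-v g`. -/
def trigField {N : ℕ} (v : Harm N × Harm N → ℂ) : VField :=
  -∑ g, mkField ((v g * (harmFreq g).1) • waveLp (harmFreq g))
    ((v g * (harmFreq g).2) • waveLp (harmFreq g))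

theorem trigField_mem {N : ℕ} (v : Harm N × Harm N → ℂ) :
    trigField v ∈ gradSpace (freqBox N) := by
  refine neg_mem (Submodule.sum_mem _ fun g _ => mkField_waveLp_mem (harmFreq_mem g) ?_ ?_)
  · ring
  · intro h; rw [h]; simp

theorem VField.fst_sum {ι : Type*} (s : Finset ι) (F : ι → VField) :
    (∑ i ∈ s, F i).fst = ∑ i ∈ s, (F i).fst := by
  classical
  induction s using Finset.induction_on with
  | empty => simp
  | insert i s hi ih => rw [Finset.sum_insert hi, Finset.sum_insert hi, WithLp.add_fst, ih]

theorem VField.snd_sum {ι : Type*} (s : Finset ι) (F : ι → VField) :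
    (∑ i ∈ s, F i).snd = ∑ i ∈ s, (F i).snd := by
  classical
  induction s using Finset.induction_on with
  | empty => simp
  | insert i s hi ih => rw [Finset.sum_insert hi, Finset.sum_insert hi, WithLp.add_snd, ih]

theorem trigField_fst {N : ℕ} (v : Harm N × Harm N → ℂ) :
    (trigField v).fst = -∑ g, (v g * (harmFreq g).1) • waveLp (harmFreq g) := by
  rw [trigField, WithLp.neg_fst, VField.fst_sum]; rfl

theorem trigField_snd {N : ℕ} (v : Harm N × Harm N → ℂ) :
    (trigField v).snd = -∑ g, (v g * (harmFreq g).2) • waveLp (harmFreq g) := by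
  rw [trigField, WithLp.neg_snd, VField.snd_sum]; rfl

theorem inner_waveLp_sum {N : ℕ} (c : Harm N × Harm N → ℂ) (k : Harm N × Harm N) :
    inner ℂ (waveLp (harmFreq k)) (∑ g, c g • waveLp (harmFreq g)) = c k := by
  classical
  rw [inner_sum, Finset.sum_eq_single k]
  · rw [inner_waveLp_smul_waveLp, if_pos rfl]
  · intro g _ hg
    rw [inner_waveLp_smul_waveLp, if_neg fun h => hg (harmFreq_injective N h).symm]
  · exact fun h => absurd (Finset.mem_univ k) h

/-- The potential is recovered by dividing a component of each Fourier coefficient by the matching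
nonzero component of the frequency. -/
theorem exists_trigField {N : ℕ} {u : VField} (hu : u ∈ gradSpace (freqBox N)) :
    ∃ v : Harm N × Harm N → ℂ, trigField v = u := by
  -- At `g = 0` the quotient takes the default value `0`, which is harmless because a gradient has
  -- no mean.
  let v : Harm N × Harm N → ℂ := fun g => -(if (harmFreq g).1 = 0
    then inner ℂ (waveLp (harmFreq g)) u.snd / (harmFreq g).2
    else inner ℂ (waveLp (harmFreq g)) u.fst / (harmFreq g).1)
  refine ⟨v, ?_⟩
  have hmem := trigField_mem v
  have key : ∀ k : Harm N × Harm N,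
      -(v k * (harmFreq k).1) = inner ℂ (waveLp (harmFreq k)) u.fst ∧
      -(v k * (harmFreq k).2) = inner ℂ (waveLp (harmFreq k)) u.snd := by
    intro k
    simp only [v]
    have h1 := hu.1 (harmFreq k)
    split_ifs with h
    · by_cases h2 : (harmFreq k).2 = 0
      · have h0 : harmFreq k = 0 := Prod.ext h h2
        rw [h0, hu.2.1.1, hu.2.1.2]; simp
      · have h2' : ((harmFreq k).2 : ℂ) ≠ 0 := by exact_mod_cast h2
        rw [h, Int.cast_zero, zero_mul] at h1
        rw [(mul_eq_zero.mp h1).resolve_left h2', h]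
        constructor
        · simp
        · field_simp
    · have h' : ((harmFreq k).1 : ℂ) ≠ 0 := by exact_mod_cast h
      constructor
      · field_simp
      · field_simp
        linear_combination h1
  refine VField.ext' (ext_inner_waveLp fun g => ?_) (ext_inner_waveLp fun g => ?_)
  · by_cases hg : g ∈ freqBox N
    · obtain ⟨k, rfl⟩ := exists_harmFreq hg
      rw [trigField_fst, inner_neg_right, inner_waveLp_sum, (key k).1]
    · rw [(hmem.2.2 g hg).1, (hu.2.2 g hg).1]
  · by_cases hg : g ∈ freqBox N
    · obtain ⟨k, rfl⟩ := exists_harmFreq hg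
      rw [trigField_snd, inner_neg_right, inner_waveLp_sum, (key k).2]
    · rw [(hmem.2.2 g hg).2, (hu.2.2 g hg).2]

section PWE

variable {μ : ℝ × ℝ → ℝ} {m M : ℝ}

theorem inner_waveLp_flux_trigField_fst (h : IsCoeff μ m M) {N : ℕ} (v : Harm N × Harm N → ℂ)
    (k : ℤ × ℤ) :
    inner ℂ (waveLp k) (fieldOp (mulOp h) (unitX + trigField v)).fst =
      fourier2 μ k - ∑ g, v g * (harmFreq g).1 * fourier2 μ (k - harmFreq g) := by
  rw [fieldOp_fst, WithLp.add_fst, trigField_fst, unitX, mkField_fst, map_add, map_neg, map_sum,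
    inner_add_right, inner_neg_right, inner_waveLp_mulOp_waveLp, sub_zero, inner_sum,
    ← sub_eq_add_neg]
  simp only [map_smul, inner_smul_right, inner_waveLp_mulOp_waveLp]

theorem inner_waveLp_flux_trigField_snd (h : IsCoeff μ m M) {N : ℕ} (v : Harm N × Harm N → ℂ)
    (k : ℤ × ℤ) :
    inner ℂ (waveLp k) (fieldOp (mulOp h) (unitX + trigField v)).snd =
      -∑ g, v g * (harmFreq g).2 * fourier2 μ (k - harmFreq g) := by
  rw [fieldOp_snd, WithLp.add_snd, trigField_snd, unitX, mkField_snd, zero_add, map_neg, map_sum,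
    inner_neg_right, inner_sum]
  simp only [map_smul, inner_smul_right, inner_waveLp_mulOp_waveLp]

/-- Row `k` of the linear system is the divergence condition at the frequency `k` for the flux of
`unitX + trigField v`. The minus sign in `trigField` puts `f_{NN}` on the right-hand side. The row
`k = 0` is trivial, so the matrix is never invertible and one speaks of preimages. -/
theorem pwe_preimage_iff (h : IsCoeff μ m M) {N : ℕ} (v : Harm N × Harm N → ℂ) :
    pweMatrix μ N *ᵥ v = pweVec μ N ↔
      IsMinimizer (fieldOp (mulOp h)) (gradSpace (freqBox N)) unitX (trigField v) := by
  rw [isMinimizer_gradSpace_iff, and_iff_right (trigField_mem v), funext_iff]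
  have key : ∀ k : Harm N × Harm N, (pweMatrix μ N *ᵥ v) k = pweVec μ N k ↔
      ((harmFreq k).1 : ℂ) *
        inner ℂ (waveLp (harmFreq k)) (fieldOp (mulOp h) (unitX + trigField v)).fst +
      ((harmFreq k).2 : ℂ) *
        inner ℂ (waveLp (harmFreq k)) (fieldOp (mulOp h) (unitX + trigField v)).snd = 0 := by
    intro k
    have e : (pweMatrix μ N *ᵥ v) k =
        ((harmFreq k).1 : ℂ) * ∑ g, v g * (harmFreq g).1 * fourier2 μ (harmFreq k - harmFreq g) +
        ((harmFreq k).2 : ℂ) *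
          ∑ g, v g * (harmFreq g).2 * fourier2 μ (harmFreq k - harmFreq g) := by
      rw [Finset.mul_sum, Finset.mul_sum, ← Finset.sum_add_distrib]
      refine Finset.sum_congr rfl fun g _ => ?_
      simp only [pweMatrix, Matrix.of_apply, harmFreq, Prod.mk_sub_mk]
      push_cast; ring
    rw [inner_waveLp_flux_trigField_fst, inner_waveLp_flux_trigField_snd, e]
    have e2 : pweVec μ N k = fourier2 μ (harmFreq k) * ((harmFreq k).1 : ℂ) := rfl
    rw [e2]
    constructor
    · intro h; linear_combination -h
    · intro h; linear_combination -h
  constructor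
  · intro hv g hg
    obtain ⟨k, rfl⟩ := exists_harmFreq hg
    exact (key k).mp (hv k)
  · intro hv k
    exact (key k).mpr (hv _ (harmFreq_mem k))

theorem mean_eq_fourier2 : mean (fun x => (μ x : ℂ)) = fourier2 μ 0 := by
  rw [fourier2_eq, mean]
  simp [wave_zero]

/-- Because `μ` is real, conjugating `μ̂(g)` gives `μ̂(-g)`, and the expression becomes the mean
flux of the trial field. -/
theorem pwe_value (h : IsCoeff μ m M) {N : ℕ} (v : Harm N × Harm N → ℂ) :
    mean (fun x => (μ x : ℂ)) - star (pweVec μ N) ⬝ᵥ v =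
      inner ℂ unitX (fieldOp (mulOp h) (unitX + trigField v)) := by
  rw [inner_unitX, inner_waveLp_flux_trigField_fst, mean_eq_fourier2]
  congr 1
  refine Finset.sum_congr rfl fun g _ => ?_
  rw [Pi.star_apply, show pweVec μ N g = fourier2 μ (harmFreq g) * ((harmFreq g).1 : ℂ) from rfl,
    zero_sub, ← fourier2_conj]
  simp only [star_mul', RCLike.star_def, map_intCast]
  ring

theorem pwe_value_eq_minVal (h : IsCoeff μ m M) {N : ℕ} {v : Harm N × Harm N → ℂ}
    (hv : pweMatrix μ N *ᵥ v = pweVec μ N) :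
    mean (fun x => (μ x : ℂ)) - star (pweVec μ N) ⬝ᵥ v =
      (minVal (fieldOp (mulOp h)) (gradSpace (freqBox N)) unitX : ℂ) := by
  rw [pwe_value h, ((pwe_preimage_iff h v).mp hv).inner_eq (isElliptic_fieldOp h)]

theorem exists_pwe_preimage (h : IsCoeff μ m M) (N : ℕ) :
    ∃ v, pweMatrix μ N *ᵥ v = pweVec μ N := by
  obtain ⟨u, hu⟩ := (isElliptic_fieldOp h).exists_isMinimizer
    (isClosed_gradSpace (freqBox N)) unitX
  obtain ⟨v, rfl⟩ := exists_trigField hu.1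
  exact ⟨v, (pwe_preimage_iff h v).mpr hu⟩

theorem pweBound_eq (h : IsCoeff μ m M) (N : ℕ) :
    pweBound μ N = minVal (fieldOp (mulOp h)) (gradSpace (freqBox N)) unitX := by
  have hex := exists_pwe_preimage h N
  rw [pweBound, dif_pos hex, pwe_value_eq_minVal h hex.choose_spec, Complex.ofReal_re]

theorem pweWellDefined (h : IsCoeff μ m M) (N : ℕ) : PweWellDefined μ N := by
  refine ⟨exists_pwe_preimage h N, fun v hv => ?_, ?_⟩
  · rw [pwe_value_eq_minVal h hv, pweBound_eq h]
  · rw [pweBound_eq h]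
    exact minVal_unitX_pos h _

end PWE

/-! ### The effective coefficient as a minimal energy -/

theorem wave_hasFDerivAt (g : ℤ × ℤ) (x : ℝ × ℝ) :
    ∃ L : ℝ × ℝ →L[ℝ] ℂ, HasFDerivAt (wave g) L x ∧
      ∀ e, L e = 2 * Real.pi * Complex.I * (g.1 * e.1 + g.2 * e.2) * wave g x := by
  have h1 := (wave1_hasDerivAt g.1 x.1).hasFDerivAt.comp x hasFDerivAt_fst
  have h2 := (wave1_hasDerivAt g.2 x.2).hasFDerivAt.comp x hasFDerivAt_snd
  refine ⟨_, h1.mul h2, fun e => ?_⟩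
  simp [wave]
  ring

theorem fderiv_wave (g : ℤ × ℤ) (x e : ℝ × ℝ) :
    fderiv ℝ (wave g) x e = 2 * Real.pi * Complex.I * (g.1 * e.1 + g.2 * e.2) * wave g x := by
  obtain ⟨L, hL, h⟩ := wave_hasFDerivAt g x
  rw [hL.fderiv, h]

theorem isTest_wave (g : ℤ × ℤ) : IsTest (wave g) := by
  have h1 : ∀ n : ℤ, ContDiff ℝ ∞ (wave1 n) := fun n => by
    unfold wave1
    exact Complex.contDiff_exp.comp
      (contDiff_const.mul (contDiff_const.mul Complex.ofRealCLM.contDiff))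
  refine ⟨((h1 g.1).comp contDiff_fst).mul ((h1 g.2).comp contDiff_snd), fun x => ?_⟩
  simp only [wave, wave1_add_one, and_self]

theorem IsTest.mul_wave {φ : ℝ × ℝ → ℂ} (hφ : IsTest φ) (g : ℤ × ℤ) :
    IsTest fun x => φ x * wave g x := by
  refine ⟨hφ.1.mul (isTest_wave g).1, fun x => ?_⟩
  simp only [(hφ.2 x).1, (hφ.2 x).2, ((isTest_wave g).2 x).1, ((isTest_wave g).2 x).2, and_self]

theorem Continuous.memLp_cell {f : ℝ × ℝ → ℂ} (hf : Continuous f) :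
    MemLp f 2 (volume.restrict cell) := by
  obtain ⟨C, hC⟩ := (isCompact_Icc.prod isCompact_Icc : IsCompact cell).exists_bound_of_continuousOn
    hf.continuousOn
  refine MemLp.of_bound hf.aestronglyMeasurable C ?_
  exact (ae_restrict_iff' (measurableSet_Icc.prod measurableSet_Icc)).mpr
    (Eventually.of_forall hC)

theorem IsTest.memLp {φ : ℝ × ℝ → ℂ} (hφ : IsTest φ) : MemLp φ 2 (volume.restrict cell) :=
  Continuous.memLp_cell hφ.1.continuous

theorem IsTest.memLp_fderiv {φ : ℝ × ℝ → ℂ} (hφ : IsTest φ) (e : ℝ × ℝ) :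
    MemLp (fun x => fderiv ℝ φ x e) 2 (volume.restrict cell) :=
  Continuous.memLp_cell ((hφ.1.continuous_fderiv (by simp)).clm_apply continuous_const)

/-- Parseval's identity for the bilinear pairing. -/
theorem hasSum_integral_mul {f k : ℝ × ℝ → ℂ} (hf : MemLp f 2 (volume.restrict cell))
    (hk : MemLp k 2 (volume.restrict cell)) :
    HasSum (fun g => (∫ x in cell, wave g x * f x) * ∫ x in cell, wave (-g) x * k x)
      (∫ x in cell, k x * f x) := by
  have hf' : MemLp (fun x => conj (f x)) 2 (volume.restrict cell) :=
    hf.of_le (Complex.continuous_conj.comp_aestronglyMeasurable hf.1)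
      (Eventually.of_forall fun x => by simp)
  have h := hasSum_inner_waveLp hf'.toLp hk.toLp
  have e : inner ℂ hf'.toLp hk.toLp = ∫ x in cell, k x * f x := by
    rw [L2.inner_def]
    refine integral_congr_ae ?_
    filter_upwards [hf'.coeFn_toLp, hk.coeFn_toLp] with x h1 h2
    rw [RCLike.inner_apply, h1, h2, Complex.conj_conj]
  rw [e] at h
  convert h using 2 with g
  rw [inner_waveLp_toLp, inner_waveLp_toLp, ← integral_conj]
  simp only [map_mul, wave_conj, neg_neg, Complex.conj_conj]

/-- Integration by parts: the derivative of the periodic product `φ * wave g` has zero mean. -/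
theorem integral_wave_mul_fderiv {e : ℝ × ℝ}
    (he : ∀ φ, IsTest φ → ∫ x in cell, fderiv ℝ φ x e = 0) {φ : ℝ × ℝ → ℂ} (hφ : IsTest φ)
    (g : ℤ × ℤ) :
    ∫ x in cell, wave g x * fderiv ℝ φ x e =
      -(2 * Real.pi * Complex.I * (g.1 * e.1 + g.2 * e.2) * ∫ x in cell, wave g x * φ x) := by
  have h := he _ (hφ.mul_wave g)
  have e1 : ∀ x, fderiv ℝ (fun x => φ x * wave g x) x e = wave g x * fderiv ℝ φ x e +
      2 * Real.pi * Complex.I * (g.1 * e.1 + g.2 * e.2) * (wave g x * φ x) := by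
    intro x
    rw [fderiv_fun_mul (hφ.1.differentiable (by simp) x)
      ((isTest_wave g).1.differentiable (by simp) x)]
    simp only [add_apply, smul_apply, fderiv_wave,
      smul_eq_mul]
    ring
  simp only [e1] at h
  rw [integral_add (wave_mul_integrable g ((hφ.memLp_fderiv e).integrable (by norm_num)))
    ((wave_mul_integrable g (hφ.memLp.integrable (by norm_num))).const_mul _),
    integral_const_mul] at h
  linear_combination h

/-- Parseval turns both sides of the weak identity into series over frequencies, which agree term by
term. With `coeff_of_hasWeakDeriv` this characterises weak derivatives by Fourier coefficients. -/
theorem hasWeakDeriv_of_coeff {e : ℝ × ℝ}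
    (he : ∀ φ, IsTest φ → ∫ x in cell, fderiv ℝ φ x e = 0) {u d : ℝ × ℝ → ℂ}
    (hu : MemLp u 2 (volume.restrict cell)) (hd : MemLp d 2 (volume.restrict cell))
    (h : ∀ g : ℤ × ℤ, ∫ x in cell, wave (-g) x * d x =
      2 * Real.pi * Complex.I * (g.1 * e.1 + g.2 * e.2) * ∫ x in cell, wave (-g) x * u x) :
    HasWeakDeriv u d e := by
  intro φ hφ
  have h1 := hasSum_integral_mul (hφ.memLp_fderiv e) hu
  have h2 := (hasSum_integral_mul hφ.memLp hd).neg
  have e1 : (fun g => (∫ x in cell, wave g x * fderiv ℝ φ x e) * ∫ x in cell, wave (-g) x * u x) =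
      fun g => -((∫ x in cell, wave g x * φ x) * ∫ x in cell, wave (-g) x * d x) :=
    funext fun g => by rw [integral_wave_mul_fderiv he hφ, h]; ring
  rw [e1] at h1
  exact h1.unique h2

theorem coeff_of_hasWeakDeriv {e : ℝ × ℝ} {u d : ℝ × ℝ → ℂ} (h : HasWeakDeriv u d e)
    (g : ℤ × ℤ) :
    ∫ x in cell, wave (-g) x * d x =
      2 * Real.pi * Complex.I * (g.1 * e.1 + g.2 * e.2) * ∫ x in cell, wave (-g) x * u x := by
  have h1 := h _ (isTest_wave (-g))
  have e1 : ∫ x in cell, u x * fderiv ℝ (wave (-g)) x e =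
      -(2 * Real.pi * Complex.I * (g.1 * e.1 + g.2 * e.2)) *
        ∫ x in cell, wave (-g) x * u x := by
    rw [← integral_const_mul]
    refine integral_congr_ae (Eventually.of_forall fun x => ?_)
    simp only [fderiv_wave, Prod.fst_neg, Prod.snd_neg]
    push_cast; ring
  have e2 : ∫ x in cell, d x * wave (-g) x = ∫ x in cell, wave (-g) x * d x := by
    simp only [mul_comm]
  rw [e1, e2] at h1
  linear_combination h1

/-- The gradient of an element of `H¹`, as a vector field. -/
def H1Per.grad (v : H1Per) : VField := mkField v.memLp_d1.toLp v.memLp_d2.toLp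

theorem H1Per.coeFn_grad_fst (v : H1Per) : v.grad.fst =ᵐ[volume.restrict cell] v.d1 :=
  v.memLp_d1.coeFn_toLp

theorem H1Per.coeFn_grad_snd (v : H1Per) : v.grad.snd =ᵐ[volume.restrict cell] v.d2 :=
  v.memLp_d2.coeFn_toLp

theorem H1Per.grad_mem (v : H1Per) : v.grad ∈ gradSpace univ := by
  have h1 := coeff_of_hasWeakDeriv v.weak_d1
  have h2 := coeff_of_hasWeakDeriv v.weak_d2
  refine ⟨fun g => ?_, ⟨?_, ?_⟩, fun g hg => absurd (mem_univ g) hg⟩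
  · rw [grad, mkField_fst, mkField_snd, inner_waveLp_toLp, inner_waveLp_toLp, h1, h2]
    push_cast; ring
  · rw [grad, mkField_fst, inner_waveLp_toLp, h1]; simp
  · rw [grad, mkField_snd, inner_waveLp_toLp, h2]; simp

theorem summable_norm_inner_waveLp_sq (f : L2Cell) :
    Summable fun g => ‖(inner ℂ (waveLp g) f : ℂ)‖ ^ 2 := by
  have h := (hasSum_inner_waveLp f f).summable.norm
  refine h.congr fun g => ?_
  rw [norm_mul, RCLike.norm_conj, sq]

/-- Every field in the closure of the gradients is the gradient of an element of `H¹`. -/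
theorem exists_grad_eq {F : VField} (hF : F ∈ gradSpace univ) : ∃ v : H1Per, v.grad = F := by
  -- The Fourier coefficients of the potential, found by dividing by a nonzero symbol `2πi g_j`; at
  -- `g = 0` the value is `0`, which fixes the additive constant.
  let c : ℤ × ℤ → ℂ := fun g => if g.1 = 0
    then inner ℂ (waveLp g) F.snd / (2 * Real.pi * Complex.I * g.2)
    else inner ℂ (waveLp g) F.fst / (2 * Real.pi * Complex.I * g.1)
  have hpi : (2 * Real.pi * Complex.I : ℂ) ≠ 0 := by simp [Real.pi_ne_zero]
  -- The symbol has modulus at least `1` for `n ≠ 0`, and division by `0` yields `0`. Hence `c` is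
  -- dominated by the coefficients of `F` and is square summable.
  have hdiv : ∀ (z : ℂ) (n : ℤ), ‖z / (2 * Real.pi * Complex.I * n)‖ ≤ ‖z‖ := by
    intro z n
    rcases eq_or_ne n 0 with rfl | hn
    · simp
    · rw [norm_div]
      refine div_le_self (norm_nonneg _) ?_
      have h1 : (1 : ℝ) ≤ ‖(n : ℂ)‖ := by
        rw [Complex.norm_intCast]; exact_mod_cast Int.one_le_abs hn
      have h2 : ‖(2 * Real.pi * Complex.I : ℂ)‖ = 2 * Real.pi := by
        simp [abs_of_pos Real.pi_pos]
      rw [norm_mul, h2]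
      nlinarith [Real.pi_gt_three]
  have hc1 : ∀ g, 2 * Real.pi * Complex.I * g.1 * c g = inner ℂ (waveLp g) F.fst := by
    intro g
    simp only [c]
    split_ifs with h
    · rw [h, Int.cast_zero, mul_zero, zero_mul]
      by_cases h2 : g.2 = 0
      · rw [show g = 0 from Prod.ext h h2, hF.2.1.1]
      · have := hF.1 g
        rw [h, Int.cast_zero, zero_mul] at this
        exact ((mul_eq_zero.mp this).resolve_left (by exact_mod_cast h2)).symm
    · have h' : (g.1 : ℂ) ≠ 0 := by exact_mod_cast h
      rw [mul_div_cancel₀ _ (mul_ne_zero hpi h')]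
  have hc2 : ∀ g, 2 * Real.pi * Complex.I * g.2 * c g = inner ℂ (waveLp g) F.snd := by
    intro g
    simp only [c]
    split_ifs with h
    · by_cases h2 : g.2 = 0
      · rw [show g = 0 from Prod.ext h h2, hF.2.1.2]; simp
      · have h' : (g.2 : ℂ) ≠ 0 := by exact_mod_cast h2
        rw [mul_div_cancel₀ _ (mul_ne_zero hpi h')]
    · have h' : (g.1 : ℂ) ≠ 0 := by exact_mod_cast h
      have := hF.1 g
      field_simp
      linear_combination this
  have hmem : Memℓp c 2 := by
    refine memℓp_gen ?_
    simp only [ENNReal.toReal_ofNat, Real.rpow_ofNat]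
    refine Summable.of_nonneg_of_le (fun g => sq_nonneg _) (fun g => ?_)
      ((summable_norm_inner_waveLp_sq F.fst).add (summable_norm_inner_waveLp_sq F.snd))
    simp only [c]
    split_ifs
    · have := pow_le_pow_left₀ (norm_nonneg _) (hdiv (inner ℂ (waveLp g) F.snd) g.2) 2
      exact this.trans (le_add_of_nonneg_left (sq_nonneg _))
    · have := pow_le_pow_left₀ (norm_nonneg _) (hdiv (inner ℂ (waveLp g) F.fst) g.1) 2
      exact this.trans (le_add_of_nonneg_right (sq_nonneg _))
  let v : L2Cell := waveBasis.repr.symm ⟨c, hmem⟩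
  have hv : ∀ g, inner ℂ (waveLp g) v = c g := by
    intro g
    rw [← waveBasis_apply, ← HilbertBasis.repr_apply_apply, LinearIsometryEquiv.apply_symm_apply]
  have hvi : ∀ g, ∫ x in cell, wave (-g) x * v x = c g := fun g => by
    rw [← inner_waveLp, hv]
  refine ⟨⟨v, F.fst, F.snd, Lp.memLp _, Lp.memLp _, Lp.memLp _, ?_, ?_⟩, ?_⟩
  · refine hasWeakDeriv_of_coeff (fun φ => integral_deriv_test_fst) (Lp.memLp _) (Lp.memLp _)
      fun g => ?_
    rw [hvi, ← inner_waveLp, ← hc1]; push_cast; ring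
  · refine hasWeakDeriv_of_coeff (fun φ => integral_deriv_test_snd) (Lp.memLp _) (Lp.memLp _)
      fun g => ?_
    rw [hvi, ← inner_waveLp, ← hc2]; push_cast; ring
  · refine VField.ext' ?_ ?_
    · exact Lp.toLp_coeFn F.fst (Lp.memLp _)
    · exact Lp.toLp_coeFn F.snd (Lp.memLp _)

section MuEff

variable {μ : ℝ × ℝ → ℝ} {m M : ℝ}

theorem inner_fieldOp (h : IsCoeff μ m M) {F W : VField} {f₁ f₂ w₁ w₂ : ℝ × ℝ → ℂ}
    (hf₁ : F.fst =ᵐ[volume.restrict cell] f₁) (hf₂ : F.snd =ᵐ[volume.restrict cell] f₂)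
    (hw₁ : W.fst =ᵐ[volume.restrict cell] w₁) (hw₂ : W.snd =ᵐ[volume.restrict cell] w₂) :
    inner ℂ F (fieldOp (mulOp h) W) =
      ∫ x in cell, (μ x : ℂ) * (w₁ x * conj (f₁ x) + w₂ x * conj (f₂ x)) := by
  rw [VField.inner_eq, L2.inner_def, L2.inner_def, ← integral_add (L2.integrable_inner _ _)
    (L2.integrable_inner _ _)]
  refine integral_congr_ae ?_
  filter_upwards [hf₁, hf₂, hw₁, hw₂, coeFn_mulOp h W.fst, coeFn_mulOp h W.snd]
    with x h1 h2 h3 h4 h5 h6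
  rw [RCLike.inner_apply, RCLike.inner_apply, fieldOp_fst, fieldOp_snd, h1, h2, h5, h6, h3, h4]
  ring

theorem coeFn_constField_fst (κ : ℝ × ℝ) :
    (constField κ).fst =ᵐ[volume.restrict cell] fun _ => (κ.1 : ℂ) := by
  have e : (constField κ).fst = (κ.1 : ℂ) • waveLp 0 := by
    simp only [constField, unitX, unitY, WithLp.add_fst, WithLp.smul_fst, mkField_fst, smul_zero,
      add_zero]
  rw [e]
  filter_upwards [Lp.coeFn_smul (κ.1 : ℂ) (waveLp 0), coeFn_waveLp 0] with x h1 h2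
  rw [h1, Pi.smul_apply, h2, wave_zero, smul_eq_mul, mul_one]

theorem coeFn_constField_snd (κ : ℝ × ℝ) :
    (constField κ).snd =ᵐ[volume.restrict cell] fun _ => (κ.2 : ℂ) := by
  have e : (constField κ).snd = (κ.2 : ℂ) • waveLp 0 := by
    simp only [constField, unitX, unitY, WithLp.add_snd, WithLp.smul_snd, mkField_snd, smul_zero,
      zero_add]
  rw [e]
  filter_upwards [Lp.coeFn_smul (κ.2 : ℂ) (waveLp 0), coeFn_waveLp 0] with x h1 h2
  rw [h1, Pi.smul_apply, h2, wave_zero, smul_eq_mul, mul_one]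

theorem formC0_eq (h : IsCoeff μ m M) (u v : H1Per) :
    formC0 μ u v = inner ℂ v.grad (fieldOp (mulOp h) u.grad) :=
  (inner_fieldOp h v.coeFn_grad_fst v.coeFn_grad_snd u.coeFn_grad_fst
    u.coeFn_grad_snd).symm

theorem formC1_one_left (h : IsCoeff μ m M) (κ : ℝ × ℝ) (v : H1Per) :
    formC1 μ κ H1Per.one v =
      Complex.I * inner ℂ v.grad (fieldOp (mulOp h) (constField κ)) := by
  rw [inner_fieldOp h v.coeFn_grad_fst v.coeFn_grad_snd (coeFn_constField_fst κ)
    (coeFn_constField_snd κ)]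
  simp [formC1, H1Per.one]

theorem formC1_one_right (h : IsCoeff μ m M) (κ : ℝ × ℝ) (u : H1Per) :
    formC1 μ κ u H1Per.one =
      -Complex.I * inner ℂ (constField κ) (fieldOp (mulOp h) u.grad) := by
  rw [inner_fieldOp h (coeFn_constField_fst κ) (coeFn_constField_snd κ) u.coeFn_grad_fst
    u.coeFn_grad_snd]
  simp [formC1, H1Per.one, mul_comm]

/-- Testing against all of `H¹` is testing against all gradient fields, by `grad_mem` and
`exists_grad_eq`. The factor `-i` in `𝒞₁` makes `i ∇h`, and not `∇h`, the minimizer. -/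
theorem isCorrector_iff (h : IsCoeff μ m M) (κ : ℝ × ℝ) (u : H1Per) :
    IsCorrector μ κ u ↔ IsMinimizer (fieldOp (mulOp h)) (gradSpace univ) (constField κ)
      (Complex.I • u.grad) := by
  have key : ∀ v : H1Per, formC0 μ u v = formC1 μ κ H1Per.one v ↔
      inner ℂ v.grad (fieldOp (mulOp h) (constField κ + Complex.I • u.grad)) = 0 := by
    intro v
    rw [formC0_eq h, formC1_one_left h, map_add, map_smul, inner_add_right, inner_smul_right]
    constructor
    · intro e
      rw [e, ← mul_assoc, Complex.I_mul_I]; ring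
    · intro e
      linear_combination -Complex.I * e + inner ℂ v.grad (fieldOp (mulOp h) u.grad) * Complex.I_sq
  constructor
  · intro hu
    refine ⟨Submodule.smul_mem _ _ u.grad_mem, fun w hw => ?_⟩
    obtain ⟨v, rfl⟩ := exists_grad_eq hw
    exact (key v).mp (hu v)
  · intro hu v
    exact (key v).mpr (hu.2 _ v.grad_mem)

theorem inner_constField_self (h : IsCoeff μ m M) {κ : ℝ × ℝ} (hκ : κ.1 ^ 2 + κ.2 ^ 2 = 1) :
    inner ℂ (constField κ) (fieldOp (mulOp h) (constField κ)) = mean fun x => (μ x : ℂ) := by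
  rw [inner_fieldOp h (coeFn_constField_fst κ) (coeFn_constField_snd κ) (coeFn_constField_fst κ)
    (coeFn_constField_snd κ), mean]
  have e : (κ.1 : ℂ) * κ.1 + κ.2 * κ.2 = 1 := by
    have : κ.1 * κ.1 + κ.2 * κ.2 = 1 := by linarith
    exact_mod_cast this
  simp only [Complex.conj_ofReal, e, mul_one]

/-- The mean of `μ` is `⟪κ, A κ⟫` for a unit vector `κ`, and minus the form term is `⟪κ, A (i ∇h)⟫`;
their sum is the mean flux of the minimizing field in the direction `κ`. -/
theorem corrector_value (h : IsCoeff μ m M) {κ : ℝ × ℝ} (hκ : κ.1 ^ 2 + κ.2 ^ 2 = 1) {u : H1Per}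
    (hu : IsCorrector μ κ u) :
    mean (fun x => (μ x : ℂ)) - formC1 μ κ u H1Per.one = (effCoeff h : ℂ) := by
  have h1 := ((isCorrector_iff h κ u).mp hu).inner_eq (isElliptic_fieldOp h)
  rw [minVal_constField h hκ, map_add, inner_add_right, inner_constField_self h hκ, map_smul,
    inner_smul_right] at h1
  rw [formC1_one_right h, ← h1]
  ring

theorem exists_isCorrector (h : IsCoeff μ m M) (κ : ℝ × ℝ) : ∃ u, IsCorrector μ κ u := by
  obtain ⟨F, hF⟩ := (isElliptic_fieldOp h).exists_isMinimizer (isClosed_gradSpace univ)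
    (constField κ)
  obtain ⟨u, hu⟩ := exists_grad_eq (Submodule.smul_mem _ (-Complex.I) hF.1)
  refine ⟨u, (isCorrector_iff h κ u).mpr ?_⟩
  rw [hu, smul_smul]
  simpa using hF

theorem muEff_eq (h : IsCoeff μ m M) {κ : ℝ × ℝ} (hκ : κ.1 ^ 2 + κ.2 ^ 2 = 1) :
    muEff μ κ = effCoeff h := by
  have hex := exists_isCorrector h κ
  rw [muEff, dif_pos hex, corrector_value h hκ hex.choose_spec, Complex.ofReal_re]

theorem muEffWellDefined (h : IsCoeff μ m M) {κ : ℝ × ℝ} (hκ : κ.1 ^ 2 + κ.2 ^ 2 = 1) :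
    MuEffWellDefined μ κ :=
  ⟨exists_isCorrector h κ, fun u hu => by rw [corrector_value h hκ hu, muEff_eq h hκ]⟩

end MuEff

/-! ### Peano series and Riemann products in a Banach algebra -/

section Peano

variable {𝔸 : Type*} [NormedRing 𝔸] {Q : ℝ → 𝔸} {C : ℝ}

theorem intervalIntegrable_mul_of_bound (hQm : StronglyMeasurable Q) (hQ : ∀ y, ‖Q y‖ ≤ C)
    {f : ℝ → 𝔸} {a b : ℝ} (hf : ContinuousOn f (uIcc a b)) :
    IntervalIntegrable (fun y => Q y * f y) volume a b := by
  have h := hf.intervalIntegrable (μ := volume)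
  rw [intervalIntegrable_iff] at h ⊢
  exact Integrable.bdd_mul h hQm.aestronglyMeasurable (Eventually.of_forall hQ)

variable [NormedAlgebra ℝ 𝔸]

/-- The terms of the Peano series of `Y' = Q Y`, `Y 0 = 1`. -/
def iterInt (Q : ℝ → 𝔸) : ℕ → ℝ → 𝔸
  | 0, _ => 1
  | n + 1, x => ∫ y in (0 : ℝ)..x, Q y * iterInt Q n y

/-- The sum of the Peano series. -/
def peanoSum (Q : ℝ → 𝔸) (x : ℝ) : 𝔸 := ∑' n, iterInt Q n x

theorem iterInt_continuous (hQm : StronglyMeasurable Q) (hQ : ∀ y, ‖Q y‖ ≤ C) (n : ℕ) :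
    Continuous (iterInt Q n) := by
  induction n with
  | zero => exact continuous_const
  | succ n ih =>
    exact intervalIntegral.continuous_primitive
      (fun a b => intervalIntegrable_mul_of_bound hQm hQ ih.continuousOn) 0

/-- Each integration raises the power of `x` by one and contributes a factor `1 / (n + 1)`. The
factor `‖1‖` is kept because the norm of the ring is not assumed to be normalised. -/
theorem norm_iterInt_le (hQ : ∀ y, ‖Q y‖ ≤ C) (n : ℕ) {x : ℝ} (hx : 0 ≤ x) :
    ‖iterInt Q n x‖ ≤ ‖(1 : 𝔸)‖ * ((C * x) ^ n / n.factorial) := by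
  have hC : 0 ≤ C := (norm_nonneg _).trans (hQ 0)
  induction n generalizing x with
  | zero => simp [iterInt]
  | succ n ih =>
    have h1 : ‖iterInt Q (n + 1) x‖ ≤
        ∫ y in (0 : ℝ)..x, C * (‖(1 : 𝔸)‖ * ((C * y) ^ n / n.factorial)) := by
      refine intervalIntegral.norm_integral_le_of_norm_le hx (Eventually.of_forall fun y hy => ?_)
        (by apply Continuous.intervalIntegrable; fun_prop)
      exact (norm_mul_le _ _).trans (mul_le_mul (hQ y) (ih hy.1.le) (norm_nonneg _) hC)
    refine h1.trans_eq ?_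
    have e : ∀ y : ℝ, C * (‖(1 : 𝔸)‖ * ((C * y) ^ n / n.factorial)) =
        C * ‖(1 : 𝔸)‖ * C ^ n / n.factorial * y ^ n := fun y => by rw [mul_pow]; ring
    simp only [e]
    rw [intervalIntegral.integral_const_mul, integral_pow, Nat.factorial_succ]
    push_cast
    have h2 : ((n : ℝ) + 1) ≠ 0 := by positivity
    have h3 : (n.factorial : ℝ) ≠ 0 := by positivity
    field_simp
    ring

theorem norm_iterInt_le_of_mem (hQ : ∀ y, ‖Q y‖ ≤ C) (n : ℕ) {x : ℝ} (hx : x ∈ Icc (0 : ℝ) 1) :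
    ‖iterInt Q n x‖ ≤ ‖(1 : 𝔸)‖ * (C ^ n / n.factorial) := by
  have hC : 0 ≤ C := (norm_nonneg _).trans (hQ 0)
  refine (norm_iterInt_le hQ n hx.1).trans ?_
  have : C * x ≤ C := mul_le_of_le_one_right hC hx.2
  have h0 : 0 ≤ C * x := mul_nonneg hC hx.1
  gcongr

variable [CompleteSpace 𝔸]

theorem summable_iterInt (hQ : ∀ y, ‖Q y‖ ≤ C) {x : ℝ} (hx : x ∈ Icc (0 : ℝ) 1) :
    Summable fun n => iterInt Q n x :=
  Summable.of_norm_bounded ((Real.summable_pow_div_factorial C).mul_left ‖(1 : 𝔸)‖)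
    fun n => norm_iterInt_le_of_mem hQ n hx

theorem continuousOn_peanoSum (hQm : StronglyMeasurable Q) (hQ : ∀ y, ‖Q y‖ ≤ C) :
    ContinuousOn (peanoSum Q) (Icc 0 1) :=
  continuousOn_tsum (fun n => (iterInt_continuous hQm hQ n).continuousOn)
    ((Real.summable_pow_div_factorial C).mul_left ‖(1 : 𝔸)‖)
    fun n _ hx => norm_iterInt_le_of_mem hQ n hx

/-- Termwise integration, justified by dominated convergence. The integral equation replaces `Y' = Q
Y`, since `Q` is merely bounded and measurable. -/
theorem peanoSum_eq (hQm : StronglyMeasurable Q) (hQ : ∀ y, ‖Q y‖ ≤ C) {x : ℝ}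
    (hx : x ∈ Icc (0 : ℝ) 1) :
    peanoSum Q x = 1 + ∫ y in (0 : ℝ)..x, Q y * peanoSum Q y := by
  have hC : 0 ≤ C := (norm_nonneg _).trans (hQ 0)
  have hs : Summable fun n : ℕ => C * (‖(1 : 𝔸)‖ * (C ^ n / n.factorial)) :=
    ((Real.summable_pow_div_factorial C).mul_left ‖(1 : 𝔸)‖).mul_left C
  have hmem : ∀ y, y ∈ uIoc 0 x → y ∈ Icc (0 : ℝ) 1 := fun y hy => by
    rw [uIoc_of_le hx.1] at hy
    exact ⟨hy.1.le, hy.2.trans hx.2⟩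
  have h := intervalIntegral.hasSum_integral_of_dominated_convergence (μ := volume) (a := 0)
    (b := x) (F := fun n y => Q y * iterInt Q n y) (f := fun y => Q y * peanoSum Q y)
    (fun n _ => C * (‖(1 : 𝔸)‖ * (C ^ n / n.factorial)))
    (fun n => (hQm.mul (iterInt_continuous hQm hQ n).stronglyMeasurable).aestronglyMeasurable)
    (fun n => Eventually.of_forall fun y hy => (norm_mul_le _ _).trans
      (mul_le_mul (hQ y) (norm_iterInt_le_of_mem hQ n (hmem y hy)) (norm_nonneg _) hC))
    (Eventually.of_forall fun _ _ => hs) intervalIntegrable_const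
    (Eventually.of_forall fun y hy => (summable_iterInt hQ (hmem y hy)).hasSum.mul_left (Q y))
  rw [peanoSum, (summable_iterInt hQ hx).tsum_eq_zero_add, ← h.tsum_eq]
  rfl

theorem peanoSum_sub_eq (hQm : StronglyMeasurable Q) (hQ : ∀ y, ‖Q y‖ ≤ C) {a b : ℝ}
    (ha : 0 ≤ a) (hab : a ≤ b) (hb : b ≤ 1) :
    peanoSum Q b - peanoSum Q a = ∫ y in a..b, Q y * peanoSum Q y := by
  have hi : ∀ c d, c ∈ Icc (0 : ℝ) 1 → d ∈ Icc (0 : ℝ) 1 →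
      IntervalIntegrable (fun y => Q y * peanoSum Q y) volume c d := fun c d hc hd =>
    intervalIntegrable_mul_of_bound hQm hQ
      ((continuousOn_peanoSum hQm hQ).mono (uIcc_subset_Icc hc hd))
  have h0 : (0 : ℝ) ∈ Icc (0 : ℝ) 1 := ⟨le_rfl, zero_le_one⟩
  have ha' : a ∈ Icc (0 : ℝ) 1 := ⟨ha, hab.trans hb⟩
  have hb' : b ∈ Icc (0 : ℝ) 1 := ⟨ha.trans hab, hb⟩
  rw [peanoSum_eq hQm hQ ha', peanoSum_eq hQm hQ hb', add_sub_add_left_eq_sub,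
    intervalIntegral.integral_interval_sub_left (hi 0 b h0 hb') (hi 0 a h0 ha')]

/-- The Riemann product of the first `j` factors. -/
def prodSteps (Q : ℝ → 𝔸) (k : ℕ) : ℕ → 𝔸
  | 0 => 1
  | j + 1 => (1 + (1 / (k : ℝ)) • Q ((j : ℝ) / (k : ℝ))) * prodSteps Q k j

/-- The error made by sampling `Q Y` at the left end points of the cells of length `1/k`. -/
def sampleError (Q : ℝ → 𝔸) (k : ℕ) (y : ℝ) : 𝔸 :=
  Q ((⌊y * k⌋₊ : ℝ) / k) * peanoSum Q ((⌊y * k⌋₊ : ℝ) / k) - Q y * peanoSum Q y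

theorem floor_mul_div_mem {k : ℕ} (hk : 0 < k) {y : ℝ} (hy : y ∈ Icc (0 : ℝ) 1) :
    (⌊y * k⌋₊ : ℝ) / k ∈ Icc (0 : ℝ) 1 := by
  have hk' : (0 : ℝ) < k := by exact_mod_cast hk
  refine ⟨by positivity, ?_⟩
  rw [div_le_one hk']
  refine (Nat.floor_le (mul_nonneg hy.1 hk'.le)).trans ?_
  exact mul_le_of_le_one_left hk'.le hy.2

theorem sampleError_aestronglyMeasurable (hQm : StronglyMeasurable Q) (hQ : ∀ y, ‖Q y‖ ≤ C)
    (k : ℕ) : AEStronglyMeasurable (sampleError Q k) (volume.restrict (Icc 0 1)) := by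
  refine AEStronglyMeasurable.sub ?_ (hQm.aestronglyMeasurable.mul
    ((continuousOn_peanoSum hQm hQ).aestronglyMeasurable measurableSet_Icc))
  -- The sampled term depends on `y` only through the integer `⌊y * k⌋₊`, so its measurability needs
  -- no information on `Q` or on the Peano sum.
  have h1 : StronglyMeasurable fun n : ℕ => Q ((n : ℝ) / k) * peanoSum Q ((n : ℝ) / k) :=
    StronglyMeasurable.of_discrete
  exact (h1.comp_measurable
    (Nat.measurable_floor.comp (measurable_id.mul_const (k : ℝ)))).aestronglyMeasurable

theorem exists_norm_sampleError_le (hQm : StronglyMeasurable Q) (hQ : ∀ y, ‖Q y‖ ≤ C) :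
    ∃ B, ∀ k : ℕ, 0 < k → ∀ y ∈ Icc (0 : ℝ) 1, ‖sampleError Q k y‖ ≤ B := by
  have hC : 0 ≤ C := (norm_nonneg _).trans (hQ 0)
  obtain ⟨D, hD⟩ := isCompact_Icc.exists_bound_of_continuousOn (continuousOn_peanoSum hQm hQ)
  refine ⟨C * D + C * D, fun k hk y hy => (norm_sub_le _ _).trans (add_le_add ?_ ?_)⟩
  · exact (norm_mul_le _ _).trans
      (mul_le_mul (hQ _) (hD _ (floor_mul_div_mem hk hy)) (norm_nonneg _) hC)
  · exact (norm_mul_le _ _).trans (mul_le_mul (hQ _) (hD _ hy) (norm_nonneg _) hC)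

/-- At a continuity point of `Q` the left grid points tend to `y`, so the error tends to `0` almost
everywhere, and it is uniformly bounded. -/
theorem tendsto_integral_sampleError (hQm : StronglyMeasurable Q) (hQ : ∀ y, ‖Q y‖ ≤ C)
    (hQc : ∀ᵐ y : ℝ, ContinuousAt Q y) :
    Tendsto (fun k : ℕ => ∫ y in (0 : ℝ)..1, ‖sampleError Q k y‖) atTop (𝓝 0) := by
  obtain ⟨B, hB⟩ := exists_norm_sampleError_le hQm hQ
  suffices h : Tendsto (fun k : ℕ => ∫ y in (0 : ℝ)..1, ‖sampleError Q k y‖) atTop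
      (𝓝 (∫ _ in (0 : ℝ)..1, (0 : ℝ))) by
    simpa using h
  refine intervalIntegral.tendsto_integral_filter_of_dominated_convergence (μ := volume)
    (fun _ => B) ?_ ?_ intervalIntegrable_const ?_
  · refine Eventually.of_forall fun k => ?_
    rw [uIoc_of_le zero_le_one, restrict_Ioc_eq_restrict_Icc]
    exact (sampleError_aestronglyMeasurable hQm hQ k).norm
  · filter_upwards [eventually_gt_atTop 0] with k hk
    refine Eventually.of_forall fun y hy => ?_
    rw [uIoc_of_le zero_le_one] at hy
    rw [norm_norm]
    exact hB k hk y ⟨hy.1.le, hy.2⟩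
  · have h1 : ∀ᵐ y : ℝ, y ≠ 1 := Measure.ae_ne volume 1
    filter_upwards [hQc, h1] with y hy hy1 hmem
    rw [uIoc_of_le zero_le_one] at hmem
    have hY : ContinuousAt (peanoSum Q) y := (continuousOn_peanoSum hQm hQ).continuousAt
      (Icc_mem_nhds hmem.1 (lt_of_le_of_ne hmem.2 hy1))
    have hl : Tendsto (fun k : ℕ => (⌊y * k⌋₊ : ℝ) / k) atTop (𝓝 y) :=
      (tendsto_nat_floor_mul_div_atTop hmem.1.le).comp tendsto_natCast_atTop_atTop
    have h2 : Tendsto (fun k : ℕ => sampleError Q k y) atTop (𝓝 0) := by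
      have h3 := ((hy.mul hY).tendsto.comp hl).sub_const (Q y * peanoSum Q y)
      rwa [Pi.mul_apply, sub_self] at h3
    simpa using h2.norm

theorem floor_mul_eq_of_mem {k j : ℕ} (hk : 0 < k) {y : ℝ}
    (hy : y ∈ Ico ((j : ℝ) / k) (((j + 1 : ℕ) : ℝ) / k)) : ⌊y * k⌋₊ = j := by
  have hk' : (0 : ℝ) < k := by exact_mod_cast hk
  rw [Nat.floor_eq_iff (mul_nonneg (le_trans (by positivity) hy.1) hk'.le)]
  refine ⟨(div_le_iff₀ hk').mp hy.1, ?_⟩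
  have := (lt_div_iff₀ hk').mp hy.2
  push_cast at this
  exact this

/-- A discrete Gronwall estimate: over one cell the error is multiplied by `1 + Q/k`, of norm effect
at most `1 + C/k ≤ exp (C/k)`, and increases by the integral of the sampling error over that cell.
-/
theorem norm_prodSteps_sub_le (hQm : StronglyMeasurable Q) (hQ : ∀ y, ‖Q y‖ ≤ C) {k : ℕ}
    (hk : 0 < k) {j : ℕ} (hj : j ≤ k) :
    ‖prodSteps Q k j - peanoSum Q ((j : ℝ) / k)‖ ≤
      Real.exp (C * (j / k)) * ∫ y in (0 : ℝ)..((j : ℝ) / k), ‖sampleError Q k y‖ := by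
  have hC : 0 ≤ C := (norm_nonneg _).trans (hQ 0)
  have hk' : (0 : ℝ) < k := by exact_mod_cast hk
  obtain ⟨B, hB⟩ := exists_norm_sampleError_le hQm hQ
  have hint : ∀ a b : ℝ, 0 ≤ a → a ≤ b → b ≤ 1 →
      IntervalIntegrable (sampleError Q k) volume a b := by
    intro a b ha hab hb
    have h01 : IntegrableOn (sampleError Q k) (Icc 0 1) :=
      Integrable.of_bound (sampleError_aestronglyMeasurable hQm hQ k) B
        ((ae_restrict_iff' measurableSet_Icc).mpr (Eventually.of_forall (hB k hk)))
    exact (h01.mono_set (uIcc_subset_Icc ⟨ha, hab.trans hb⟩ ⟨ha.trans hab, hb⟩)).intervalIntegrable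
  induction j with
  | zero =>
    have h0 : peanoSum Q 0 = 1 := by
      rw [peanoSum_eq hQm hQ ⟨le_rfl, zero_le_one⟩, intervalIntegral.integral_same, add_zero]
    simp [prodSteps, h0]
  | succ j ih =>
    have ih := ih (Nat.le_of_succ_le hj)
    set a : ℝ := (j : ℝ) / k with ha
    set b : ℝ := ((j + 1 : ℕ) : ℝ) / k with hb
    have hba : b = a + 1 / k := by rw [ha, hb]; push_cast; ring
    have ha0 : 0 ≤ a := by positivity
    have hab : a ≤ b := by rw [hba]; linarith [one_div_pos.mpr hk']
    have hb1 : b ≤ 1 := by rw [hb, div_le_one hk']; exact_mod_cast hj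
    set E := prodSteps Q k j - peanoSum Q a with hE
    set I := ∫ y in (0 : ℝ)..a, ‖sampleError Q k y‖ with hI
    -- On the cell from `a` to `b` the sampling point is `a`, so the integral of the sampling error
    -- is the local defect of Euler's scheme.
    have hr : ∫ y in a..b, sampleError Q k y =
        (1 / (k : ℝ)) • (Q a * peanoSum Q a) - (peanoSum Q b - peanoSum Q a) := by
      have e1 : ∫ y in a..b, sampleError Q k y =
          ∫ y in a..b, (Q a * peanoSum Q a - Q y * peanoSum Q y) := by
        refine intervalIntegral.integral_congr_ae ?_
        filter_upwards [Measure.ae_ne volume b] with y hyb hy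
        rw [uIoc_of_le hab] at hy
        rw [sampleError, floor_mul_eq_of_mem hk ⟨hy.1.le, lt_of_le_of_ne hy.2 hyb⟩]
      rw [e1, intervalIntegral.integral_sub intervalIntegrable_const
        (intervalIntegrable_mul_of_bound hQm hQ ((continuousOn_peanoSum hQm hQ).mono
          (uIcc_subset_Icc ⟨ha0, hab.trans hb1⟩ ⟨ha0.trans hab, hb1⟩))),
        intervalIntegral.integral_const, peanoSum_sub_eq hQm hQ ha0 hab hb1, hba,
        add_sub_cancel_left]
    have hstep : prodSteps Q k (j + 1) - peanoSum Q b =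
        E + (1 / (k : ℝ)) • (Q a * E) + ∫ y in a..b, sampleError Q k y := by
      rw [hr, hE, prodSteps, ← ha, add_mul, one_mul, smul_mul_assoc, mul_sub, smul_sub]
      abel
    have hJ : ‖∫ y in a..b, sampleError Q k y‖ ≤ ∫ y in a..b, ‖sampleError Q k y‖ :=
      intervalIntegral.norm_integral_le_integral_norm hab
    have hsplit : ∫ y in (0 : ℝ)..b, ‖sampleError Q k y‖ =
        I + ∫ y in a..b, ‖sampleError Q k y‖ :=
      (intervalIntegral.integral_add_adjacent_intervals
        (hint 0 a le_rfl ha0 (hab.trans hb1)).norm (hint a b ha0 hab hb1).norm).symm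
    have hJ0 : 0 ≤ ∫ y in a..b, ‖sampleError Q k y‖ :=
      intervalIntegral.integral_nonneg hab fun y _ => norm_nonneg _
    have hQE : ‖(1 / (k : ℝ)) • (Q a * E)‖ ≤ C / k * ‖E‖ := by
      rw [norm_smul, Real.norm_of_nonneg (by positivity)]
      calc 1 / (k : ℝ) * ‖Q a * E‖ ≤ 1 / (k : ℝ) * (C * ‖E‖) := by
            gcongr
            exact (norm_mul_le _ _).trans (mul_le_mul_of_nonneg_right (hQ a) (norm_nonneg _))
        _ = C / k * ‖E‖ := by ring
    have hexp : Real.exp (C * b) = Real.exp (C * a) * Real.exp (C / k) := by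
      rw [← Real.exp_add, hba]; congr 1; ring
    have hI0 : 0 ≤ I := intervalIntegral.integral_nonneg ha0 fun y _ => norm_nonneg _
    have h1 : 1 + C / k ≤ Real.exp (C / k) := by linarith [Real.add_one_le_exp (C / k)]
    have h2 : (1 : ℝ) ≤ Real.exp (C * b) := Real.one_le_exp (mul_nonneg hC (ha0.trans hab))
    have hCk : 0 ≤ C / k := by positivity
    rw [hstep, hsplit, mul_add]
    refine (norm_add_le _ _).trans (add_le_add ((norm_add_le _ _).trans ?_) (hJ.trans ?_))
    · calc ‖E‖ + ‖(1 / (k : ℝ)) • (Q a * E)‖ ≤ (1 + C / k) * ‖E‖ := by linarith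
        _ ≤ Real.exp (C / k) * (Real.exp (C * a) * I) := by gcongr
        _ = Real.exp (C * b) * I := by rw [hexp]; ring
    · exact le_mul_of_one_le_left hJ0 h2

/-- The Riemann products converge to the sum of the Peano series if `Q` is continuous almost
everywhere. -/
theorem tendsto_prodSteps (hQm : StronglyMeasurable Q) (hQ : ∀ y, ‖Q y‖ ≤ C)
    (hQc : ∀ᵐ y : ℝ, ContinuousAt Q y) :
    Tendsto (fun k => prodSteps Q k (k + 1)) atTop (𝓝 (peanoSum Q 1)) := by
  have h1 : Tendsto (fun k => prodSteps Q k k) atTop (𝓝 (peanoSum Q 1)) := by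
    rw [tendsto_iff_norm_sub_tendsto_zero]
    have h2 := (tendsto_integral_sampleError hQm hQ hQc).const_mul (Real.exp C)
    rw [mul_zero] at h2
    refine squeeze_zero' (Eventually.of_forall fun _ => norm_nonneg _) ?_ h2
    filter_upwards [eventually_gt_atTop 0] with k hk
    have h3 := norm_prodSteps_sub_le hQm hQ hk le_rfl
    rwa [div_self (by positivity : (k : ℝ) ≠ 0), mul_one] at h3
  -- The Riemann product has `k + 1` factors, one more than there are cells. The additional factor
  -- `1 + Q(1)/k` tends to `1`.
  have h2 : Tendsto (fun k : ℕ => (1 / (k : ℝ)) • Q ((k : ℝ) / k)) atTop (𝓝 0) := by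
    rw [tendsto_zero_iff_norm_tendsto_zero]
    have h3 : Tendsto (fun k : ℕ => 1 / (k : ℝ) * C) atTop (𝓝 0) := by
      have := tendsto_one_div_atTop_nhds_zero_nat (𝕜 := ℝ)
      simpa using this.mul_const C
    refine squeeze_zero (fun _ => norm_nonneg _) (fun k => ?_) h3
    rw [norm_smul, Real.norm_of_nonneg (by positivity)]
    exact mul_le_mul_of_nonneg_left (hQ _) (by positivity)
  have h3 := (h2.const_add 1).mul h1
  rw [add_zero, one_mul] at h3
  exact h3

end Peano

/-! ### Matrix-valued multiplicative integrals -/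

section MatrixPeano

variable {ι : Type*} [Fintype ι] [DecidableEq ι]

/-- Square matrices as a Banach algebra, with the operator norm of `ℓ^∞`. -/
def MatAlg (ι : Type*) : Type _ := Matrix ι ι ℂ

instance : NormedRing (MatAlg ι) := Matrix.linftyOpNormedRing (n := ι) (α := ℂ)

instance : NormedAlgebra ℝ (MatAlg ι) := Matrix.linftyOpNormedAlgebra (n := ι) (R := ℝ) (α := ℂ)

instance : FiniteDimensional ℝ (MatAlg ι) :=
  inferInstanceAs (FiniteDimensional ℝ (Matrix ι ι ℂ))

instance : CompleteSpace (MatAlg ι) := FiniteDimensional.complete ℝ _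

/-- The entries of a matrix, as continuous linear maps. -/
def MatAlg.entry (i j : ι) : MatAlg ι →L[ℝ] ℂ :=
  LinearMap.toContinuousLinearMap
    { toFun := fun A => A i j
      map_add' := fun _ _ => rfl
      map_smul' := fun _ _ => rfl }

variable {Q : ℝ → Matrix ι ι ℂ} {C : ℝ}

/-- A matrix function as a function with values in the Banach algebra of matrices. -/
def toMatAlg (Q : ℝ → Matrix ι ι ℂ) : ℝ → MatAlg ι := Q

theorem stronglyMeasurable_toMatAlg (hQm : ∀ i j, Measurable fun x => Q x i j) :
    StronglyMeasurable (toMatAlg Q) := by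
  let L : ℂ → ι → ι → MatAlg ι := fun c i j => (c • Matrix.single i j (1 : ℂ) : Matrix ι ι ℂ)
  have hL : ∀ i j, Continuous fun c => L c i j := fun i j =>
    LinearMap.continuous_of_finiteDimensional
      ({ toFun := fun c => L c i j
         map_add' := fun a b => add_smul a b (Matrix.single i j (1 : ℂ))
         map_smul' := fun r c => smul_assoc r c (Matrix.single i j (1 : ℂ)) } : ℂ →ₗ[ℝ] MatAlg ι)
  have e : toMatAlg Q = fun x => ∑ i, ∑ j, L (Q x i j) i j := by
    funext x
    refine (Matrix.matrix_eq_sum_single (Q x)).trans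
      (Finset.sum_congr rfl fun i _ => Finset.sum_congr rfl fun j _ => ?_)
    simp [L]
  rw [e]
  exact Finset.stronglyMeasurable_fun_sum _ fun i _ =>
    Finset.stronglyMeasurable_fun_sum _ fun j _ =>
      (hL i j).comp_stronglyMeasurable (hQm i j).stronglyMeasurable

theorem norm_toMatAlg_le (hQ : ∀ x i j, ‖Q x i j‖ ≤ C) (x : ℝ) :
    ‖toMatAlg Q x‖ ≤ Fintype.card ι * C := by
  have hn : ‖toMatAlg Q x‖ = ↑(Finset.univ.sup fun i => ∑ j, ‖Q x i j‖₊) :=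
    Matrix.linfty_opNorm_def (Q x)
  rw [hn]
  -- For an empty index type the hypothesis says nothing about the sign of `C`, but both sides are
  -- `0`.
  rcases isEmpty_or_nonempty ι with h | ⟨⟨i₀⟩⟩
  · simp
  · have hC : 0 ≤ C := (norm_nonneg _).trans (hQ x i₀ i₀)
    have h1 : (Finset.univ.sup fun i => ∑ j, ‖Q x i j‖₊) ≤ Fintype.card ι * C.toNNReal := by
      refine Finset.sup_le fun i _ => ?_
      refine (Finset.sum_le_card_nsmul _ _ C.toNNReal fun j _ => ?_).trans_eq (by simp)
      rw [← NNReal.coe_le_coe, Real.coe_toNNReal _ hC]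
      exact hQ x i j
    have h2 := NNReal.coe_le_coe.mpr h1
    rwa [NNReal.coe_mul, NNReal.coe_natCast, Real.coe_toNNReal _ hC] at h2

theorem intervalIntegral_entry {f : ℝ → MatAlg ι} {a b : ℝ}
    (hf : IntervalIntegrable f volume a b) (i j : ι) :
    MatAlg.entry i j (∫ y in a..b, f y) = ∫ y in a..b, MatAlg.entry i j (f y) :=
  ((MatAlg.entry i j).intervalIntegral_comp_comm hf).symm

/-- Taking an entry is a continuous linear map, so it commutes with the Bochner integral; this links
the Banach algebra to the entrywise definition. -/
theorem iterInt_eq_peanoTerm (hQm : StronglyMeasurable (toMatAlg Q))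
    (hQ : ∀ x, ‖toMatAlg Q x‖ ≤ C) (n : ℕ) (x : ℝ) :
    iterInt (toMatAlg Q) n x = (peanoTerm Q n x : Matrix ι ι ℂ) := by
  induction n generalizing x with
  | zero => rfl
  | succ n ih =>
    refine Matrix.ext fun i j => ?_
    have h := intervalIntegral_entry (a := 0) (b := x)
      (intervalIntegrable_mul_of_bound hQm hQ (iterInt_continuous hQm hQ n).continuousOn) i j
    have e : iterInt (toMatAlg Q) n = fun y => (peanoTerm Q n y : Matrix ι ι ℂ) := funext ih
    refine h.trans ?_
    rw [e]
    rfl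

theorem prodSteps_eq_partialProduct (k j : ℕ) :
    prodSteps (toMatAlg Q) k j = (partialProduct Q k j : Matrix ι ι ℂ) := by
  induction j with
  | zero => rfl
  | succ j ih =>
    rw [prodSteps, partialProduct, ih]
    have e : (1 / (k : ℂ)) • Q ((j : ℝ) / k) = (1 / (k : ℝ)) • Q ((j : ℝ) / k) := by
      ext a b
      simp
    rw [e]
    rfl

theorem summable_peanoTerm (hQm : ∀ i j, Measurable fun x => Q x i j)
    (hQ : ∀ x i j, ‖Q x i j‖ ≤ C) : Summable fun n => peanoTerm Q n 1 := by
  have h := summable_iterInt (norm_toMatAlg_le hQ) (x := 1) ⟨zero_le_one, le_rfl⟩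
  have e : (fun n => iterInt (toMatAlg Q) n 1) = fun n => (peanoTerm Q n 1 : Matrix ι ι ℂ) :=
    funext fun n => iterInt_eq_peanoTerm (stronglyMeasurable_toMatAlg hQm) (norm_toMatAlg_le hQ) n 1
  rw [e] at h
  exact h

theorem multIntegral_eq_peanoSum (hQm : ∀ i j, Measurable fun x => Q x i j)
    (hQ : ∀ x i j, ‖Q x i j‖ ≤ C) : (multIntegral Q : Matrix ι ι ℂ) = peanoSum (toMatAlg Q) 1 := by
  have e : (fun n => iterInt (toMatAlg Q) n 1) = fun n => (peanoTerm Q n 1 : Matrix ι ι ℂ) :=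
    funext fun n => iterInt_eq_peanoTerm (stronglyMeasurable_toMatAlg hQm) (norm_toMatAlg_le hQ) n 1
  rw [peanoSum, e]
  rfl

theorem tendsto_riemannProduct (hQm : ∀ i j, Measurable fun x => Q x i j)
    (hQ : ∀ x i j, ‖Q x i j‖ ≤ C) (hQc : ∀ᵐ x : ℝ, ∀ i j, ContinuousAt (fun x => Q x i j) x) :
    Tendsto (fun k => riemannProduct Q k) atTop (𝓝 (multIntegral Q)) := by
  have hQc' : ∀ᵐ x : ℝ, ContinuousAt (toMatAlg Q) x := by
    filter_upwards [hQc] with x hx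
    exact continuousAt_pi.mpr fun i => continuousAt_pi.mpr fun j => hx i j
  have h := tendsto_prodSteps (stronglyMeasurable_toMatAlg hQm) (norm_toMatAlg_le hQ) hQc'
  have e : (fun k => prodSteps (toMatAlg Q) k (k + 1)) =
      fun k => (riemannProduct Q k : Matrix ι ι ℂ) :=
    funext fun k => prodSteps_eq_partialProduct k (k + 1)
  rw [e, ← multIntegral_eq_peanoSum hQm hQ] at h
  exact h

/-- The fundamental solution of `Y' = Q Y`, in integrated form. -/
theorem exists_fundamental (hQm : ∀ i j, Measurable fun x => Q x i j)
    (hQ : ∀ x i j, ‖Q x i j‖ ≤ C) :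
    ∃ Y : ℝ → Matrix ι ι ℂ, Y 0 = 1 ∧ Y 1 = multIntegral Q ∧
      (∀ i j, ContinuousOn (fun x => Y x i j) (Icc 0 1)) ∧
      ∀ x ∈ Icc (0 : ℝ) 1, ∀ i j, Y x i j = Y 0 i j + ∫ y in (0 : ℝ)..x, (Q y * Y y) i j := by
  have hm := stronglyMeasurable_toMatAlg hQm
  have hb := norm_toMatAlg_le hQ
  have hc := continuousOn_peanoSum hm hb
  have h0 : peanoSum (toMatAlg Q) 0 = 1 := by
    rw [peanoSum_eq hm hb ⟨le_rfl, zero_le_one⟩, intervalIntegral.integral_same, add_zero]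
  let Y : ℝ → MatAlg ι := peanoSum (toMatAlg Q)
  refine ⟨Y, h0, (multIntegral_eq_peanoSum hQm hQ).symm, fun i j => ?_,
    fun x hx i j => ?_⟩
  · exact (MatAlg.entry i j).continuous.comp_continuousOn hc
  · have h1 := congrArg (MatAlg.entry i j) (peanoSum_eq hm hb hx)
    rw [map_add, intervalIntegral_entry (intervalIntegrable_mul_of_bound hm hb
      (hc.mono (uIcc_subset_Icc ⟨le_rfl, zero_le_one⟩ hx))), ← h0] at h1
    exact h1

end MatrixPeano

/-! ### The Toeplitz matrices and the system matrix -/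

section System

variable {μ : ℝ × ℝ → ℝ} {m M : ℝ}

theorem fourier1_eq (n : ℤ) (x : ℝ) :
    fourier1 μ n x = ∫ y in Icc (0 : ℝ) 1, (μ (x, y) : ℂ) * wave1 (-n) y := by
  refine integral_congr_ae (Eventually.of_forall fun y => ?_)
  simp only [wave1]
  congr 2
  push_cast; ring

theorem IsCoeff.measurable_section (h : IsCoeff μ m M) (x : ℝ) :
    Measurable fun y => (μ (x, y) : ℂ) :=
  h.measurable_ofReal.comp measurable_prodMk_left

theorem IsCoeff.integrable_section_mul (h : IsCoeff μ m M) (x : ℝ) {f : ℝ → ℂ}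
    (hf : Continuous f) :
    Integrable (fun y => (μ (x, y) : ℂ) * f y) (volume.restrict (Icc (0 : ℝ) 1)) :=
  Integrable.bdd_mul (c := M) (hf.continuousOn.integrableOn_compact isCompact_Icc)
    (h.measurable_section x).aestronglyMeasurable (Eventually.of_forall fun _ => h.norm_le _)

theorem norm_fourier1_le (h : IsCoeff μ m M) (n : ℤ) (x : ℝ) : ‖fourier1 μ n x‖ ≤ M := by
  rw [fourier1_eq]
  have h1 := norm_integral_le_of_norm_le_const (μ := volume.restrict (Icc (0 : ℝ) 1)) (C := M)
    (f := fun y => (μ (x, y) : ℂ) * wave1 (-n) y) (Eventually.of_forall fun y => by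
      rw [norm_mul, norm_wave1, mul_one]; exact h.norm_le _)
  simpa using h1

theorem measurable_fourier1 (h : IsCoeff μ m M) (n : ℤ) : Measurable (fourier1 μ n) := by
  have h1 : StronglyMeasurable fun z : ℝ × ℝ => (μ z : ℂ) * wave1 (-n) z.2 :=
    (h.measurable_ofReal.mul ((wave1_continuous _).measurable.comp measurable_snd)).stronglyMeasurable
  have h2 := (h1.integral_prod_right' (ν := volume.restrict (Icc (0 : ℝ) 1))).measurable
  rw [show fourier1 μ n = _ from funext fun x => fourier1_eq n x]
  exact h2

/-- Dominated convergence in `y`. By Fubini the hypothesis holds for almost every `x` when `μ` is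
continuous almost everywhere. -/
theorem continuousAt_fourier1 (h : IsCoeff μ m M) (n : ℤ) {x : ℝ}
    (hx : ∀ᵐ y : ℝ, ContinuousAt μ (x, y)) : ContinuousAt (fourier1 μ n) x := by
  have e : fourier1 μ n = fun x => ∫ y in Icc (0 : ℝ) 1, (μ (x, y) : ℂ) * wave1 (-n) y :=
    funext fun x => fourier1_eq n x
  rw [e]
  refine tendsto_integral_filter_of_dominated_convergence (fun _ => M)
    (Eventually.of_forall fun x' => (h.integrable_section_mul x' (wave1_continuous _)).1)
    (Eventually.of_forall fun x' => Eventually.of_forall fun y => ?_) (integrable_const _) ?_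
  · rw [norm_mul, norm_wave1, mul_one]; exact h.norm_le _
  · refine ae_restrict_of_ae ?_
    filter_upwards [hx] with y hy
    have h1 : ContinuousAt (fun x' => μ (x', y)) x :=
      ContinuousAt.comp (f := fun x' : ℝ => (x', y)) hy (by fun_prop)
    exact ((Complex.continuous_ofReal.continuousAt.comp h1).mul continuousAt_const).tendsto

/-- The trigonometric polynomial with the coefficients `c`. -/
def trigPoly {N : ℕ} (c : Harm N → ℂ) (y : ℝ) : ℂ := ∑ n, c n * wave1 n y

theorem trigPoly_continuous {N : ℕ} (c : Harm N → ℂ) : Continuous (trigPoly c) :=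
  continuous_finsetSum _ fun _ _ => continuous_const.mul (wave1_continuous _)

theorem muHat_mulVec (h : IsCoeff μ m M) {N : ℕ} (x : ℝ) (c : Harm N → ℂ) (n : Harm N) :
    (muHat μ N x *ᵥ c) n =
      ∫ y in Icc (0 : ℝ) 1, wave1 (-n) y * ((μ (x, y) : ℂ) * trigPoly c y) := by
  have e : ∀ y, wave1 (-n) y * ((μ (x, y) : ℂ) * trigPoly c y) =
      ∑ k : Harm N, c k * ((μ (x, y) : ℂ) * wave1 (-((n : ℤ) - k)) y) := by
    intro y
    rw [trigPoly, Finset.mul_sum, Finset.mul_sum]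
    refine Finset.sum_congr rfl fun k _ => ?_
    rw [show -((n : ℤ) - k) = -n + k by ring, wave1_add]
    ring
  simp only [e]
  rw [integral_finsetSum _ fun k _ =>
    (h.integrable_section_mul x (wave1_continuous _)).const_mul _]
  change ∑ k, muHat μ N x n k * c k = _
  refine Finset.sum_congr rfl fun k _ => ?_
  rw [integral_const_mul, ← fourier1_eq, muHat, Matrix.of_apply, mul_comm]

/-- The Toeplitz matrix is the compression of multiplication by `μ (x, ·)` to trigonometric
polynomials, so its quadratic form inherits the bounds of `μ`. -/
theorem star_dotProduct_muHat (h : IsCoeff μ m M) {N : ℕ} (x : ℝ) (c : Harm N → ℂ) :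
    (star c ⬝ᵥ (muHat μ N x *ᵥ c)) =
      ((∫ y in Icc (0 : ℝ) 1, μ (x, y) * ‖trigPoly c y‖ ^ 2 : ℝ) : ℂ) := by
  rw [← integral_complex_ofReal, dotProduct]
  simp only [muHat_mulVec h, ← integral_const_mul]
  rw [← integral_finsetSum]
  · refine integral_congr_ae (Eventually.of_forall fun y => ?_)
    have e : ∑ n : Harm N, star c n * (wave1 (-n) y * ((μ (x, y) : ℂ) * trigPoly c y)) =
        conj (trigPoly c y) * ((μ (x, y) : ℂ) * trigPoly c y) := by
      rw [trigPoly, map_sum, Finset.sum_mul]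
      refine Finset.sum_congr rfl fun n _ => ?_
      rw [map_mul, wave1_conj, Pi.star_apply, RCLike.star_def]
      ring
    simp only [e]
    push_cast
    rw [mul_left_comm, Complex.conj_mul']
  · intro n _
    refine Integrable.const_mul ?_ _
    have := h.integrable_section_mul x ((wave1_continuous (-n)).mul (trigPoly_continuous c))
    refine this.congr (Eventually.of_forall fun y => ?_)
    simp only [Pi.mul_apply]
    ring

theorem integral_norm_trigPoly_sq {N : ℕ} (c : Harm N → ℂ) :
    ∫ y in Icc (0 : ℝ) 1, ‖trigPoly c y‖ ^ 2 = ∑ n, ‖c n‖ ^ 2 := by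
  -- The preceding identity is applied to `μ ≡ 1`, whose Toeplitz matrix is the identity.
  have h1 : IsCoeff (fun _ => 1) 1 1 :=
    ⟨measurable_const, one_pos, fun _ => le_rfl, fun _ => le_rfl, fun _ => ⟨rfl, rfl⟩,
      fun _ => rfl⟩
  have h2 := star_dotProduct_muHat h1 0 c
  have e : muHat (fun _ => 1) N 0 = 1 := by
    ext n k
    rw [muHat, Matrix.of_apply, fourier1_eq, Matrix.one_apply]
    simp only [Complex.ofReal_one, one_mul, integral_wave1, neg_eq_zero, sub_eq_zero,
      Subtype.ext_iff]
  rw [e, Matrix.one_mulVec] at h2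
  have h3 : star c ⬝ᵥ c = ((∑ n, ‖c n‖ ^ 2 : ℝ) : ℂ) := by
    rw [dotProduct]
    push_cast
    refine Finset.sum_congr rfl fun n _ => ?_
    rw [Pi.star_apply, RCLike.star_def, Complex.conj_mul']
  rw [h3] at h2
  simp only [one_mul] at h2
  exact_mod_cast h2.symm

theorem muHat_coercive (h : IsCoeff μ m M) {N : ℕ} (x : ℝ) (c : Harm N → ℂ) :
    m * ∑ n, ‖c n‖ ^ 2 ≤ (star c ⬝ᵥ (muHat μ N x *ᵥ c)).re := by
  have hc : Continuous fun y => ‖trigPoly c y‖ ^ 2 := (trigPoly_continuous c).norm.pow 2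
  have hi : IntegrableOn (fun y => ‖trigPoly c y‖ ^ 2) (Icc (0 : ℝ) 1) :=
    hc.continuousOn.integrableOn_compact isCompact_Icc
  rw [star_dotProduct_muHat h, Complex.ofReal_re, ← integral_norm_trigPoly_sq,
    ← integral_const_mul]
  refine integral_mono (hi.const_mul m) ?_ fun y =>
    mul_le_mul_of_nonneg_right (h.lower _) (sq_nonneg _)
  exact Integrable.bdd_mul (c := M) hi (h.meas.comp measurable_prodMk_left).aestronglyMeasurable
    (Eventually.of_forall fun y => by
      rw [Real.norm_of_nonneg (h.pos' _).le]; exact h.upper _)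

theorem isUnit_det_muHat (h : IsCoeff μ m M) (N : ℕ) (x : ℝ) : IsUnit (muHat μ N x).det := by
  rw [← Matrix.isUnit_iff_isUnit_det, ← Matrix.mulVec_injective_iff_isUnit]
  have h0 : ∀ c : Harm N → ℂ, muHat μ N x *ᵥ c = 0 → c = 0 := by
    intro c hc
    have h1 := muHat_coercive h x c
    rw [hc, dotProduct_zero, Complex.zero_re] at h1
    have h2 : ∑ n, ‖c n‖ ^ 2 ≤ 0 := by
      by_contra hn
      exact absurd h1 (not_le.mpr (mul_pos h.pos (not_le.mp hn)))
    have h3 := (Finset.sum_eq_zero_iff_of_nonneg fun n _ => sq_nonneg ‖c n‖).mp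
      (le_antisymm h2 (Finset.sum_nonneg fun n _ => sq_nonneg _))
    funext n
    simpa using h3 n (Finset.mem_univ n)
  intro c d hcd
  refine sub_eq_zero.mp (h0 _ ?_)
  rw [Matrix.mulVec_sub, sub_eq_zero]
  exact hcd

/-- For the column `c` of index `j` of the inverse, coercivity gives `m ‖c i‖² ≤ ‖c j‖` for every
`i`. The case `i = j` yields `m ‖c j‖ ≤ 1`, hence `(m ‖c i‖)² ≤ 1`. The bound is uniform in `x`, as
boundedness of `Q_N` requires. -/
theorem norm_inv_muHat_le (h : IsCoeff μ m M) (N : ℕ) (x : ℝ) (i j : Harm N) :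
    ‖(muHat μ N x)⁻¹ i j‖ ≤ m⁻¹ := by
  set c : Harm N → ℂ := (muHat μ N x)⁻¹ *ᵥ Pi.single j 1 with hc
  have hci : ∀ i, c i = (muHat μ N x)⁻¹ i j := fun i => by simp [hc]
  have h1 := muHat_coercive h x c
  rw [hc, Matrix.mulVec_mulVec, Matrix.mul_nonsing_inv _ (isUnit_det_muHat h N x),
    Matrix.one_mulVec, ← hc] at h1
  have h2 : (star c ⬝ᵥ Pi.single j 1).re ≤ ‖c j‖ := by
    rw [dotProduct_single, mul_one, Pi.star_apply]
    exact (Complex.re_le_norm _).trans_eq (norm_star _)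
  have h3 : ∀ i, m * ‖c i‖ ^ 2 ≤ ‖c j‖ := fun i =>
    (mul_le_mul_of_nonneg_left (Finset.single_le_sum (f := fun n => ‖c n‖ ^ 2)
      (fun n _ => sq_nonneg _) (Finset.mem_univ i)) h.pos.le).trans (h1.trans h2)
  have hm := h.pos
  have h4 : m * ‖c j‖ ≤ 1 := by
    rcases (norm_nonneg (c j)).eq_or_lt with h0 | h0
    · rw [← h0]; simp
    · have := h3 j
      nlinarith
  have h5 : (m * ‖c i‖) ^ 2 ≤ 1 := by
    have := h3 i
    nlinarith
  have h6 : m * ‖c i‖ ≤ 1 := (abs_le_of_sq_le_sq' (by simpa using h5) zero_le_one).2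
  rw [← hci, ← one_div, le_div_iff₀ hm, mul_comm]
  exact h6

theorem measurable_det {ι : Type*} [Fintype ι] [DecidableEq ι] {A : ℝ → Matrix ι ι ℂ}
    (hA : ∀ i j, Measurable fun x => A x i j) : Measurable fun x => (A x).det := by
  simp only [Matrix.det_apply']
  exact Finset.measurable_fun_sum _ fun σ _ =>
    (Finset.measurable_fun_prod _ fun i _ => hA _ _).const_mul _

/-- Cramer's rule expresses the entries through determinants. -/
theorem measurable_inv_apply {ι : Type*} [Fintype ι] [DecidableEq ι] {A : ℝ → Matrix ι ι ℂ}
    (hA : ∀ i j, Measurable fun x => A x i j) (i j : ι) : Measurable fun x => (A x)⁻¹ i j := by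
  simp only [Matrix.inv_def, Ring.inverse_eq_inv', Matrix.smul_apply, smul_eq_mul,
    Matrix.adjugate_apply]
  refine (measurable_det hA).inv.mul (measurable_det fun k l => ?_)
  simp only [Matrix.updateRow_apply]
  split_ifs
  · exact measurable_const
  · exact hA k l

theorem continuousAt_inv_apply {ι : Type*} [Fintype ι] [DecidableEq ι] {A : ℝ → Matrix ι ι ℂ}
    {x : ℝ} (hA : ∀ i j, ContinuousAt (fun x => A x i j) x) (hdet : (A x).det ≠ 0) (i j : ι) :
    ContinuousAt (fun x => (A x)⁻¹ i j) x := by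
  have hA' : ContinuousAt A x :=
    continuousAt_pi.mpr fun i => continuousAt_pi.mpr fun j => hA i j
  have h1 : ContinuousAt (fun x => (A x).det) x :=
    ContinuousAt.comp (g := fun B : Matrix ι ι ℂ => B.det)
      (continuous_id.matrix_det).continuousAt hA'
  have h2 : ContinuousAt (fun x => (A x).adjugate i j) x :=
    ContinuousAt.comp (g := fun B : Matrix ι ι ℂ => B.adjugate i j)
      ((continuous_id.matrix_adjugate).matrix_elem i j).continuousAt hA'
  simp only [Matrix.inv_def, Ring.inverse_eq_inv', Matrix.smul_apply, smul_eq_mul]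
  exact (h1.inv₀ hdet).mul h2

theorem diff_muHat_diff_apply (N : ℕ) (x : ℝ) (i j : Harm N) :
    (diffMatrix N * muHat μ N x * diffMatrix N) i j =
      (2 * Real.pi * ((i : ℤ) : ℂ)) * fourier1 μ (i - j) x * (2 * Real.pi * ((j : ℤ) : ℂ)) := by
  rw [diffMatrix, Matrix.mul_diagonal, Matrix.diagonal_mul, muHat, Matrix.of_apply]

theorem measurable_systemMatrix (h : IsCoeff μ m M) (N : ℕ) (i j : Harm N ⊕ Harm N) :
    Measurable fun x => systemMatrix μ N x i j := by
  rcases i with i | i <;> rcases j with j | j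
  · exact measurable_const
  · exact measurable_inv_apply (fun i j => measurable_fourier1 h _) i j
  · simp only [systemMatrix, Matrix.fromBlocks_apply₂₁, diff_muHat_diff_apply]
    exact ((measurable_fourier1 h _).const_mul _).mul_const _
  · exact measurable_const

theorem continuousAt_systemMatrix (h : IsCoeff μ m M) (N : ℕ) {x : ℝ}
    (hx : ∀ᵐ y : ℝ, ContinuousAt μ (x, y)) (i j : Harm N ⊕ Harm N) :
    ContinuousAt (fun x => systemMatrix μ N x i j) x := by
  rcases i with i | i <;> rcases j with j | j
  · exact continuousAt_const
  · exact continuousAt_inv_apply (fun i j => continuousAt_fourier1 h _ hx)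
      (isUnit_det_muHat h N x).ne_zero i j
  · simp only [systemMatrix, Matrix.fromBlocks_apply₂₁, diff_muHat_diff_apply]
    exact (continuousAt_const.mul (continuousAt_fourier1 h _ hx)).mul continuousAt_const
  · exact continuousAt_const

theorem exists_norm_systemMatrix_le (h : IsCoeff μ m M) (N : ℕ) :
    ∃ C, ∀ x i j, ‖systemMatrix μ N x i j‖ ≤ C := by
  have h1 : ∀ i j, ∃ C, ∀ x, ‖systemMatrix μ N x i j‖ ≤ C := by
    intro i j
    rcases i with i | i <;> rcases j with j | j
    · exact ⟨0, fun x => by simp [systemMatrix]⟩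
    · exact ⟨m⁻¹, fun x => norm_inv_muHat_le h N x i j⟩
    · refine ⟨‖(2 * Real.pi * ((i : ℤ) : ℂ))‖ * M * ‖(2 * Real.pi * ((j : ℤ) : ℂ))‖, fun x => ?_⟩
      simp only [systemMatrix, Matrix.fromBlocks_apply₂₁, diff_muHat_diff_apply]
      rw [norm_mul, norm_mul]
      gcongr
      exact norm_fourier1_le h _ _
    · exact ⟨0, fun x => by simp [systemMatrix]⟩
  choose C hC using h1
  refine ⟨∑ i, ∑ j, |C i j|, fun x i j => (hC i j x).trans ((le_abs_self _).trans ?_)⟩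
  exact (Finset.single_le_sum (f := fun j => |C i j|) (fun _ _ => abs_nonneg _)
    (Finset.mem_univ j)).trans (Finset.single_le_sum (f := fun i => ∑ j, |C i j|)
      (fun _ _ => Finset.sum_nonneg fun _ _ => abs_nonneg _) (Finset.mem_univ i))

theorem tendsto_riemannProduct_systemMatrix (h : IsCoeff μ m M) (N : ℕ)
    (hc : ∀ᵐ x : ℝ × ℝ, ContinuousAt μ x) :
    Tendsto (fun k => riemannProduct (systemMatrix μ N) k) atTop (𝓝 (monodromy μ N)) := by
  obtain ⟨C, hC⟩ := exists_norm_systemMatrix_le h N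
  refine tendsto_riemannProduct (measurable_systemMatrix h N) hC ?_
  rw [Measure.volume_eq_prod] at hc
  -- Fubini for null sets: for almost every `x₁`, `μ` is continuous at `(x₁, x₂)` for almost every
  -- `x₂`.
  filter_upwards [Measure.ae_ae_of_ae_prod hc] with x hx i j
  exact continuousAt_systemMatrix h N hx i j

end System

/-! ### Integration by parts and fields with finitely many harmonics in `x₂` -/

/-- Since `q` is only integrable, `f` need not be differentiable everywhere. In place of the product
rule, `w' x * q t` is integrated over the triangle `t ≤ x` in both orders. -/
theorem integral_deriv_mul_primitive {w w' q f : ℝ → ℂ} (hw : ∀ x, HasDerivAt w (w' x) x)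
    (hw' : Continuous w') (hq : IntegrableOn q (Icc 0 1))
    (hf : ∀ x ∈ Icc (0 : ℝ) 1, f x = f 0 + ∫ y in (0 : ℝ)..x, q y) :
    ∫ x in Icc (0 : ℝ) 1, w' x * f x =
      w 1 * f 1 - w 0 * f 0 - ∫ x in Icc (0 : ℝ) 1, w x * q x := by
  have hwc : Continuous w := continuous_iff_continuousAt.mpr fun x => (hw x).continuousAt
  have hwi : IntegrableOn w' (Icc 0 1) := hw'.continuousOn.integrableOn_compact isCompact_Icc
  set ν : Measure ℝ := volume.restrict (Icc (0 : ℝ) 1) with hν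
  let T : Set (ℝ × ℝ) := {z | z.2 ≤ z.1}
  have hT : MeasurableSet T := measurableSet_le measurable_snd measurable_fst
  have hG : Integrable (T.indicator fun z : ℝ × ℝ => w' z.1 * q z.2) (ν.prod ν) :=
    (Integrable.mul_prod hwi hq).indicator hT
  have hswap := integral_integral_swap (f := fun x t => T.indicator
    (fun z : ℝ × ℝ => w' z.1 * q z.2) (x, t)) hG
  have e1 : ∀ x ∈ Icc (0 : ℝ) 1, ∫ t, T.indicator (fun z : ℝ × ℝ => w' z.1 * q z.2) (x, t) ∂ν =
      w' x * (f x - f 0) := by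
    intro x hx
    have h1 : ∀ t, T.indicator (fun z : ℝ × ℝ => w' z.1 * q z.2) (x, t) =
        (Iic x).indicator (fun t => w' x * q t) t := fun t => by
      simp only [T, indicator, mem_ofPred_eq, mem_Iic]
    simp only [h1]
    have h2 : Icc (0 : ℝ) 1 ∩ Iic x = Icc 0 x := by
      ext t; simp only [mem_inter_iff, mem_Icc, mem_Iic]
      constructor
      · rintro ⟨⟨h3, _⟩, h4⟩; exact ⟨h3, h4⟩
      · rintro ⟨h3, h4⟩; exact ⟨⟨h3, h4.trans hx.2⟩, h4⟩
    rw [hν, setIntegral_indicator measurableSet_Iic, h2, integral_const_mul, hf x hx,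
      add_sub_cancel_left, integral_Icc_eq_integral_Ioc, ← intervalIntegral.integral_of_le hx.1]
  have e2 : ∀ t ∈ Icc (0 : ℝ) 1, ∫ x, T.indicator (fun z : ℝ × ℝ => w' z.1 * q z.2) (x, t) ∂ν =
      (w 1 - w t) * q t := by
    intro t ht
    have h1 : ∀ x, T.indicator (fun z : ℝ × ℝ => w' z.1 * q z.2) (x, t) =
        (Ici t).indicator (fun x => w' x * q t) x := fun x => by
      simp only [T, indicator, mem_ofPred_eq, mem_Ici]
    simp only [h1]
    have h2 : Icc (0 : ℝ) 1 ∩ Ici t = Icc t 1 := by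
      ext x; simp only [mem_inter_iff, mem_Icc, mem_Ici]
      constructor
      · rintro ⟨⟨_, h3⟩, h4⟩; exact ⟨h4, h3⟩
      · rintro ⟨h3, h4⟩; exact ⟨⟨ht.1.trans h3, h4⟩, h3⟩
    rw [hν, setIntegral_indicator measurableSet_Ici, h2, integral_mul_const,
      integral_Icc_eq_integral_Ioc, ← intervalIntegral.integral_of_le ht.2,
      intervalIntegral.integral_eq_sub_of_hasDerivAt (fun x _ => hw x)
        (hw'.intervalIntegrable t 1)]
  have i1 : ∫ x, (∫ t, T.indicator (fun z : ℝ × ℝ => w' z.1 * q z.2) (x, t) ∂ν) ∂ν =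
      ∫ x in Icc (0 : ℝ) 1, w' x * (f x - f 0) :=
    setIntegral_congr_fun measurableSet_Icc e1
  have i2 : ∫ t, (∫ x, T.indicator (fun z : ℝ × ℝ => w' z.1 * q z.2) (x, t) ∂ν) ∂ν =
      ∫ t in Icc (0 : ℝ) 1, (w 1 - w t) * q t :=
    setIntegral_congr_fun measurableSet_Icc e2
  rw [i1, i2] at hswap
  have j1 : Integrable (fun x => w' x * (f x - f 0)) ν := by
    refine hG.integral_prod_left.congr ?_
    exact (ae_restrict_iff' measurableSet_Icc).mpr (Eventually.of_forall e1)
  have j2 : Integrable (fun x => w x * q x) ν := by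
    obtain ⟨B, hB⟩ := isCompact_Icc.exists_bound_of_continuousOn (s := Icc (0 : ℝ) 1)
      hwc.continuousOn
    exact Integrable.bdd_mul (c := B) hq hwc.aestronglyMeasurable
      ((ae_restrict_iff' measurableSet_Icc).mpr (Eventually.of_forall hB))
  have k1 : ∫ x in Icc (0 : ℝ) 1, w' x * f x =
      (∫ x in Icc (0 : ℝ) 1, w' x * (f x - f 0)) + (w 1 - w 0) * f 0 := by
    have : ∫ x in Icc (0 : ℝ) 1, w' x * f 0 = (w 1 - w 0) * f 0 := by
      rw [integral_mul_const, integral_Icc_eq_integral_Ioc,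
        ← intervalIntegral.integral_of_le zero_le_one,
        intervalIntegral.integral_eq_sub_of_hasDerivAt (fun x _ => hw x)
        (hw'.intervalIntegrable 0 1)]
    rw [← this, ← integral_add j1 (hwi.mul_const _)]
    refine integral_congr_ae (Eventually.of_forall fun x => ?_)
    simp only; ring
  have k2 : ∫ t in Icc (0 : ℝ) 1, (w 1 - w t) * q t =
      w 1 * (f 1 - f 0) - ∫ x in Icc (0 : ℝ) 1, w x * q x := by
    simp only [sub_mul]
    rw [integral_sub (hq.const_mul _) j2, integral_const_mul, hf 1 ⟨zero_le_one, le_rfl⟩,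
      add_sub_cancel_left, integral_Icc_eq_integral_Ioc,
      ← intervalIntegral.integral_of_le zero_le_one]
  rw [k1, hswap, k2]
  ring

theorem wave1_apply_zero (n : ℤ) : wave1 n 0 = 1 := by simp [wave1]

theorem wave1_apply_one (n : ℤ) : wave1 n 1 = 1 := by
  rw [← zero_add (1 : ℝ), wave1_add_one, wave1_apply_zero]

theorem integral_wave1_mul_deriv {q f : ℝ → ℂ} (hq : IntegrableOn q (Icc 0 1))
    (hf : ∀ x ∈ Icc (0 : ℝ) 1, f x = f 0 + ∫ y in (0 : ℝ)..x, q y) (k : ℤ) :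
    ∫ x in Icc (0 : ℝ) 1, wave1 (-k) x * q x =
      f 1 - f 0 + 2 * Real.pi * Complex.I * k * ∫ x in Icc (0 : ℝ) 1, wave1 (-k) x * f x := by
  have h := integral_deriv_mul_primitive (wave1_hasDerivAt (-k))
    (continuous_const.mul (wave1_continuous (-k))) hq hf
  rw [wave1_apply_zero, wave1_apply_one] at h
  simp only [mul_assoc _ (wave1 (-k) _)] at h
  rw [integral_const_mul] at h
  push_cast at h
  linear_combination h

/-- The function of two variables with the harmonics `p n` in the second variable. -/
def bandFun {N : ℕ} (p : Harm N → ℝ → ℂ) (z : ℝ × ℝ) : ℂ := trigPoly (fun n => p n z.1) z.2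

section Band

variable {N : ℕ} {p : Harm N → ℝ → ℂ}

theorem bandFun_memLp (hp : ∀ n, MemLp (p n) 2 (volume.restrict (Icc (0 : ℝ) 1))) :
    MemLp (bandFun p) 2 (volume.restrict cell) := by
  rw [volume_restrict_cell]
  change MemLp (fun z : ℝ × ℝ => ∑ n : Harm N, p n z.1 * wave1 n z.2) 2 _
  refine memLp_finsetSum _ fun n _ => ?_
  have h1 := (hp n).comp_fst (volume.restrict (Icc (0 : ℝ) 1))
  refine h1.of_le (h1.1.mul ((wave1_continuous _).comp continuous_snd).aestronglyMeasurable)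
    (Eventually.of_forall fun z => ?_)
  rw [norm_mul, norm_wave1, mul_one]

theorem integral_wave_bandFun (hp : ∀ n, MemLp (p n) 2 (volume.restrict (Icc (0 : ℝ) 1)))
    (g : ℤ × ℤ) :
    ∫ z in cell, wave (-g) z * bandFun p z =
      ∑ n : Harm N, (∫ x in Icc (0 : ℝ) 1, wave1 (-g.1) x * p n x) *
        if (n : ℤ) = g.2 then 1 else 0 := by
  have e : ∀ z, wave (-g) z * bandFun p z =
      ∑ n : Harm N, (wave1 (-g.1) z.1 * p n z.1) * wave1 (-g.2 + n) z.2 := by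
    intro z
    rw [bandFun, trigPoly, Finset.mul_sum]
    refine Finset.sum_congr rfl fun n _ => ?_
    rw [wave1_add, wave, Prod.fst_neg, Prod.snd_neg]
    ring
  simp only [e]
  rw [volume_restrict_cell, integral_finsetSum]
  · refine Finset.sum_congr rfl fun n _ => ?_
    rw [integral_prod_mul (fun x => wave1 (-g.1) x * p n x) (wave1 (-g.2 + n)), integral_wave1]
    simp only [neg_add_eq_zero, eq_comm]
  · intro n _
    have h2 : IntegrableOn (wave1 (-g.2 + n)) (Icc 0 1) :=
      (wave1_continuous _).continuousOn.integrableOn_compact isCompact_Icc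
    refine Integrable.mul_prod (f := fun x => wave1 (-g.1) x * p n x) ?_ h2
    exact ((hp n).integrable (by norm_num)).bdd_mul (c := 1)
      (wave1_continuous _).aestronglyMeasurable
      (Eventually.of_forall fun x => (norm_wave1 _ x).le)

theorem integral_wave_bandFun_of_mem
    (hp : ∀ n, MemLp (p n) 2 (volume.restrict (Icc (0 : ℝ) 1))) (k : ℤ) (n : Harm N) :
    ∫ z in cell, wave (-(k, (n : ℤ))) z * bandFun p z =
      ∫ x in Icc (0 : ℝ) 1, wave1 (-k) x * p n x := by
  rw [integral_wave_bandFun hp, Finset.sum_eq_single n]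
  · simp
  · intro j _ hj
    rw [if_neg (fun h => hj (Subtype.ext h)), mul_zero]
  · exact fun h => absurd (Finset.mem_univ n) h

theorem integral_wave_bandFun_of_notMem
    (hp : ∀ n, MemLp (p n) 2 (volume.restrict (Icc (0 : ℝ) 1))) {g : ℤ × ℤ}
    (hg : g.2 ∉ Finset.Icc (-(N : ℤ)) N) :
    ∫ z in cell, wave (-g) z * bandFun p z = 0 := by
  rw [integral_wave_bandFun hp]
  refine Finset.sum_eq_zero fun n _ => ?_
  have hn : (n : ℤ) ≠ g.2 := fun h => hg (h ▸ n.2)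
  rw [if_neg hn, mul_zero]

/-- Among the harmonics of `μ * bandFun p` in `x₂`, those with index at most `N` in modulus are
given by the Toeplitz matrix; this is where the truncated system meets the strip of frequencies. -/
theorem integral_wave_flux {μ : ℝ × ℝ → ℝ} {m M : ℝ} (h : IsCoeff μ m M)
    (hp : ∀ n, MemLp (p n) 2 (volume.restrict (Icc (0 : ℝ) 1))) (k : ℤ) (n : Harm N) :
    ∫ z in cell, wave (-(k, (n : ℤ))) z * ((μ z : ℂ) * bandFun p z) =
      ∫ x in Icc (0 : ℝ) 1, wave1 (-k) x * (muHat μ N x *ᵥ fun j => p j x) n := by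
  have hi := wave_mul_integrable (-(k, (n : ℤ)))
    ((h.memLp_mul (bandFun_memLp hp)).integrable (by norm_num))
  rw [volume_restrict_cell] at hi ⊢
  rw [integral_prod _ hi]
  refine integral_congr_ae (Eventually.of_forall fun x => ?_)
  simp only [muHat_mulVec h, ← integral_const_mul]
  refine integral_congr_ae (Eventually.of_forall fun y => ?_)
  simp only [wave, bandFun, Prod.fst_neg, Prod.snd_neg]
  ring

end Band

/-! ### The MM bounds as minimal energies -/

/-- The frequencies `g` with `|g₂| ≤ N`. -/
def freqStrip (N : ℕ) : Set (ℤ × ℤ) := {g | g.2 ∈ Finset.Icc (-(N : ℤ)) N}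

/-- The harmonic of index `0`. -/
def harmZero (N : ℕ) : Harm N := ⟨0, by simp⟩

/-- A solution of the truncated system, in integrated form, whose first half `a` increases by
`c e₀` over a period and whose second half `b` is periodic. -/
structure IsBandSolution (μ : ℝ × ℝ → ℝ) (N : ℕ) (c : ℂ) (a a' b b' : Harm N → ℝ → ℂ) : Prop where
  int_a : ∀ n, ∀ x ∈ Icc (0 : ℝ) 1, a n x = a n 0 + ∫ y in (0 : ℝ)..x, a' n y
  int_b : ∀ n, ∀ x ∈ Icc (0 : ℝ) 1, b n x = b n 0 + ∫ y in (0 : ℝ)..x, b' n y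
  cont_a : ∀ n, ContinuousOn (a n) (Icc 0 1)
  cont_b : ∀ n, ContinuousOn (b n) (Icc 0 1)
  memLp_a' : ∀ n, MemLp (a' n) 2 (volume.restrict (Icc (0 : ℝ) 1))
  memLp_b' : ∀ n, MemLp (b' n) 2 (volume.restrict (Icc (0 : ℝ) 1))
  -- The first block row of the system, multiplied by the Toeplitz matrix: `b` is the truncated
  -- first component of the flux.
  flux : ∀ x, (muHat μ N x *ᵥ fun j => a' j x) = fun j => b j x
  flux' : ∀ x, ((diffMatrix N * muHat μ N x * diffMatrix N) *ᵥ fun j => a j x) = fun j => b' j x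
  period_a : ∀ n, a n 1 = a n 0 + c * e0 N n
  period_b : ∀ n, b n 1 = b n 0

section Band

variable {μ : ℝ × ℝ → ℝ} {m M : ℝ} {N : ℕ} {c : ℂ} {a a' b b' : Harm N → ℝ → ℂ}

theorem ContinuousOn.memLp_Icc {f : ℝ → ℂ} (hf : ContinuousOn f (Icc 0 1)) :
    MemLp f 2 (volume.restrict (Icc (0 : ℝ) 1)) := by
  obtain ⟨C, hC⟩ := isCompact_Icc.exists_bound_of_continuousOn hf
  exact MemLp.of_bound (hf.aestronglyMeasurable measurableSet_Icc) C
    ((ae_restrict_iff' measurableSet_Icc).mpr (Eventually.of_forall hC))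

/-- The harmonics of the second derivative of the field attached to `a`. -/
def secondDeriv (a : Harm N → ℝ → ℂ) (n : Harm N) (x : ℝ) : ℂ :=
  2 * Real.pi * Complex.I * ((n : ℤ) : ℂ) * a n x

theorem IsBandSolution.memLp_secondDeriv (hs : IsBandSolution μ N c a a' b b') (n : Harm N) :
    MemLp (secondDeriv a n) 2 (volume.restrict (Icc (0 : ℝ) 1)) :=
  (ContinuousOn.memLp_Icc (hs.cont_a n)).const_mul _

/-- The total field of a solution of the truncated system. -/
def IsBandSolution.field (hs : IsBandSolution μ N c a a' b b') : VField :=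
  mkField (bandFun_memLp hs.memLp_a').toLp (bandFun_memLp hs.memLp_secondDeriv).toLp

theorem IsBandSolution.integrableOn_a' (hs : IsBandSolution μ N c a a' b b') (n : Harm N) :
    IntegrableOn (a' n) (Icc 0 1) := (hs.memLp_a' n).integrable (by norm_num)

theorem IsBandSolution.integrableOn_b' (hs : IsBandSolution μ N c a a' b b') (n : Harm N) :
    IntegrableOn (b' n) (Icc 0 1) := (hs.memLp_b' n).integrable (by norm_num)

theorem IsBandSolution.integral_a' (hs : IsBandSolution μ N c a a' b b') (n : Harm N) (k : ℤ) :
    ∫ x in Icc (0 : ℝ) 1, wave1 (-k) x * a' n x =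
      c * e0 N n + 2 * Real.pi * Complex.I * k * ∫ x in Icc (0 : ℝ) 1, wave1 (-k) x * a n x := by
  rw [integral_wave1_mul_deriv (hs.integrableOn_a' n) (hs.int_a n), hs.period_a,
    add_sub_cancel_left]

theorem IsBandSolution.integral_b' (hs : IsBandSolution μ N c a a' b b') (n : Harm N) (k : ℤ) :
    ∫ x in Icc (0 : ℝ) 1, wave1 (-k) x * b' n x =
      2 * Real.pi * Complex.I * k * ∫ x in Icc (0 : ℝ) 1, wave1 (-k) x * b n x := by
  rw [integral_wave1_mul_deriv (hs.integrableOn_b' n) (hs.int_b n), hs.period_b, sub_self,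
    zero_add]

theorem IsBandSolution.inner_field_fst (hs : IsBandSolution μ N c a a' b b') (k : ℤ)
    (n : Harm N) : inner ℂ (waveLp (k, (n : ℤ))) hs.field.fst =
      ∫ x in Icc (0 : ℝ) 1, wave1 (-k) x * a' n x := by
  rw [field, mkField_fst, inner_waveLp_toLp, integral_wave_bandFun_of_mem hs.memLp_a']

theorem IsBandSolution.inner_field_snd (hs : IsBandSolution μ N c a a' b b') (k : ℤ)
    (n : Harm N) : inner ℂ (waveLp (k, (n : ℤ))) hs.field.snd =
      2 * Real.pi * Complex.I * ((n : ℤ) : ℂ) * ∫ x in Icc (0 : ℝ) 1, wave1 (-k) x * a n x := by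
  rw [field, mkField_snd, inner_waveLp_toLp, integral_wave_bandFun_of_mem hs.memLp_secondDeriv,
    ← integral_const_mul]
  refine integral_congr_ae (Eventually.of_forall fun x => ?_)
  simp only [secondDeriv]
  ring

theorem IsBandSolution.inner_flux_fst (h : IsCoeff μ m M) (hs : IsBandSolution μ N c a a' b b')
    (k : ℤ) (n : Harm N) :
    inner ℂ (waveLp (k, (n : ℤ))) (fieldOp (mulOp h) hs.field).fst =
      ∫ x in Icc (0 : ℝ) 1, wave1 (-k) x * b n x := by
  rw [fieldOp_fst, field, mkField_fst, mulOp_toLp, inner_waveLp_toLp,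
    integral_wave_flux h hs.memLp_a']
  simp only [hs.flux]

theorem muHat_mulVec_secondDeriv (hs : IsBandSolution μ N c a a' b b') (x : ℝ) (n : Harm N) :
    2 * Real.pi * ((n : ℤ) : ℂ) * (muHat μ N x *ᵥ fun j => secondDeriv a j x) n =
      Complex.I * b' n x := by
  rw [← congrFun (hs.flux' x) n]
  simp only [Matrix.mulVec, dotProduct, diff_muHat_diff_apply, Finset.mul_sum, secondDeriv]
  refine Finset.sum_congr rfl fun j _ => ?_
  rw [muHat, Matrix.of_apply]
  ring

/-- This is the vanishing divergence of the flux at the frequency `(k, n)`. It is the second block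
row of the system after integration by parts, the boundary term being absent because `b` is
periodic. -/
theorem IsBandSolution.inner_flux_snd (h : IsCoeff μ m M) (hs : IsBandSolution μ N c a a' b b')
    (k : ℤ) (n : Harm N) :
    ((n : ℤ) : ℂ) * inner ℂ (waveLp (k, (n : ℤ))) (fieldOp (mulOp h) hs.field).snd =
      -(k * ∫ x in Icc (0 : ℝ) 1, wave1 (-k) x * b n x) := by
  have hpi : (2 * Real.pi : ℂ) ≠ 0 := by simp [Real.pi_ne_zero]
  have h1 : 2 * Real.pi * (((n : ℤ) : ℂ) *
      inner ℂ (waveLp (k, (n : ℤ))) (fieldOp (mulOp h) hs.field).snd) =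
      Complex.I * ∫ x in Icc (0 : ℝ) 1, wave1 (-k) x * b' n x := by
    rw [fieldOp_snd, field, mkField_snd, mulOp_toLp, inner_waveLp_toLp,
      integral_wave_flux h hs.memLp_secondDeriv, ← mul_assoc, ← integral_const_mul,
      ← integral_const_mul]
    refine integral_congr_ae (Eventually.of_forall fun x => ?_)
    simp only
    rw [mul_left_comm _ (wave1 (-k) x), muHat_mulVec_secondDeriv hs]
    ring
  rw [hs.integral_b'] at h1
  refine mul_left_cancel₀ hpi (h1.trans ?_)
  linear_combination (2 * Real.pi * k * ∫ x in Icc (0 : ℝ) 1, wave1 (-k) x * b n x) * Complex.I_sq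

theorem IsBandSolution.inner_field_of_notMem (hs : IsBandSolution μ N c a a' b b') {g : ℤ × ℤ}
    (hg : g ∉ freqStrip N) :
    inner ℂ (waveLp g) hs.field.fst = 0 ∧ inner ℂ (waveLp g) hs.field.snd = 0 := by
  rw [field, mkField_fst, mkField_snd, inner_waveLp_toLp, inner_waveLp_toLp]
  exact ⟨integral_wave_bandFun_of_notMem hs.memLp_a' hg,
    integral_wave_bandFun_of_notMem hs.memLp_secondDeriv hg⟩

theorem inner_waveLp_waveLp_zero (g : ℤ × ℤ) :
    inner ℂ (waveLp g) (waveLp 0) = (if g = 0 then 1 else 0 : ℂ) := by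
  classical
  rw [orthonormal_iff_ite.mp orthonormal_waveLp]

theorem unitX_fst : unitX.fst = waveLp 0 := rfl

theorem unitX_snd : unitX.snd = 0 := rfl

/-- The field is the gradient of the potential with harmonics `a`. The gain `c e₀` of `a` over a
period contributes exactly the mean `c • unitX`, and the rest is a periodic gradient. The
Euler-Lagrange equations are the divergence conditions at the frequencies of the strip. -/
theorem IsBandSolution.isMinimizer (h : IsCoeff μ m M) (hs : IsBandSolution μ N c a a' b b') :
    IsMinimizer (fieldOp (mulOp h)) (gradSpace (freqStrip N)) (c • unitX)
      (hs.field - c • unitX) := by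
  have hfst : ∀ g, inner ℂ (waveLp g) (hs.field - c • unitX).fst =
      inner ℂ (waveLp g) hs.field.fst - c * if g = 0 then 1 else 0 := fun g => by
    rw [WithLp.sub_fst, WithLp.smul_fst, inner_sub_right, inner_smul_right, unitX_fst,
      inner_waveLp_waveLp_zero]
  have hsnd : ∀ g, inner ℂ (waveLp g) (hs.field - c • unitX).snd =
      inner ℂ (waveLp g) hs.field.snd := fun g => by
    rw [WithLp.sub_snd, WithLp.smul_snd, inner_sub_right, inner_smul_right, unitX_snd,
      inner_zero_right, mul_zero, sub_zero]
  rw [isMinimizer_gradSpace_iff, add_sub_cancel]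
  refine ⟨⟨fun g => ?_, ⟨?_, ?_⟩, fun g hg => ?_⟩, fun g hg => ?_⟩
  · rw [hfst, hsnd]
    by_cases hg : g ∈ freqStrip N
    · obtain ⟨k, n⟩ := g
      lift n to Harm N using hg
      rw [hs.inner_field_fst, hs.inner_field_snd, hs.integral_a', e0]
      by_cases hn : (n : ℤ) = 0
      · simp [hn]
      · rw [if_neg hn, if_neg (fun h0 => hn (congrArg Prod.snd h0))]
        ring
    · have h0 : g ≠ 0 := by
        rintro rfl
        exact hg (harmZero N).2
      rw [(hs.inner_field_of_notMem hg).1, (hs.inner_field_of_notMem hg).2, if_neg h0]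
      simp
  · rw [hfst, if_pos rfl]
    have := hs.inner_field_fst 0 (harmZero N)
    rw [hs.integral_a'] at this
    refine (congrArg (· - c * 1) this).trans ?_
    simp [e0, harmZero]
  · rw [hsnd]
    refine (hs.inner_field_snd 0 (harmZero N)).trans ?_
    simp [harmZero]
  · rw [hfst, hsnd, (hs.inner_field_of_notMem hg).1, (hs.inner_field_of_notMem hg).2, if_neg]
    · simp
    · rintro rfl
      exact hg (harmZero N).2
  · obtain ⟨k, n⟩ := g
    lift n to Harm N using hg
    rw [hs.inner_flux_snd h, hs.inner_flux_fst h]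
    ring

/-- The matrix `∂_N` annihilates the harmonic `0`. The mean flux through the lines of constant `x₁`
is therefore conserved, and its initial value already equals the mean flux over the cell. -/
theorem IsBandSolution.deriv_b_zero (hs : IsBandSolution μ N c a a' b b') (x : ℝ) :
    b' (harmZero N) x = 0 := by
  rw [← congrFun (hs.flux' x) (harmZero N)]
  simp only [Matrix.mulVec, dotProduct, diff_muHat_diff_apply]
  refine Finset.sum_eq_zero fun j _ => ?_
  simp [harmZero]

theorem IsBandSolution.inner_unitX_flux (h : IsCoeff μ m M)
    (hs : IsBandSolution μ N c a a' b b') :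
    inner ℂ unitX (fieldOp (mulOp h) hs.field) = b (harmZero N) 0 := by
  rw [inner_unitX]
  refine (hs.inner_flux_fst h 0 (harmZero N)).trans ?_
  have h1 : ∀ x ∈ Icc (0 : ℝ) 1, wave1 (-0) x * b (harmZero N) x = b (harmZero N) 0 := by
    intro x hx
    rw [neg_zero, wave1_zero, one_mul, hs.int_b _ x hx]
    simp only [hs.deriv_b_zero, intervalIntegral.integral_zero, add_zero]
  rw [setIntegral_congr_fun measurableSet_Icc h1]
  simp

/-- Without a jump the field minimizes the energy with datum `0`, so it vanishes by uniqueness. Then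
each `a n` is constant, and is `0` for `n ≠ 0` because the second component vanishes; the flux
relation gives `b = 0`. Only the additive constant in harmonic `0` of `a` stays free. -/
theorem IsBandSolution.eq_zero (h : IsCoeff μ m M) (hs : IsBandSolution μ N 0 a a' b b') :
    (∀ n : Harm N, (n : ℤ) ≠ 0 → a n 0 = 0) ∧ ∀ n, b n 0 = 0 := by
  have h1 := hs.isMinimizer h
  rw [zero_smul, sub_zero] at h1
  have h2 : IsMinimizer (fieldOp (mulOp h)) (gradSpace (freqStrip N)) 0 0 :=
    ⟨zero_mem _, fun w _ => by rw [add_zero, map_zero, inner_zero_right]⟩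
  have h3 : hs.field = 0 := h1.unique (isElliptic_fieldOp h) h2
  have ha' : ∀ n, a' n =ᵐ[volume.restrict (Icc (0 : ℝ) 1)] 0 := fun n =>
    ae_eq_zero_of_integral_wave1 (hs.memLp_a' n) fun k => by
      rw [← hs.inner_field_fst, h3, WithLp.zero_fst, inner_zero_right]
  constructor
  · intro n hn
    have h4 := hs.inner_field_snd 0 n
    rw [h3, WithLp.zero_snd, inner_zero_right] at h4
    have h5 : ∀ x ∈ Icc (0 : ℝ) 1, wave1 (-0) x * a n x = a n 0 := by
      intro x hx
      rw [neg_zero, wave1_zero, one_mul, hs.int_a n x hx, intervalIntegral.integral_of_le hx.1,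
        integral_eq_zero_of_ae, add_zero]
      exact ae_restrict_of_ae_restrict_of_subset
        (Ioc_subset_Icc_self.trans (Icc_subset_Icc_right hx.2)) (ha' n)
    rw [setIntegral_congr_fun measurableSet_Icc h5] at h4
    have hn' : ((n : ℤ) : ℂ) ≠ 0 := by exact_mod_cast hn
    simpa [Real.pi_ne_zero, hn] using h4.symm
  · intro n
    have h4 : b n =ᵐ[volume.restrict (Icc (0 : ℝ) 1)] 0 := by
      have h5 : ∀ᵐ x ∂(volume.restrict (Icc (0 : ℝ) 1)), ∀ j, a' j x = 0 :=
        ae_all_iff.mpr fun j => ha' j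
      filter_upwards [h5] with x hx
      rw [← congrFun (hs.flux x) n]
      simp [hx, Matrix.mulVec, dotProduct]
    -- The flux relation gives `b n = 0` almost everywhere; continuity extends this to the initial
    -- point.
    exact Measure.eqOn_Icc_of_ae_eq volume zero_ne_one h4 (hs.cont_b n) continuousOn_const
      ⟨le_rfl, zero_le_one⟩

end Band

/-! ### The equation `(M_N - I) v = w₁` -/

section Monodromy

variable {μ : ℝ × ℝ → ℝ} {m M : ℝ}

/-- The corresponding row of `Q_N` is zero, since `∂_N` annihilates the harmonic `0`. Hence that row
of `M_N - I` vanishes and its range lies in a hyperplane. -/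
theorem monodromy_harmZero (h : IsCoeff μ m M) (N : ℕ) (j : Harm N ⊕ Harm N) :
    monodromy μ N (Sum.inr (harmZero N)) j =
      (1 : Matrix (Harm N ⊕ Harm N) (Harm N ⊕ Harm N) ℂ) (Sum.inr (harmZero N)) j := by
  obtain ⟨C, hC⟩ := exists_norm_systemMatrix_le h N
  obtain ⟨Y, hY0, hY1, -, hY⟩ := exists_fundamental (measurable_systemMatrix h N) hC
  have h1 := hY 1 ⟨zero_le_one, le_rfl⟩ (Sum.inr (harmZero N)) j
  have hQ : ∀ y k, systemMatrix μ N y (Sum.inr (harmZero N)) k = 0 := by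
    intro y k
    rcases k with k | k
    · simp only [systemMatrix, Matrix.fromBlocks_apply₂₁, diff_muHat_diff_apply]
      simp [harmZero]
    · simp [systemMatrix]
  have h2 : ∀ y, (systemMatrix μ N y * Y y) (Sum.inr (harmZero N)) j = 0 := fun y => by
    rw [Matrix.mul_apply]
    exact Finset.sum_eq_zero fun k _ => by rw [hQ, zero_mul]
  simp only [h2, intervalIntegral.integral_zero, add_zero] at h1
  rw [hY0, hY1] at h1
  exact h1

theorem memLp_systemMatrix_mul (h : IsCoeff μ m M) (N : ℕ) (i j : Harm N ⊕ Harm N) {f : ℝ → ℂ}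
    (hf : ContinuousOn f (Icc 0 1)) :
    MemLp (fun x => systemMatrix μ N x i j * f x) 2 (volume.restrict (Icc (0 : ℝ) 1)) := by
  obtain ⟨C, hC⟩ := exists_norm_systemMatrix_le h N
  have h1 := ContinuousOn.memLp_Icc hf
  refine h1.of_le_mul (c := C) ((measurable_systemMatrix h N i j).aestronglyMeasurable.mul h1.1)
    (Eventually.of_forall fun x => ?_)
  rw [norm_mul]
  exact mul_le_mul_of_nonneg_right (hC x i j) (norm_nonneg _)

theorem w1_inl (N : ℕ) (n : Harm N) : w1 N (Sum.inl n) = e0 N n := rfl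

theorem w1_inr (N : ℕ) (n : Harm N) : w1 N (Sum.inr n) = 0 := rfl

theorem w2_dotProduct (N : ℕ) (v : Harm N ⊕ Harm N → ℂ) :
    w2 N ⬝ᵥ v = v (Sum.inr (harmZero N)) := by
  rw [dotProduct, Finset.sum_eq_single (Sum.inr (harmZero N))]
  · simp [w2, e0, harmZero]
  · rintro (n | n) _ hn
    · simp [w2]
    · have hn' : (n : ℤ) ≠ 0 := fun h0 => hn (congrArg Sum.inr (Subtype.ext h0))
      simp [w2, e0, hn']
  · exact fun h0 => absurd (Finset.mem_univ _) h0

/-- Preimages under `M_N - I` of multiples of `w₁` are initial values of solutions of the truncated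
system. -/
theorem exists_isBandSolution (h : IsCoeff μ m M) {N : ℕ} {v : Harm N ⊕ Harm N → ℂ} {c : ℂ}
    (hv : (monodromy μ N - 1) *ᵥ v = c • w1 N) :
    ∃ a a' b b', IsBandSolution μ N c a a' b b' ∧ (∀ n, a n 0 = v (Sum.inl n)) ∧
      ∀ n, b n 0 = v (Sum.inr n) := by
  obtain ⟨C, hC⟩ := exists_norm_systemMatrix_le h N
  obtain ⟨Y, hY0, hY1, hYc, hY⟩ := exists_fundamental (measurable_systemMatrix h N) hC
  -- The solution with initial value `v`. Its value at `1` is `M_N v = v + c w₁`, so the first half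
  -- gains `c e₀` and the second half is periodic.
  set ξ : ℝ → Harm N ⊕ Harm N → ℂ := fun x => Y x *ᵥ v with hξ
  set q : ℝ → Harm N ⊕ Harm N → ℂ := fun x => systemMatrix μ N x *ᵥ ξ x with hq
  have hξc : ∀ i, ContinuousOn (fun x => ξ x i) (Icc 0 1) := fun i => by
    simp only [hξ, Matrix.mulVec, dotProduct]
    exact continuousOn_finsetSum _ fun j _ => (hYc i j).mul continuousOn_const
  have hqL : ∀ i, MemLp (fun x => q x i) 2 (volume.restrict (Icc (0 : ℝ) 1)) := fun i => by
    simp only [hq, Matrix.mulVec, dotProduct]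
    exact memLp_finsetSum _ fun j _ => memLp_systemMatrix_mul h N i j (hξc j)
  have hint : ∀ i, ∀ x ∈ Icc (0 : ℝ) 1, ξ x i = ξ 0 i + ∫ y in (0 : ℝ)..x, q y i := by
    intro i x hx
    have e : ∀ y, q y i = ∑ j, (systemMatrix μ N y * Y y) i j * v j := fun y => by
      simp only [hq, hξ, Matrix.mulVec_mulVec]
      rfl
    have hi : ∀ j, IntervalIntegrable (fun y => (systemMatrix μ N y * Y y) i j) volume 0 x := by
      intro j
      have h1 : IntegrableOn (fun y => (systemMatrix μ N y * Y y) i j) (Icc 0 1) := by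
        simp only [Matrix.mul_apply]
        exact integrable_finsetSum _ fun k _ =>
          (memLp_systemMatrix_mul h N i k (hYc k j)).integrable (by norm_num)
      exact (h1.mono_set (uIcc_subset_Icc ⟨le_rfl, zero_le_one⟩ hx)).intervalIntegrable
    simp only [e]
    rw [intervalIntegral.integral_finsetSum fun j _ => (hi j).mul_const _]
    simp only [hξ, Matrix.mulVec, dotProduct, intervalIntegral.integral_mul_const]
    rw [← Finset.sum_add_distrib]
    refine Finset.sum_congr rfl fun j _ => ?_
    rw [hY x hx i j, add_mul]
  have hξ0 : ξ 0 = v := by simp only [hξ, hY0, Matrix.one_mulVec]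
  have hξ1 : ξ 1 = v + c • w1 N := by
    rw [← hv, Matrix.sub_mulVec, Matrix.one_mulVec]
    simp only [hξ, hY1]
    exact (add_sub_cancel v _).symm
  refine ⟨fun n x => ξ x (Sum.inl n), fun n x => q x (Sum.inl n), fun n x => ξ x (Sum.inr n),
    fun n x => q x (Sum.inr n), ⟨fun n => hint _, fun n => hint _, fun n => hξc _, fun n => hξc _,
    fun n => hqL _, fun n => hqL _, fun x => ?_, fun x => ?_, fun n => ?_, fun n => ?_⟩,
    fun n => by simp only [hξ0], fun n => by simp only [hξ0]⟩
  · have e : (fun j => q x (Sum.inl j)) = (muHat μ N x)⁻¹ *ᵥ fun j => ξ x (Sum.inr j) := by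
      funext n
      simp [hq, systemMatrix, Matrix.fromBlocks_mulVec, Function.comp_def]
    rw [e, Matrix.mulVec_mulVec, Matrix.mul_nonsing_inv _ (isUnit_det_muHat h N x),
      Matrix.one_mulVec]
  · funext n
    simp [hq, systemMatrix, Matrix.fromBlocks_mulVec, Function.comp_def]
  · simp only [hξ0, hξ1, Pi.add_apply, Pi.smul_apply, smul_eq_mul, w1_inl]
  · simp only [hξ0, hξ1, Pi.add_apply, Pi.smul_apply, smul_eq_mul, w1_inr, mul_zero, add_zero]

/-- The component of `v` selected by `w₂` is the initial value of the conserved mean flux, hence the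
minimal energy, whichever preimage is taken. -/
theorem mm_value_eq_minVal (h : IsCoeff μ m M) {N : ℕ} {v : Harm N ⊕ Harm N → ℂ}
    (hv : (monodromy μ N - 1) *ᵥ v = w1 N) :
    w2 N ⬝ᵥ v = (minVal (fieldOp (mulOp h)) (gradSpace (freqStrip N)) unitX : ℂ) := by
  obtain ⟨a, a', b, b', hs, -, hb⟩ := exists_isBandSolution h (c := 1) (by rwa [one_smul])
  have h1 := hs.isMinimizer h
  rw [one_smul] at h1
  rw [← h1.inner_eq (isElliptic_fieldOp h), add_sub_cancel, hs.inner_unitX_flux h, hb,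
    w2_dotProduct]

/-- A kernel vector starts a solution without jump, which by `IsBandSolution.eq_zero` is trivial up
to an additive constant of the potential. -/
theorem monodromy_kernel (h : IsCoeff μ m M) {N : ℕ} {v : Harm N ⊕ Harm N → ℂ}
    (hv : (monodromy μ N - 1) *ᵥ v = 0) : v = v (Sum.inl (harmZero N)) • w1 N := by
  obtain ⟨a, a', b, b', hs, ha, hb⟩ := exists_isBandSolution h (c := 0) (by rwa [zero_smul])
  obtain ⟨h1, h2⟩ := hs.eq_zero h
  funext i
  rcases i with n | n
  · rw [Pi.smul_apply, w1_inl, smul_eq_mul, e0]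
    split_ifs with hn
    · rw [mul_one]
      congr 2
      exact Subtype.ext hn
    · rw [mul_zero, ← ha, h1 n hn]
  · rw [Pi.smul_apply, w1_inr, smul_zero, ← hb, h2]

/-- Rank-nullity: the range lies in the hyperplane cut out by the vanishing row, and the kernel has
dimension at most one, so the range is the whole hyperplane. The vector `w₁` belongs to it. -/
theorem exists_mm_preimage (h : IsCoeff μ m M) (N : ℕ) :
    ∃ v, (monodromy μ N - 1) *ᵥ v = w1 N := by
  let T := (monodromy μ N - 1).mulVecLin
  let φ : (Harm N ⊕ Harm N → ℂ) →ₗ[ℂ] ℂ := LinearMap.proj (Sum.inr (harmZero N))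
  have hle : LinearMap.range T ≤ LinearMap.ker φ := by
    rintro _ ⟨v, rfl⟩
    rw [LinearMap.mem_ker]
    change ((monodromy μ N - 1) *ᵥ v) (Sum.inr (harmZero N)) = 0
    simp only [Matrix.mulVec, dotProduct, Matrix.sub_apply, monodromy_harmZero h, sub_self,
      zero_mul, Finset.sum_const_zero]
  have hker : Module.finrank ℂ (LinearMap.ker T) ≤ 1 := by
    have h1 : LinearMap.ker T ≤ Submodule.span ℂ {w1 N} := by
      intro v hv
      rw [LinearMap.mem_ker] at hv
      rw [monodromy_kernel h hv]
      exact Submodule.smul_mem _ _ (Submodule.mem_span_singleton_self _)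
    exact (Submodule.finrank_mono h1).trans
      ((finrank_span_le_card {w1 N}).trans_eq (by simp))
  have hφ : LinearMap.range φ = ⊤ := LinearMap.range_eq_top.mpr fun z => ⟨fun _ => z, rfl⟩
  have d1 := LinearMap.finrank_range_add_finrank_ker T
  have d2 := LinearMap.finrank_range_add_finrank_ker φ
  rw [hφ, finrank_top, Module.finrank_self] at d2
  have heq := Submodule.eq_of_le_of_finrank_le hle (by omega)
  have hw : w1 N ∈ LinearMap.range T := by
    rw [heq, LinearMap.mem_ker]
    rfl
  obtain ⟨v, hv⟩ := hw
  exact ⟨v, hv⟩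

theorem mmBound_eq (h : IsCoeff μ m M) (N : ℕ) :
    mmBound μ N = minVal (fieldOp (mulOp h)) (gradSpace (freqStrip N)) unitX := by
  have hex := exists_mm_preimage h N
  rw [mmBound, dif_pos hex, mm_value_eq_minVal h hex.choose_spec, Complex.ofReal_re]

theorem mmBound_pos (h : IsCoeff μ m M) (N : ℕ) : 0 < mmBound μ N := by
  rw [mmBound_eq h]
  exact minVal_unitX_pos h _

theorem mmWellDefined (h : IsCoeff μ m M) (N : ℕ) : MmWellDefined μ N := by
  obtain ⟨C, hC⟩ := exists_norm_systemMatrix_le h N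
  refine ⟨isUnit_det_muHat h N, summable_peanoTerm (measurable_systemMatrix h N) hC,
    tendsto_riemannProduct_systemMatrix h N, exists_mm_preimage h N, fun v hv => ?_,
    mmBound_pos h N⟩
  rw [mm_value_eq_minVal h hv, mmBound_eq h]

/-! ### Ordering and convergence of the MM bounds -/

theorem freqStrip_mono : Monotone freqStrip := fun N K hNK g hg => by
  simp only [freqStrip, mem_ofPred_eq, Finset.mem_Icc] at hg ⊢
  omega

theorem freqBox_subset_freqStrip (N : ℕ) : freqBox N ⊆ freqStrip N := fun _ hg => hg.2

theorem mmBound_antitone (h : IsCoeff μ m M) : Antitone (mmBound μ) := fun N K hNK => by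
  rw [mmBound_eq h, mmBound_eq h]
  exact (isElliptic_fieldOp h).minVal_anti (gradSpace_mono (freqStrip_mono hNK))

theorem effCoeff_le_mmBound (h : IsCoeff μ m M) (N : ℕ) : effCoeff h ≤ mmBound μ N := by
  rw [mmBound_eq h]
  exact (isElliptic_fieldOp h).minVal_anti (gradSpace_mono (subset_univ _))

theorem mmBound_le_pweBound (h : IsCoeff μ m M) (N : ℕ) : mmBound μ N ≤ pweBound μ N := by
  rw [mmBound_eq h, pweBound_eq h]
  exact (isElliptic_fieldOp h).minVal_anti (gradSpace_mono (freqBox_subset_freqStrip N))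

theorem tendsto_mmBound (h : IsCoeff μ m M) :
    Tendsto (mmBound μ) atTop (𝓝 (effCoeff h)) := by
  obtain ⟨u, hu⟩ := (isElliptic_fieldOp h).exists_isMinimizer (isClosed_gradSpace univ) unitX
  have h1 := (isElliptic_fieldOp h).tendsto_minVal (V := fun N => gradSpace (freqStrip N))
    (fun N K hNK => gradSpace_mono (freqStrip_mono hNK))
    -- Every frequency `g` lies in the strip of half-width `|g₂|`, so the strips exhaust `ℤ²`.
    (fun N => gradSpace_mono (subset_univ _)) hu fun ε hε =>
      exists_gradSpace_near freqStrip_mono (fun g => ⟨g.2.natAbs, by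
        simp only [freqStrip, mem_ofPred_eq, Finset.mem_Icc]
        omega⟩) hu.1 hε
  exact h1.congr fun N => (mmBound_eq h N).symm

end Monodromy

end Phononic

end

/-! ### Assembly of the bounds for `μ` and `μ⁻¹` -/

theorem theorem2 (μ : ℝ × ℝ → ℝ) (hmeas : Measurable μ)
    (hbdd : ∃ m M : ℝ, 0 < m ∧ ∀ x, m ≤ μ x ∧ μ x ≤ M)
    (hper : Phononic.IsPeriodic μ) (hcubic : Phononic.IsCubic μ)
    (κ : ℝ × ℝ) (hκ : κ.1 ^ 2 + κ.2 ^ 2 = 1) :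
    -- all the quantities are well defined
    (Phononic.MuEffWellDefined μ κ ∧
      ∀ N : ℕ, Phononic.PweWellDefined μ N ∧ Phononic.PweWellDefined (Phononic.recip μ) N ∧
        Phononic.MmWellDefined μ N ∧ Phononic.MmWellDefined (Phononic.recip μ) N) ∧
    -- monotone convergence of the upper and of the lower MM bounds
    (Antitone (Phononic.mmBound μ) ∧
      Tendsto (Phononic.mmBound μ) atTop (𝓝 (Phononic.muEff μ κ))) ∧
    (Monotone (Phononic.mmDual μ) ∧
      Tendsto (Phononic.mmDual μ) atTop (𝓝 (Phononic.muEff μ κ))) ∧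
    -- comparison with the PWE bounds
    (∀ N : ℕ, Phononic.pweDual μ N ≤ Phononic.mmDual μ N ∧
      Phononic.mmDual μ N ≤ Phononic.muEff μ κ ∧
      Phononic.muEff μ κ ≤ Phononic.mmBound μ N ∧
      Phononic.mmBound μ N ≤ Phononic.pweBound μ N) ∧
    -- the MM bounds are at least as close to the limit as the PWE bounds
    (∀ N : ℕ, |Phononic.mmBound μ N - Phononic.muEff μ κ|
        ≤ |Phononic.pweBound μ N - Phononic.muEff μ κ| ∧
      |Phononic.mmDual μ N - Phononic.muEff μ κ|
        ≤ |Phononic.pweDual μ N - Phononic.muEff μ κ|) := by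
  obtain ⟨m, M, hm, hb⟩ := hbdd
  have h : Phononic.IsCoeff μ m M :=
    ⟨hmeas, hm, fun x => (hb x).1, fun x => (hb x).2, hper, hcubic⟩
  have hr := h.recip
  have heff := Phononic.muEff_eq h hκ
  have hdual := Phononic.effCoeff_recip h
  have hpos := Phononic.effCoeff_pos h
  have hposr := Phononic.mmBound_pos hr
  -- The upper bounds for `μ⁻¹` converge to its effective coefficient; duality identifies the
  -- reciprocal of that limit with the effective coefficient of `μ`.
  have hmm : Tendsto (Phononic.mmDual μ) atTop (𝓝 (Phononic.muEff μ κ)) := by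
    have h1 := (Phononic.tendsto_mmBound hr).inv₀ (Phononic.effCoeff_pos hr).ne'
    rw [hdual, inv_inv, ← heff] at h1
    exact h1.congr fun N => (one_div _).symm
  have hmono : Monotone (Phononic.mmDual μ) := fun N K hNK =>
    one_div_le_one_div_of_le (hposr K) (Phononic.mmBound_antitone hr hNK)
  have hchain : ∀ N : ℕ, Phononic.pweDual μ N ≤ Phononic.mmDual μ N ∧
      Phononic.mmDual μ N ≤ Phononic.muEff μ κ ∧
      Phononic.muEff μ κ ≤ Phononic.mmBound μ N ∧
      Phononic.mmBound μ N ≤ Phononic.pweBound μ N := fun N =>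
    ⟨one_div_le_one_div_of_le (hposr N) (Phononic.mmBound_le_pweBound hr N),
      -- A monotone sequence stays below its limit, so the lower bound needs no separate variational
      -- argument.
      hmono.ge_of_tendsto hmm N, heff ▸ Phononic.effCoeff_le_mmBound h N,
      Phononic.mmBound_le_pweBound h N⟩
  refine ⟨⟨Phononic.muEffWellDefined h hκ, fun N => ⟨Phononic.pweWellDefined h N,
    Phononic.pweWellDefined hr N, Phononic.mmWellDefined h N, Phononic.mmWellDefined hr N⟩⟩,
    ⟨Phononic.mmBound_antitone h, heff ▸ Phononic.tendsto_mmBound h⟩, ⟨hmono, hmm⟩, hchain,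
    fun N => ?_⟩
  obtain ⟨h1, h2, h3, h4⟩ := hchain N
  constructor
  · rw [abs_of_nonneg (sub_nonneg.mpr h3), abs_of_nonneg (sub_nonneg.mpr (h3.trans h4))]
    exact sub_le_sub_right h4 _
  · rw [abs_of_nonpos (sub_nonpos.mpr h2), abs_of_nonpos (sub_nonpos.mpr (h1.trans h2))]
    exact neg_le_neg (sub_le_sub_right h1 _)
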